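/- Let $\lambda,c,d>0$ and $\alpha\in\mathbb R$. For every $\pi\in[0,1]$ let $\mathbb P_\pi$ be a probability measure under which $W$ is a standard Brownian motion with continuous paths and $\Theta$ is a random variable independent of $W$ with $\mathbb P_\pi(\Theta=0)=\pi$ and $\mathbb P_\pi(\Theta>t)=(1-\pi)e^{-\lambda t}$ for $t\ge 0$; put $X_t=\alpha(t-\Theta)^++W_t$. An observation strategy $\hat\tau\in\mathcal T$ is a sequence $0=\tau_0<\tau_1<\tau_2<\cdots$ of $[0,\infty]$-valued random variables (strictly increasing as long as they are finite; $\tau_k=\infty$ means that the $k$-th observation is not made) such that $\tau_1$ is deterministic and, for $j\ge 2$, $\tau_j$ is $\sigma(X_{\tau_1},\dots,X_{\tau_{j-1}},\tau_1,\dots,\tau_{j-1})$-measurable. Let $\mathcal F^{\hat\tau}_t$ be the $\sigma$-algebra generated by the observations $(\tau_k,X_{\tau_k})$, $k\ge1$, with $\tau_k\le t$, let $\Pi^{\hat\tau}_t=\mathbb P_\pi(\Theta\le t\mid\mathcal F^{\hat\tau}_t)$ (right-continuous version), and let $\mathcal S^{\hat\tau}_0$ be the set of $(\mathcal F^{\hat\tau}_t)_{t\ge0}$-stopping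 times $\tau$ such that $\mathbb P_\pi$-a.s. $\tau=\tau_k$ for some $k=k(\omega)\ge 0$. Let $$F(\pi)=\inf_{t\ge0}\Big\{(1-\pi)e^{-\lambda t}+ct-c(1-\pi)\frac{1-e^{-\lambda t}}{\lambda}\Big\}$$ be the optimal cost without observations, and for $n\ge 0$ let $$V_n(\pi)=\inf_{\hat\tau\in\mathcal T}\ \inf_{\tau\in\mathcal S^{\hat\tau}_0,\ \tau\le\tau_n}\mathbb E_\pi\Big[F(\Pi^{\hat\tau}_\tau)+c\int_0^\tau\Pi^{\hat\tau}_s\,ds+d\sum_{k=1}^\infty \mathbf 1_{\{\tau_k\le\tau\}}\Big]$$ be the value of the problem in which at most $n$ observations may be made. For $t>0$, $\pi\in[0,1)$, $x\in\mathbb R$ let $$j(t,\pi,x)=e^{\alpha x+(\lambda-\alpha^2/2)t}\frac{\pi}{1-\pi}+\lambda\int_0^t e^{(\lambda+\alpha x/t)u-\alpha^2u^2/(2t)}\,du,$$ with the convention $\frac{j}{1+j}=1$ for $\pi=1$. Define $$\mathcal Jf(\pi)=\min\Big\{F(\pi),\ \inf_{t>0}\Big(d+\mathbb E_\pi\Big[f\Big(\frac{j(t,\pi,X_t)}{1+j(t,\pi,X_t)}\Big)+c(t-\Theta)^+\Big]\Big)\Big\},$$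 and $f_0=F$, $f_{n+1}=\mathcal Jf_n$. Then $V_n(\pi)=f_n(\pi)$ for all $n\ge0$ and all $\pi\in[0,1]$. -/

import Mathlib

open MeasureTheory ProbabilityTheory
open scoped NNReal ENNReal

/-- The Wiener disorder model. On one measurable space `Ω` there are a process `W`, a random time
`Θ` and, for each prior `p ∈ [0, 1]`, a probability measure `P p` under which `W` is a standard
Brownian motion (with continuous paths), `Θ` is independent of `W`, and
`P p (Θ = 0) = p`, `P p (Θ > t) = (1 - p) exp (-lam t)` for `t ≥ 0`.
The parameter `α` is the drift after the disorder, `lam` is the disorder rate. -/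
structure DisorderModel (Ω : Type*) [MeasurableSpace Ω] (α lam : ℝ) where
  P : ℝ → Measure Ω
  W : ℝ≥0 → Ω → ℝ
  Θ : Ω → ℝ
  isProbabilityMeasure : ∀ p ∈ Set.Icc (0 : ℝ) 1, IsProbabilityMeasure (P p)
  measurable_W : ∀ t, Measurable (W t)
  continuous_W : ∀ ω, Continuous fun t => W t ω
  isBrownian : ∀ p ∈ Set.Icc (0 : ℝ) 1, IsBrownianReal W (P p)
  measurable_Θ : Measurable Θ
  prob_Θ_eq_zero : ∀ p ∈ Set.Icc (0 : ℝ) 1, P p {ω | Θ ω = 0} = ENNReal.ofReal p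
  prob_Θ_gt : ∀ p ∈ Set.Icc (0 : ℝ) 1, ∀ t : ℝ, 0 ≤ t →
    P p {ω | t < Θ ω} = ENNReal.ofReal ((1 - p) * Real.exp (-lam * t))
  indep : ∀ p ∈ Set.Icc (0 : ℝ) 1, IndepFun Θ (fun ω t => W t ω) (P p)

/-- The posterior probability of a disorder at time `t` when nothing is observed on `[0, t]` and
the prior probability is `p`. -/
noncomputable def noObservationPosterior (lam p t : ℝ) : ℝ :=
  1 - (1 - p) * Real.exp (-lam * t)

/-- The optimal cost `F p = inf_{t ≥ 0} (1 - Π_t + c ∫_0^t Π_s ds)` when no observation is made. -/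
noncomputable def noObservationCost (lam c p : ℝ) : ℝ :=
  ⨅ t : ℝ≥0, (1 - noObservationPosterior lam p t +
    c * ∫ s in (0 : ℝ)..t, noObservationPosterior lam p s)

/-- The posterior odds `j(t, p, x)` of a disorder when the increment of the observation process
over a time span of length `t > 0` equals `x` and the prior probability is `p < 1`. -/
noncomputable def posteriorOdds (α lam t p x : ℝ) : ℝ :=
  Real.exp (α * x + (lam - α ^ 2 / 2) * t) * (p / (1 - p)) +
    lam * ∫ u in (0 : ℝ)..t,
      Real.exp ((lam + α * x / t) * u - α ^ 2 * u ^ 2 / (2 * t))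

/-- The updated probability `j / (1 + j)`; for the prior `p = 1`, where `j = ∞`, it equals `1`. -/
noncomputable def updatedPosterior (α lam t p x : ℝ) : ℝ :=
  if p = 1 then 1
  else posteriorOdds α lam t p x / (1 + posteriorOdds α lam t p x)

namespace DisorderModel

variable {Ω : Type*} [MeasurableSpace Ω] {α lam : ℝ}

/-- The observation process `X_t = α (t - Θ)⁺ + W_t`. -/
noncomputable def X (M : DisorderModel Ω α lam) (t : ℝ≥0) (ω : Ω) : ℝ :=
  α * max ((t : ℝ) - M.Θ ω) 0 + M.W t ω

/-- `J₀ f(p, t) = d + E_p [f (j(t, p, X_t) / (1 + j(t, p, X_t))) + c (t - Θ)⁺]`. -/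
noncomputable def jumpCost (M : DisorderModel Ω α lam) (c d : ℝ) (f : ℝ → ℝ) (p : ℝ) (t : ℝ≥0) :
    ℝ :=
  d + ∫ ω, (f (updatedPosterior α lam t p (M.X t ω)) + c * max ((t : ℝ) - M.Θ ω) 0) ∂(M.P p)

/-- The jump operator `J f(p) = min {F(p), inf_{t > 0} J₀ f(p, t)}`. -/
noncomputable def jumpOperator (M : DisorderModel Ω α lam) (c d : ℝ) (f : ℝ → ℝ) (p : ℝ) : ℝ :=
  min (noObservationCost lam c p) (⨅ t : {t : ℝ≥0 // 0 < t}, M.jumpCost c d f p t)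

/-- The iterates `f_0 = F`, `f_{n+1} = J f_n`. -/
noncomputable def iterates (M : DisorderModel Ω α lam) (c d : ℝ) : ℕ → ℝ → ℝ
  | 0 => noObservationCost lam c
  | n + 1 => M.jumpOperator c d (M.iterates c d n)

/-- The pair `(σ, X_σ)` for a random time `σ` with values in `[0, ∞]`. If `σ = ∞`, nothing is
observed, and the second entry is `0` by convention. -/
noncomputable def observation (M : DisorderModel Ω α lam) (σ : Ω → ℝ≥0∞) (ω : Ω) : ℝ≥0∞ × ℝ :=
  (σ ω, if σ ω = ⊤ then 0 else M.X (σ ω).toNNReal ω)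

/-- A sequence of observation times `0 = τ_0 < τ_1 < τ_2 < ⋯`, strictly increasing as long as it is
finite (`τ_k = ∞` means that the `k`-th observation is never made), such that `τ_1` is
deterministic and `τ_{j+1}` is measurable with respect to
`σ(X_{τ_1}, …, X_{τ_j}, τ_1, …, τ_j)` for `j ≥ 1`. -/
structure ObservationStrategy (M : DisorderModel Ω α lam) where
  time : ℕ → Ω → ℝ≥0∞
  time_zero : ∀ ω, time 0 ω = 0
  time_lt : ∀ k ω, time k ω ≠ ⊤ → time k ω < time (k + 1) ω
  time_top : ∀ k ω, time k ω = ⊤ → time (k + 1) ω = ⊤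
  time_one : ∃ t : ℝ≥0∞, ∀ ω, time 1 ω = t
  measurable_time_succ : ∀ j : ℕ, 1 ≤ j →
    Measurable[⨆ i ∈ Finset.Icc 1 j,
      MeasurableSpace.comap (M.observation (time i)) inferInstance] (time (j + 1))

theorem measurable_X (M : DisorderModel Ω α lam) (t : ℝ≥0) : Measurable (M.X t) :=
  (((measurable_const.sub M.measurable_Θ).max measurable_const).const_mul α).add (M.measurable_W t)

theorem continuous_X (M : DisorderModel Ω α lam) (ω : Ω) : Continuous fun t => M.X t ω := by
  have h := M.continuous_W ω
  unfold X
  fun_prop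

theorem measurable_observation (M : DisorderModel Ω α lam) {σ : Ω → ℝ≥0∞} (hσ : Measurable σ) :
    Measurable (M.observation σ) := by
  have h : Measurable (Function.uncurry M.X) :=
    measurable_uncurry_of_continuous_of_measurable M.continuous_X M.measurable_X
  have h' : Measurable fun ω => M.X (σ ω).toNNReal ω :=
    h.comp (hσ.ennreal_toNNReal.prodMk measurable_id)
  exact hσ.prodMk (Measurable.ite (hσ (measurableSet_singleton _)) measurable_const h')

namespace ObservationStrategy

variable {M : DisorderModel Ω α lam}

theorem measurable_time (S : M.ObservationStrategy) (k : ℕ) : Measurable (S.time k) := by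
  induction k using Nat.strong_induction_on with
  | _ k ih =>
    match k, ih with
    | 0, _ =>
      have h : S.time 0 = fun _ => 0 := funext S.time_zero
      rw [h]
      exact measurable_const
    | 1, _ =>
      obtain ⟨t, ht⟩ := S.time_one
      have h : S.time 1 = fun _ => t := funext ht
      rw [h]
      exact measurable_const
    | j + 2, ih =>
      refine (S.measurable_time_succ (j + 1) (by omega)).mono ?_ le_rfl
      refine iSup₂_le fun i hi => ?_
      have hi' : i ≤ j + 1 := (Finset.mem_Icc.mp hi).2
      exact (M.measurable_observation (ih i (by omega))).comap_le

/-- The `(k+1)`-st observation as recorded at time `t`: the pair `(τ_{k+1}, X_{τ_{k+1}})` if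
`τ_{k+1} ≤ t`, and the value `(0, 0)`, which no observation made so far can have because
`τ_{k+1} > 0`, otherwise. -/
noncomputable def record (S : M.ObservationStrategy) (t : ℝ≥0) (k : ℕ) (ω : Ω) : ℝ≥0∞ × ℝ :=
  if S.time (k + 1) ω ≤ t then M.observation (S.time (k + 1)) ω else (0, 0)

/-- The filtration generated by the observations: at time `t` it is generated by all pairs
`(τ_k, X_{τ_k})`, `k ≥ 1`, with `τ_k ≤ t`. -/
noncomputable def filtration (S : M.ObservationStrategy) :
    Filtration ℝ≥0 (inferInstance : MeasurableSpace Ω) where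
  seq t := ⨆ k : ℕ, MeasurableSpace.comap (S.record t k) inferInstance
  mono' := by
    intro s t hst
    refine iSup_mono fun k => ?_
    have hst' : (s : ℝ≥0∞) ≤ t := by exact_mod_cast hst
    let g : ℝ≥0∞ × ℝ → ℝ≥0∞ × ℝ := fun x => if x.1 ≤ s then x else (0, 0)
    have hg : Measurable g :=
      Measurable.ite (measurable_fst measurableSet_Iic) measurable_id measurable_const
    have hcomp : S.record s k = g ∘ S.record t k := by
      funext ω
      by_cases h1 : S.time (k + 1) ω ≤ s
      · have h2 : S.time (k + 1) ω ≤ t := h1.trans hst'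
        simp [g, record, h1, h2, observation]
      · by_cases h2 : S.time (k + 1) ω ≤ t
        · simp [g, record, h1, h2, observation]
        · simp [g, record, h1, h2]
    rw [hcomp, ← MeasurableSpace.comap_comp]
    exact MeasurableSpace.comap_mono hg.comap_le
  le' := by
    intro t
    refine iSup_le fun k => ?_
    have h : Measurable (S.record t k) :=
      Measurable.ite ((S.measurable_time (k + 1)) measurableSet_Iic)
        (M.measurable_observation (S.measurable_time (k + 1))) measurable_const
    exact h.comap_le

/-- `A` is (a right-continuous version of) the a posteriori probability process
`Π_t = P_p (Θ ≤ t | F_t)`. Any two such versions are indistinguishable. -/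
def IsPosterior (S : M.ObservationStrategy) (p : ℝ) (A : ℝ≥0 → Ω → ℝ) : Prop :=
  (∀ ω t, ContinuousWithinAt (fun s => A s ω) (Set.Ici t) t) ∧
  ∀ t : ℝ≥0, A t =ᵐ[M.P p]
    (M.P p)[Set.indicator {ω | M.Θ ω ≤ t} (fun _ => (1 : ℝ)) | S.filtration t]

/-- The stopping times `τ` of the observation filtration such that almost surely `τ = τ_k` for some
`k ≥ 0`, where `τ_0 = 0`. -/
def IsObservationStoppingTime (S : M.ObservationStrategy) (p : ℝ) (τ : Ω → ℝ≥0∞) : Prop :=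
  IsStoppingTime S.filtration τ ∧ ∀ᵐ ω ∂(M.P p), ∃ k : ℕ, τ ω = S.time k ω

/-- The expected cost `E_p [F(Π_τ) + c ∫_0^τ Π_s ds + d ∑_{k ≥ 1} 1_{τ_k ≤ τ}]`. It is `∞` as soon
as `τ = ∞` with positive probability, whatever value is used for `Π_∞`. -/
noncomputable def cost (S : M.ObservationStrategy) (c d p : ℝ) (A : ℝ≥0 → Ω → ℝ)
    (τ : Ω → ℝ≥0∞) : ℝ≥0∞ :=
  ∫⁻ ω, (ENNReal.ofReal (noObservationCost lam c (A (τ ω).toNNReal ω)) +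
    ENNReal.ofReal c * (∫⁻ s in {s : ℝ | 0 ≤ s ∧ ENNReal.ofReal s ≤ τ ω},
      ENNReal.ofReal (A s.toNNReal ω)) +
    ENNReal.ofReal d * ∑' k : ℕ, (if S.time (k + 1) ω ≤ τ ω then 1 else 0)) ∂(M.P p)

end ObservationStrategy

/-- The value `V_n(p)` of the problem in which at most `n` observations may be made: the infimum
of the cost over all observation strategies and all stopping times `τ ≤ τ_n` that almost surely
take values among the observation times `τ_0 = 0, τ_1, τ_2, …`. -/
noncomputable def value (M : DisorderModel Ω α lam) (c d : ℝ) (n : ℕ) (p : ℝ) : ℝ≥0∞ :=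
  ⨅ (S : M.ObservationStrategy) (τ : Ω → ℝ≥0∞) (_ : S.IsObservationStoppingTime p τ)
    (_ : ∀ᵐ ω ∂(M.P p), τ ω ≤ S.time n ω) (A : ℝ≥0 → Ω → ℝ) (_ : S.IsPosterior p A),
    S.cost c d p A τ

end DisorderModel

open Filter Set
open scoped Topology

/-! ### Upper semicontinuity -/

/-! The theorem is a dynamic programming principle whose state is the posterior probability at the
observation times. Everything is done in `ℝ≥0∞` for functions on the unit interval: `dpValue` is the
iterate there, `value_eq_dpValue` identifies it with the value, and `iterates_eq_dpValue` goes back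
to real numbers.

Filtering. Let Π_k be the result of k applications of the explicit update j / (1 + j) to the prior.
By induction on k (`isFilteredAt`), given the first k observations the residual time (Θ - τ_k)⁺ has
the law Π_k δ₀ + (1 - Π_k) Exp(lam), which is the prior law with Π_k in place of p. The inductive
step has two ingredients. The endpoints of [τ_k, τ_{k+1}] are random but known at τ_k, so given Θ
and the history the Brownian increment over this interval is centred normal with variance τ_{k+1} -
τ_k (`setLIntegral_random_increment`). Bayes' formula for a single observation (`transition_bayes`)
then turns one mixture into the next; it rests on the memorylessness of the exponential law and on
the ratio of shifted Gaussian densities. Hence between observations the posterior evolves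
deterministically (`condExp_eq_posteriorAfter`), and right-continuity forces every admissible
version of Π to follow this formula (`IsPosterior.ae_eq`).

Lower bound. A stopping time that takes values among the observation times decides at τ_k, from the
first k observations alone, whether to stop (`measurableSet_stop`). Splitting the remaining cost at
the next observation and inducting on the number of observations left shows that no strategy beats
`dpValue` (`dpValue_le_cost`).

Upper bound. A nearly optimal waiting time has to be chosen measurably in the posterior. The update
is jointly continuous in time, prior and increment, even at time 0, so reverse Fatou and stability
under infima make every iterate upper semicontinuous. Strict sublevel sets in t are then open, and
the first good member of a dense sequence of times is a measurable choice
(`exists_measurable_waitingTime`). Following these choices loses at most ε per observation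
(`cost_le_dpValue`). -/

theorem UpperSemicontinuous.comp_continuous_map {X Y γ : Type*} [TopologicalSpace X]
    [TopologicalSpace Y] [LinearOrder γ] {f : Y → γ} (hf : UpperSemicontinuous f) {g : X → Y}
    (hg : Continuous g) : UpperSemicontinuous fun x => f (g x) :=
  fun x y hy => (hg.tendsto x).eventually (hf (g x) y hy)

theorem UpperSemicontinuous.limsup_seq_le {X γ : Type*} [TopologicalSpace X]
    [CompleteLinearOrder γ] {f : X → γ} (hf : UpperSemicontinuous f) {u : ℕ → X} {x : X}
    (hu : Tendsto u atTop (𝓝 x)) : limsup (fun n => f (u n)) atTop ≤ f x := by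
  refine le_trans ?_ (upperSemicontinuousAt_iff_limsup_le.1 (hf x))
  exact limsup_le_limsup_of_le (u := f) hu

/-- Reverse Fatou, with the constant 1 as integrable majorant. Fatou is a statement about sequences,
so closedness of the superlevel sets is tested along sequences; this is why the space is sequential.
-/
theorem upperSemicontinuous_lintegral {X Ω : Type*} [TopologicalSpace X] [SequentialSpace X]
    [MeasurableSpace Ω] {μ : Measure Ω} [IsFiniteMeasure μ] {h : X → Ω → ℝ≥0∞}
    (hm : ∀ x, Measurable (h x)) (hu : ∀ ω, UpperSemicontinuous fun x => h x ω)
    (hb : ∀ x ω, h x ω ≤ 1) : UpperSemicontinuous fun x => ∫⁻ ω, h x ω ∂μ := by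
  rw [upperSemicontinuous_iff_isClosed_preimage]
  intro a
  refine IsSeqClosed.isClosed fun u x hua hux => ?_
  have hfin : ∫⁻ _, (1 : ℝ≥0∞) ∂μ ≠ ∞ := by simp
  calc a ≤ limsup (fun n => ∫⁻ ω, h (u n) ω ∂μ) atTop :=
        le_limsup_of_frequently_le (Frequently.of_forall hua)
    _ ≤ ∫⁻ ω, limsup (fun n => h (u n) ω) atTop ∂μ :=
        limsup_lintegral_le _ (fun n => hm (u n)) (fun n => Eventually.of_forall (hb (u n))) hfin
    _ ≤ ∫⁻ ω, h x ω ∂μ := lintegral_mono fun ω => (hu ω).limsup_seq_le hux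

/-- The limsup of a product is at most the product of the limsups unless 0 · ∞ occurs; finiteness of
`w` and the bound on `f` exclude that. -/
theorem UpperSemicontinuous.continuous_mul {X : Type*} [TopologicalSpace X] {w f : X → ℝ≥0∞}
    (hw : Continuous w) (hwt : ∀ x, w x ≠ ∞) (hf : UpperSemicontinuous f) (hft : ∀ x, f x ≤ 1) :
    UpperSemicontinuous fun x => w x * f x := by
  intro x
  refine upperSemicontinuousAt_iff_limsup_le.2 ?_
  have hlw : limsup w (𝓝 x) = w x := (hw.tendsto x).limsup_eq
  have hlf : limsup f (𝓝 x) ≤ f x := upperSemicontinuousAt_iff_limsup_le.1 (hf x)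
  refine (ENNReal.limsup_mul_le' (u := w) (v := f) (Or.inr ?_) (Or.inl ?_)).trans ?_
  · exact ((hlf.trans (hft x)).trans_lt ENNReal.one_lt_top).ne
  · rw [hlw]; exact hwt x
  · rw [hlw]; gcongr

/-! ### The Bayesian update of the posterior probability -/

/-- The integral term of `posteriorOdds`, rescaled to the unit interval. -/
noncomputable def oddsIntegral (α lam t x : ℝ) : ℝ :=
  lam * (t * ∫ v in (0 : ℝ)..1, Real.exp ((lam * t + α * x) * v - α ^ 2 * t * v ^ 2 / 2))

/-- The rescaled integrand contains no division by t, so continuity holds up to and including t = 0.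
-/
theorem continuous_oddsIntegral (α lam : ℝ) :
    Continuous fun q : ℝ × ℝ => oddsIntegral α lam q.1 q.2 := by
  unfold oddsIntegral
  refine continuous_const.mul (continuous_fst.mul ?_)
  refine intervalIntegral.continuous_parametric_intervalIntegral_of_continuous' ?_ 0 1
  unfold Function.uncurry
  fun_prop

theorem oddsIntegral_nonneg {α lam t x : ℝ} (hlam : 0 ≤ lam) (ht : 0 ≤ t) :
    0 ≤ oddsIntegral α lam t x :=
  mul_nonneg hlam (mul_nonneg ht
    (intervalIntegral.integral_nonneg zero_le_one fun _ _ => (Real.exp_pos _).le))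

theorem oddsIntegral_eq (α lam t x : ℝ) :
    oddsIntegral α lam t x = lam * ∫ u in (0 : ℝ)..t,
      Real.exp ((lam + α * x / t) * u - α ^ 2 * u ^ 2 / (2 * t)) := by
  rcases eq_or_ne t 0 with rfl | ht
  · simp [oddsIntegral]
  · have h := intervalIntegral.smul_integral_comp_mul_left (a := 0) (b := 1)
      (fun u => Real.exp ((lam + α * x / t) * u - α ^ 2 * u ^ 2 / (2 * t))) t
    rw [mul_zero, mul_one, smul_eq_mul] at h
    rw [← h, oddsIntegral]
    congr 3 with v
    congr 1
    field_simp

/-- The likelihood factor of the first term of `posteriorOdds`. -/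
noncomputable def oddsFactor (α lam t x : ℝ) : ℝ := Real.exp (α * x + (lam - α ^ 2 / 2) * t)

/-- Numerator and denominator of j / (1 + j) are multiplied by 1 - p. This removes the pole of the
odds at p = 1 and absorbs the convention made there, so a single formula, continuous in p, covers
the whole interval. -/
theorem updatedPosterior_eq (α lam t p x : ℝ) :
    updatedPosterior α lam t p x =
      (oddsFactor α lam t x * p + oddsIntegral α lam t x * (1 - p)) /
        (oddsFactor α lam t x * p + (oddsIntegral α lam t x + 1) * (1 - p)) := by
  unfold updatedPosterior
  split_ifs with h
  · subst h
    have : oddsFactor α lam t x ≠ 0 := (Real.exp_pos _).ne'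
    simp [this]
  · have h1 : 1 - p ≠ 0 := sub_ne_zero.2 (Ne.symm h)
    rw [← mul_div_mul_right _ _ h1, posteriorOdds, ← oddsIntegral_eq, ← oddsFactor]
    congr 1
    · field_simp
    · field_simp
      ring

/-- The probability density of the increment, up to the factor `exp (-lam t)`. -/
noncomputable def incrementDensity (α lam t p x : ℝ) : ℝ :=
  oddsFactor α lam t x * p + (oddsIntegral α lam t x + 1) * (1 - p)

theorem incrementDensity_pos {α lam t p x : ℝ} (hlam : 0 ≤ lam) (ht : 0 ≤ t)
    (hp : p ∈ Icc (0 : ℝ) 1) : 0 < incrementDensity α lam t p x := by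
  have ha : 0 < oddsFactor α lam t x := Real.exp_pos _
  have hb : 0 ≤ oddsIntegral α lam t x := oddsIntegral_nonneg hlam ht
  obtain ⟨h0, h1⟩ := hp
  unfold incrementDensity
  rcases h0.eq_or_lt with rfl | h0
  · simp; linarith
  · have := mul_pos ha h0
    have := mul_nonneg (by linarith : 0 ≤ oddsIntegral α lam t x + 1) (sub_nonneg.2 h1)
    linarith

theorem updatedPosterior_mem_Icc {α lam t p x : ℝ} (hlam : 0 ≤ lam) (ht : 0 ≤ t)
    (hp : p ∈ Icc (0 : ℝ) 1) : updatedPosterior α lam t p x ∈ Icc (0 : ℝ) 1 := by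
  have hD := incrementDensity_pos (α := α) (x := x) hlam ht hp
  have ha : 0 < oddsFactor α lam t x := Real.exp_pos _
  have hb : 0 ≤ oddsIntegral α lam t x := oddsIntegral_nonneg hlam ht
  obtain ⟨h0, h1⟩ := hp
  rw [updatedPosterior_eq, ← incrementDensity]
  refine ⟨div_nonneg ?_ hD.le, (div_le_one hD).2 ?_⟩
  · exact add_nonneg (mul_nonneg ha.le h0) (mul_nonneg hb (sub_nonneg.2 h1))
  · unfold incrementDensity; nlinarith

/-- The update of a posterior probability `p` after an increment `x` over a time span `t`. -/
noncomputable def posteriorUpdate (α lam : ℝ) (t : ℝ≥0) (p : unitInterval) (x : ℝ) :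
    unitInterval :=
  projIcc 0 1 zero_le_one (updatedPosterior α lam t p x)

theorem coe_posteriorUpdate {α lam : ℝ} (hlam : 0 ≤ lam) (t : ℝ≥0) (p : unitInterval) (x : ℝ) :
    (posteriorUpdate α lam t p x : ℝ) = updatedPosterior α lam t p x := by
  have h := updatedPosterior_mem_Icc (α := α) (x := x) hlam t.coe_nonneg p.2
  rw [posteriorUpdate, projIcc_of_mem _ h]

theorem continuous_posteriorUpdate {α lam : ℝ} (hlam : 0 ≤ lam) :
    Continuous fun q : ℝ≥0 × unitInterval × ℝ => posteriorUpdate α lam q.1 q.2.1 q.2.2 := by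
  refine continuous_projIcc.comp ?_
  simp only [updatedPosterior_eq]
  have hb : Continuous fun q : ℝ≥0 × unitInterval × ℝ =>
      oddsIntegral α lam (q.1 : ℝ) q.2.2 :=
    (continuous_oddsIntegral α lam).comp (by fun_prop :
      Continuous fun q : ℝ≥0 × unitInterval × ℝ => ((q.1 : ℝ), q.2.2))
  have ha : Continuous fun q : ℝ≥0 × unitInterval × ℝ =>
      oddsFactor α lam (q.1 : ℝ) q.2.2 := by
    unfold oddsFactor; fun_prop
  refine Continuous.div (by fun_prop) (by fun_prop) fun q => ?_
  exact (incrementDensity_pos hlam q.1.coe_nonneg q.2.1.2).ne'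

/-! ### The prior and the transition of the posterior -/

/-- The integral of `h` with respect to the law `p δ₀ + (1 - p) Exp(lam)` of the disorder time. -/
noncomputable def priorMix (lam p : ℝ) (h : ℝ → ℝ≥0∞) : ℝ≥0∞ :=
  ENNReal.ofReal p * h 0 + ENNReal.ofReal (1 - p) * ∫⁻ θ, h θ ∂expMeasure lam

/-- The expectation of `χ (X_t, (Θ - t)⁺)` for the prior probability `p`. -/
noncomputable def transition (α lam : ℝ) (t : ℝ≥0) (p : ℝ) (χ : ℝ → ℝ → ℝ≥0∞) : ℝ≥0∞ :=
  priorMix lam p fun θ => ∫⁻ z, χ (α * max ((t : ℝ) - θ) 0 + √(t : ℝ) * z) (max (θ - t) 0)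
    ∂gaussianReal 0 1

theorem priorMix_const {lam p : ℝ} (hlam : 0 < lam) (hp : p ∈ Icc (0 : ℝ) 1) (a : ℝ≥0∞) :
    priorMix lam p (fun _ => a) = a := by
  have := isProbabilityMeasure_expMeasure hlam
  rw [priorMix, lintegral_const, measure_univ, mul_one, ← add_mul,
    ← ENNReal.ofReal_add hp.1 (sub_nonneg.2 hp.2)]
  simp

theorem lintegral_expMeasure (lam : ℝ) (h : ℝ → ℝ≥0∞) :
    ∫⁻ θ, h θ ∂expMeasure lam =
      ∫⁻ θ in Ioi 0, ENNReal.ofReal (lam * Real.exp (-lam * θ)) * h θ := by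
  have hm : Measurable (exponentialPDF lam) :=
    (measurable_exponentialPDFReal lam).ennreal_ofReal
  have e : expMeasure lam = volume.withDensity (exponentialPDF lam) := rfl
  rw [e, lintegral_withDensity_eq_lintegral_mul_non_measurable _ hm
    (Eventually.of_forall fun _ => ENNReal.ofReal_lt_top), setLIntegral_congr Ioi_ae_eq_Ici,
    ← lintegral_indicator measurableSet_Ici]
  congr 1 with θ
  by_cases hθ : 0 ≤ θ
  · rw [indicator_of_mem (mem_Ici.2 hθ), Pi.mul_apply, exponentialPDF_of_nonneg hθ, neg_mul]
  · rw [indicator_of_notMem (by simpa using hθ), Pi.mul_apply,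
      exponentialPDF_of_neg (not_le.1 hθ), zero_mul]

theorem ae_pos_expMeasure (lam : ℝ) : ∀ᵐ θ ∂expMeasure lam, 0 < θ := by
  rw [ae_iff, ← lintegral_indicator_one (by measurability), lintegral_expMeasure]
  refine (setLIntegral_congr_fun measurableSet_Ioi fun θ hθ => ?_).trans lintegral_zero
  have : θ ∉ {a : ℝ | ¬ 0 < a} := by simpa using hθ
  rw [indicator_of_notMem this, mul_zero]

/-- The weight is the ratio of the densities of N(m, t) and N(0, t). All drifts are thereby
integrated against one reference law, as Bayes' formula requires. -/
theorem lintegral_gaussianReal_shift {t : ℝ≥0} (ht : t ≠ 0) (m : ℝ) {f : ℝ → ℝ≥0∞}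
    (hf : Measurable f) :
    ∫⁻ z, f (m + √(t : ℝ) * z) ∂gaussianReal 0 1 =
      ∫⁻ x, ENNReal.ofReal (Real.exp (m * x / t - m ^ 2 / (2 * t))) * f x ∂gaussianReal 0 t := by
  have h1 : (gaussianReal 0 1).map (fun z => m + √(t : ℝ) * z) = gaussianReal m t := by
    have : (fun z => m + √(t : ℝ) * z) = (m + ·) ∘ (√(t : ℝ) * ·) := rfl
    rw [this, ← Measure.map_map (by fun_prop) (by fun_prop), gaussianReal_map_const_mul,
      gaussianReal_map_const_add]
    congr 1
    · simp
    · ext; simp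
  rw [← lintegral_map hf (by fun_prop), h1, gaussianReal_of_var_ne_zero _ ht,
    gaussianReal_of_var_ne_zero _ ht,
    lintegral_withDensity_eq_lintegral_mul _ (measurable_gaussianPDF _ _) hf,
    lintegral_withDensity_eq_lintegral_mul _ (measurable_gaussianPDF _ _) (by fun_prop)]
  congr 1 with x
  simp only [Pi.mul_apply]
  rw [← mul_assoc, gaussianPDF, gaussianPDF, ← ENNReal.ofReal_mul (gaussianPDFReal_nonneg _ _ _)]
  congr 2
  rw [gaussianPDFReal, gaussianPDFReal, mul_assoc _ (Real.exp _) (Real.exp _), ← Real.exp_add]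
  congr 2
  have : (t : ℝ) ≠ 0 := by exact_mod_cast ht
  field_simp
  ring

/-- Memorylessness: beyond t the exponential law is a shifted copy of itself with mass exp(-lam t).
Up to t the variable is u = t - θ, the time elapsed since the disorder. -/
theorem lintegral_expMeasure_split (lam : ℝ) {t : ℝ} (ht : 0 ≤ t)
    {h : ℝ → ℝ≥0∞} :
    ∫⁻ θ, h θ ∂expMeasure lam =
      (∫⁻ u in Ico 0 t, ENNReal.ofReal (lam * Real.exp (-lam * (t - u))) * h (t - u)) +
      ENNReal.ofReal (Real.exp (-lam * t)) * ∫⁻ θ, h (θ + t) ∂expMeasure lam := by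
  rw [lintegral_expMeasure lam h, lintegral_expMeasure lam fun θ => h (θ + t)]
  have hu := lintegral_union (μ := volume)
    (f := fun θ => ENNReal.ofReal (lam * Real.exp (-lam * θ)) * h θ) measurableSet_Ioi
    (Ioc_disjoint_Ioi (a := 0) (le_refl t))
  rw [Ioc_union_Ioi_eq_Ioi ht] at hu
  rw [hu]
  congr 1
  · have h1 := (Measure.measurePreserving_sub_left
      (volume : Measure ℝ) t).setLIntegral_comp_preimage_emb
      (Homeomorph.subLeft t).measurableEmbedding
      (fun u => ENNReal.ofReal (lam * Real.exp (-lam * u)) * h u) (Ioc 0 t)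
    have h2 : (fun x => t - x) ⁻¹' Ioc 0 t = Ico 0 t := by
      ext u
      simp [and_comm]
    rw [← h2]
    exact h1.symm
  · have h1 := (measurePreserving_add_right volume t).setLIntegral_comp_preimage_emb
      (Homeomorph.addRight t).measurableEmbedding
      (fun u => ENNReal.ofReal (lam * Real.exp (-lam * u)) * h u) (Ioi t)
    rw [← h1, ← lintegral_const_mul']
    · have : (fun x => x + t) ⁻¹' Ioi t = Ioi 0 := by ext; simp
      rw [this]
      congr 1 with θ
      rw [← mul_assoc, ← ENNReal.ofReal_mul (Real.exp_pos _).le]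
      congr 2
      rw [mul_left_comm, ← Real.exp_add]
      ring_nf
    · simp

/-- Averages the likelihood ratio of drift αu against the exponential density at t - u. The two
exponents add up to the one in `posteriorOdds`, apart from the factor exp(-lam t). -/
theorem lintegral_oddsIntegral {α lam x : ℝ} (hlam : 0 < lam) {t : ℝ} (ht : 0 < t) :
    ∫⁻ u in Ico 0 t, ENNReal.ofReal (lam * Real.exp (-lam * (t - u))) *
      ENNReal.ofReal (Real.exp (α * u * x / t - (α * u) ^ 2 / (2 * t))) =
    ENNReal.ofReal (Real.exp (-lam * t) * oddsIntegral α lam t x) := by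
  rw [setLIntegral_congr Ico_ae_eq_Ioc, oddsIntegral_eq, intervalIntegral.integral_of_le ht.le,
    ← integral_const_mul,
    ← integral_const_mul, ofReal_integral_eq_lintegral_ofReal]
  · congr 1 with u
    rw [← ENNReal.ofReal_mul (by positivity)]
    congr 1
    rw [mul_assoc, mul_left_comm (Real.exp _) lam, ← Real.exp_add, ← Real.exp_add]
    congr 2
    field_simp
    ring
  · refine (Continuous.integrableOn_Icc ?_).mono_set Ioc_subset_Icc_self
    fun_prop
  · exact Eventually.of_forall fun u => by positivity

/-- Bayes' formula with reference law N(0, t). The disorder occurs at 0, in (0, t], or after t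
(`h0`, `h1`, `h2`). The first two cases leave residual 0; the last leaves a fresh exponential
residual and no drift. Collecting both weights at a fixed increment x gives the density of x times
the mixture with the updated posterior. -/
theorem transition_eq_lintegral {α lam p : ℝ} (hlam : 0 < lam) (hp : p ∈ Icc (0 : ℝ) 1) {t : ℝ≥0}
    (ht : t ≠ 0) {χ : ℝ → ℝ → ℝ≥0∞} (hχ : Measurable (Function.uncurry χ)) :
    transition α lam t p χ = ∫⁻ x, (ENNReal.ofReal (Real.exp (-lam * t) *
        incrementDensity α lam t p x) *
      priorMix lam (updatedPosterior α lam t p x) (χ x)) ∂gaussianReal 0 t := by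
  have ht' : (0 : ℝ) < t := by positivity
  have := isProbabilityMeasure_expMeasure hlam
  have hχ' : ∀ s, Measurable fun x => χ x s := fun s =>
    hχ.comp (measurable_id.prodMk measurable_const)
  have hI : Measurable fun x => ∫⁻ θ, χ x θ ∂expMeasure lam := hχ.lintegral_prod_right'
  have h0 : ∫⁻ z, χ (α * max ((t : ℝ) - 0) 0 + √(t : ℝ) * z) (max (0 - (t : ℝ)) 0)
      ∂gaussianReal 0 1 =
      ∫⁻ x, ENNReal.ofReal (Real.exp (α * x - α ^ 2 / 2 * t)) * χ x 0 ∂gaussianReal 0 t := by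
    rw [max_eq_left (by simp), max_eq_right (by simp), sub_zero,
      lintegral_gaussianReal_shift ht _ (hχ' 0)]
    congr 1 with x
    congr 3
    field_simp
  have h1 : ∫⁻ u in Ico 0 (t : ℝ), ENNReal.ofReal (lam * Real.exp (-lam * (t - u))) *
      (∫⁻ z, χ (α * max ((t : ℝ) - (t - u)) 0 + √(t : ℝ) * z) (max (t - u - t) 0)
        ∂gaussianReal 0 1) =
      ∫⁻ x, ENNReal.ofReal (Real.exp (-lam * t) * oddsIntegral α lam t x) * χ x 0
        ∂gaussianReal 0 t := by
    have : ∀ x, ENNReal.ofReal (Real.exp (-lam * t) * oddsIntegral α lam t x) * χ x 0 =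
        ∫⁻ u in Ico 0 (t : ℝ), ENNReal.ofReal (lam * Real.exp (-lam * (t - u))) *
          (ENNReal.ofReal (Real.exp (α * u * x / t - (α * u) ^ 2 / (2 * t))) * χ x 0) := by
      intro x
      rw [← lintegral_oddsIntegral hlam ht', ← lintegral_mul_const _ (by fun_prop)]
      simp only [mul_assoc]
    simp_rw [this]
    rw [lintegral_lintegral_swap]
    · refine setLIntegral_congr_fun measurableSet_Ico fun u hu => ?_
      have e1 : max ((t : ℝ) - (t - u)) 0 = u := by rw [sub_sub_cancel, max_eq_left hu.1]
      have e2 : max ((t : ℝ) - u - t) 0 = 0 := max_eq_right (by linarith [hu.1])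
      simp only [e1, e2]
      rw [lintegral_gaussianReal_shift ht _ (hχ' 0), lintegral_const_mul]
      fun_prop
    · have := hχ' 0
      unfold Function.uncurry
      fun_prop
  have h2 : ∫⁻ θ, (∫⁻ z, χ (α * max ((t : ℝ) - (θ + t)) 0 + √(t : ℝ) * z) (max (θ + t - t) 0)
        ∂gaussianReal 0 1) ∂expMeasure lam =
      ∫⁻ x, ∫⁻ θ, χ x θ ∂expMeasure lam ∂gaussianReal 0 t := by
    rw [lintegral_lintegral_swap hχ.aemeasurable]
    refine lintegral_congr_ae ?_
    filter_upwards [ae_pos_expMeasure lam] with θ hθ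
    have e1 : max ((t : ℝ) - (θ + t)) 0 = 0 := max_eq_right (by linarith)
    have e2 : max (θ + (t : ℝ) - t) 0 = θ := by rw [add_sub_cancel_right, max_eq_left hθ.le]
    simp only [e1, e2]
    rw [mul_zero, lintegral_gaussianReal_shift ht _ (hχ' θ)]
    simp
  rw [transition, priorMix, lintegral_expMeasure_split lam t.coe_nonneg, h0, h1, h2,
    ← lintegral_const_mul _ (by have := hχ' 0; fun_prop), ← lintegral_const_mul _ hI,
    ← lintegral_add_left
      (by have := hχ' 0; have := continuous_oddsIntegral α lam; fun_prop),
    ← lintegral_const_mul _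
      (by have := hχ' 0; have := continuous_oddsIntegral α lam; fun_prop),
    ← lintegral_add_left (by have := hχ' 0; fun_prop)]
  congr 1 with x
  have hD := incrementDensity_pos (α := α) (x := x) hlam.le t.coe_nonneg hp
  have hU := updatedPosterior_mem_Icc (α := α) (x := x) hlam.le t.coe_nonneg hp
  have hb := oddsIntegral_nonneg (α := α) (x := x) hlam.le t.coe_nonneg
  have hp' := sub_nonneg.2 hp.2
  have hp0 := hp.1
  have ha : 0 < oddsFactor α lam t x := Real.exp_pos _
  have e0 := updatedPosterior_eq α lam t p x
  rw [← incrementDensity, eq_div_iff hD.ne'] at e0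
  -- `e1` is the joint weight of increment x and a disorder that has already happened; `e2` is the
  -- weight for one still to come. They are density times posterior and density times its
  -- complement.
  have e1 : Real.exp (-lam * t) * incrementDensity α lam t p x * updatedPosterior α lam t p x =
      p * Real.exp (α * x - α ^ 2 / 2 * t) +
        (1 - p) * (Real.exp (-lam * t) * oddsIntegral α lam t x) := by
    rw [mul_assoc, mul_comm (incrementDensity _ _ _ _ _), e0, mul_add, oddsFactor, ← mul_assoc,
      ← Real.exp_add]
    ring_nf
  have e2 : Real.exp (-lam * t) * incrementDensity α lam t p x *
      (1 - updatedPosterior α lam t p x) = (1 - p) * Real.exp (-lam * t) := by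
    rw [mul_sub, mul_assoc _ _ (updatedPosterior _ _ _ _ _), mul_comm (incrementDensity _ _ _ _ _)
      (updatedPosterior _ _ _ _ _), e0, incrementDensity]
    ring
  have hK : 0 ≤ Real.exp (-lam * t) * incrementDensity α lam t p x := by positivity
  generalize Real.exp (-lam * t) * incrementDensity α lam t p x = K at *
  rw [priorMix, mul_add (ENNReal.ofReal K), ← mul_assoc (ENNReal.ofReal K),
    ← mul_assoc (ENNReal.ofReal K), ← ENNReal.ofReal_mul hK,
    ← ENNReal.ofReal_mul hK, e1, e2, ENNReal.ofReal_add (by positivity)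
    (by positivity), ENNReal.ofReal_mul hp0, ENNReal.ofReal_mul hp', ENNReal.ofReal_mul hp']
  ring

theorem measurable_priorMix {β : Type*} {mβ : MeasurableSpace β} {lam : ℝ} (hlam : 0 < lam)
    {p : β → ℝ}
    (hp : Measurable p) {h : β → ℝ → ℝ≥0∞} (hh : Measurable (Function.uncurry h)) :
    Measurable fun b => priorMix lam (p b) (h b) := by
  have := isProbabilityMeasure_expMeasure hlam
  have h0 : Measurable fun b => h b 0 := hh.comp (measurable_id.prodMk measurable_const)
  have h1 : Measurable fun b => ∫⁻ θ, h b θ ∂expMeasure lam := hh.lintegral_prod_right'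
  unfold priorMix
  fun_prop

/-- Both sides are expanded by `transition_eq_lintegral`. On the right the integrand ignores the
residual, so its mixture integral is the integrand itself and the two expansions agree. -/
theorem transition_bayes {α lam : ℝ} (hlam : 0 < lam) (p : unitInterval) {t : ℝ≥0}
    (ht : t ≠ 0) {χ : ℝ → ℝ → ℝ≥0∞} (hχ : Measurable (Function.uncurry χ)) :
    transition α lam t p χ =
      transition α lam t p fun x _ => priorMix lam (posteriorUpdate α lam t p x) (χ x) := by
  simp_rw [coe_posteriorUpdate hlam.le]
  have hm : Measurable fun x => priorMix lam (updatedPosterior α lam t p x) (χ x) := by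
    refine measurable_priorMix hlam ?_ hχ
    have : updatedPosterior α lam t p = fun x => (posteriorUpdate α lam t p x : ℝ) :=
      funext fun x => (coe_posteriorUpdate hlam.le t p x).symm
    rw [this]
    exact measurable_subtype_coe.comp
      ((continuous_posteriorUpdate hlam.le).measurable.comp
        (measurable_const.prodMk (measurable_const.prodMk measurable_id)))
  have hm' : Measurable (Function.uncurry fun x (_ : ℝ) =>
      priorMix lam (updatedPosterior α lam t p x) (χ x)) := hm.comp measurable_fst
  rw [transition_eq_lintegral hlam p.2 ht hχ, transition_eq_lintegral hlam p.2 ht hm']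
  congr 1 with x
  rw [priorMix_const hlam (updatedPosterior_mem_Icc hlam.le t.coe_nonneg p.2)]

/-! ### The dynamic programming operator -/

/-- The expected delay cost `c E_p[(t - Θ)⁺]`. -/
noncomputable def delayCost (lam c p t : ℝ) : ℝ≥0∞ :=
  ENNReal.ofReal (c * ∫ s in (0 : ℝ)..t, noObservationPosterior lam p s)

theorem integral_noObservationPosterior {lam : ℝ} (hlam : 0 < lam) (p t : ℝ) :
    ∫ s in (0 : ℝ)..t, noObservationPosterior lam p s =
      t - (1 - p) * (1 - Real.exp (-lam * t)) / lam := by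
  unfold noObservationPosterior
  rw [intervalIntegral.integral_sub (by simp) (Continuous.intervalIntegrable (by fun_prop) _ _),
    intervalIntegral.integral_const_mul]
  have h : ∫ s in (0 : ℝ)..t, Real.exp (-lam * s) = (1 - Real.exp (-lam * t)) / lam := by
    rw [intervalIntegral.integral_comp_mul_left _ (by linarith : -lam ≠ 0)]
    simp
    field_simp
    ring
  rw [h]
  simp
  ring

theorem noObservationPosterior_mem_Icc {lam p s : ℝ} (hlam : 0 < lam) (hp : p ∈ Icc (0 : ℝ) 1)
    (hs : 0 ≤ s) : noObservationPosterior lam p s ∈ Icc (0 : ℝ) 1 := by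
  have h1 : Real.exp (-lam * s) ≤ 1 := Real.exp_le_one_iff.2 (by nlinarith)
  have h2 := Real.exp_pos (-lam * s)
  obtain ⟨h3, h4⟩ := hp
  unfold noObservationPosterior
  constructor <;> nlinarith

theorem lintegral_noObservationPosterior {lam c : ℝ} (hlam : 0 < lam) (hc : 0 < c)
    (p : unitInterval) (t : ℝ≥0) :
    ENNReal.ofReal c * ∫⁻ s in Ico 0 (t : ℝ), ENNReal.ofReal (noObservationPosterior lam p s) =
      delayCost lam c p t := by
  rw [delayCost, intervalIntegral.integral_of_le t.coe_nonneg, ENNReal.ofReal_mul hc.le,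
    ofReal_integral_eq_lintegral_ofReal, setLIntegral_congr Ico_ae_eq_Ioc]
  · refine (Continuous.integrableOn_Icc ?_).mono_set Ioc_subset_Icc_self
    unfold noObservationPosterior
    fun_prop
  · refine (ae_restrict_mem measurableSet_Ioc).mono fun s hs => ?_
    exact (noObservationPosterior_mem_Icc hlam p.2 hs.1.le).1

theorem continuous_delayCost {lam c : ℝ} (hlam : 0 < lam) :
    Continuous fun q : unitInterval × ℝ≥0 => delayCost lam c q.1 q.2 := by
  unfold delayCost
  simp only [integral_noObservationPosterior hlam]
  exact ENNReal.continuous_ofReal.comp (by fun_prop)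

/-- The cost `J₀ g(p, t)`, for a function `g` on the unit interval. -/
noncomputable def stepCost (α lam c d : ℝ) (g : unitInterval → ℝ≥0∞) (p : unitInterval)
    (t : ℝ≥0) : ℝ≥0∞ :=
  ENNReal.ofReal d + delayCost lam c p t +
    transition α lam t p fun x _ => g (posteriorUpdate α lam t p x)

/-- The iterates of the jump operator, for functions on the unit interval. -/
noncomputable def dpValue (α lam c d : ℝ) : ℕ → unitInterval → ℝ≥0∞
  | 0, p => ENNReal.ofReal (noObservationCost lam c p)
  | n + 1, p => min (ENNReal.ofReal (noObservationCost lam c p))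
      (⨅ t : {t : ℝ≥0 // 0 < t}, stepCost α lam c d (dpValue α lam c d n) p t)

theorem priorMix_mono {lam p : ℝ} {h k : ℝ → ℝ≥0∞} (hk : ∀ θ, h θ ≤ k θ) :
    priorMix lam p h ≤ priorMix lam p k := by
  unfold priorMix
  gcongr with θ
  · exact hk 0
  · exact hk θ

theorem bddBelow_noObservationCost {lam c : ℝ} (hlam : 0 < lam) (hc : 0 < c) {p : ℝ}
    (hp : p ∈ Icc (0 : ℝ) 1) : 0 ∈ lowerBounds (range fun t : ℝ≥0 =>
      (1 - noObservationPosterior lam p t +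
        c * ∫ s in (0 : ℝ)..t, noObservationPosterior lam p s)) := by
  rintro _ ⟨t, rfl⟩
  have h1 := (noObservationPosterior_mem_Icc hlam hp t.coe_nonneg).2
  have h2 : 0 ≤ ∫ s in (0 : ℝ)..t, noObservationPosterior lam p s :=
    intervalIntegral.integral_nonneg t.coe_nonneg fun s hs =>
      (noObservationPosterior_mem_Icc hlam hp hs.1).1
  have := mul_nonneg hc.le h2
  simp only
  linarith

theorem noObservationCost_mem_Icc {lam c : ℝ} (hlam : 0 < lam) (hc : 0 < c) {p : ℝ}
    (hp : p ∈ Icc (0 : ℝ) 1) : noObservationCost lam c p ∈ Icc (0 : ℝ) 1 := by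
  have hb := bddBelow_noObservationCost hlam hc hp
  refine ⟨le_ciInf fun t => hb ⟨t, rfl⟩, (ciInf_le ⟨0, hb⟩ 0).trans ?_⟩
  have := hp.1
  simp [noObservationPosterior]
  linarith

theorem upperSemicontinuous_noObservationCost {lam c : ℝ} (hlam : 0 < lam) (hc : 0 < c) :
    UpperSemicontinuous fun p : unitInterval => noObservationCost lam c p := by
  unfold noObservationCost
  refine upperSemicontinuous_ciInf
    (fun p => ⟨0, bddBelow_noObservationCost hlam hc p.2⟩) fun t => ?_
  simp only [integral_noObservationPosterior hlam]
  refine Continuous.upperSemicontinuous ?_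
  unfold noObservationPosterior
  fun_prop

theorem Continuous.posteriorUpdate {β : Type*} [TopologicalSpace β] {α lam : ℝ} (hlam : 0 ≤ lam)
    {t : β → ℝ≥0} {p : β → unitInterval} {x : β → ℝ} (ht : Continuous t) (hp : Continuous p)
    (hx : Continuous x) : Continuous fun b => posteriorUpdate α lam (t b) (p b) (x b) :=
  (continuous_posteriorUpdate hlam).comp (ht.prodMk (hp.prodMk hx))

theorem Measurable.posteriorUpdate {β : Type*} {mβ : MeasurableSpace β} {α lam : ℝ} (hlam : 0 ≤ lam)
    {t : β → ℝ≥0} {p : β → unitInterval} {x : β → ℝ} (ht : Measurable t) (hp : Measurable p)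
    (hx : Measurable x) : Measurable fun b => posteriorUpdate α lam (t b) (p b) (x b) :=
  (continuous_posteriorUpdate hlam).measurable.comp (ht.prodMk (hp.prodMk hx))

/-- The update is continuous in (p, t) for each fixed Θ and normal variable z, so `g` after the
update is upper semicontinuous; reverse Fatou is applied first in z, then in Θ. Fixing the law of z,
with √t as a factor in the integrand, keeps the reference measure independent of t. -/
theorem upperSemicontinuous_stepCost {α lam c d : ℝ} (hlam : 0 < lam)
    {g : unitInterval → ℝ≥0∞} (hg : UpperSemicontinuous g) (hg1 : ∀ p, g p ≤ 1) :
    UpperSemicontinuous fun q : unitInterval × ℝ≥0 => stepCost α lam c d g q.1 q.2 := by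
  have := isProbabilityMeasure_expMeasure hlam
  unfold stepCost
  refine UpperSemicontinuous.add
    (continuous_const.add (continuous_delayCost hlam)).upperSemicontinuous ?_
  unfold transition priorMix
  have hz : ∀ (θ : ℝ), UpperSemicontinuous fun q : unitInterval × ℝ≥0 =>
      ∫⁻ z, g (posteriorUpdate α lam q.2 q.1 (α * max ((q.2 : ℝ) - θ) 0 + √(q.2 : ℝ) * z))
        ∂gaussianReal 0 1 := fun θ => by
    refine upperSemicontinuous_lintegral (fun q => ?_) (fun z => ?_) (fun q z => hg1 _)
    · refine hg.measurable.comp (Measurable.posteriorUpdate hlam.le ?_ ?_ ?_) <;> fun_prop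
    · refine hg.comp_continuous_map (Continuous.posteriorUpdate hlam.le ?_ ?_ ?_) <;>
        fun_prop
  refine UpperSemicontinuous.add ?_ ?_
  · refine UpperSemicontinuous.continuous_mul
      (ENNReal.continuous_ofReal.comp (by fun_prop)) (by simp) (hz 0) fun q => ?_
    exact (lintegral_mono fun z => hg1 _).trans (by simp)
  · refine UpperSemicontinuous.continuous_mul
      (ENNReal.continuous_ofReal.comp (by fun_prop)) (by simp) ?_ fun q => ?_
    · refine upperSemicontinuous_lintegral (fun q => ?_) hz (fun q θ => ?_)
      · have : Measurable fun r : ℝ × ℝ => g (posteriorUpdate α lam q.2 q.1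
            (α * max ((q.2 : ℝ) - r.1) 0 + √(q.2 : ℝ) * r.2)) := by
          refine hg.measurable.comp (Measurable.posteriorUpdate hlam.le ?_ ?_ ?_) <;> fun_prop
        exact this.lintegral_prod_right'
      · exact (lintegral_mono fun z => hg1 _).trans (by simp)
    · refine (lintegral_mono fun θ => (lintegral_mono fun z => hg1 _)).trans ?_
      simp

theorem dpValue_le_one {α lam c d : ℝ} (hlam : 0 < lam) (hc : 0 < c) (n : ℕ)
    (p : unitInterval) : dpValue α lam c d n p ≤ 1 := by
  have h : ENNReal.ofReal (noObservationCost lam c p) ≤ 1 :=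
    ENNReal.ofReal_le_one.2 (noObservationCost_mem_Icc hlam hc p.2).2
  cases n with
  | zero => exact h
  | succ n => exact (min_le_left _ _).trans h

theorem upperSemicontinuous_dpValue {α lam c d : ℝ} (hlam : 0 < lam) (hc : 0 < c) (n : ℕ) :
    UpperSemicontinuous (dpValue α lam c d n) := by
  have h0 : UpperSemicontinuous fun p : unitInterval =>
      ENNReal.ofReal (noObservationCost lam c p) :=
    ENNReal.continuous_ofReal.comp_upperSemicontinuous
      (upperSemicontinuous_noObservationCost hlam hc) ENNReal.ofReal_mono
  induction n with
  | zero => exact h0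
  | succ n ih =>
    refine h0.inf (upperSemicontinuous_iInf fun t => ?_)
    exact (upperSemicontinuous_stepCost hlam ih (dpValue_le_one hlam hc n)).comp_continuous_map
      (g := fun p => (p, (t : ℝ≥0))) (by fun_prop)

theorem measurable_dpValue {α lam c d : ℝ} (hlam : 0 < lam) (hc : 0 < c) (n : ℕ) :
    Measurable (dpValue α lam c d n) :=
  (upperSemicontinuous_dpValue hlam hc n).measurable

/-- A measurable choice of nearly optimal waiting times, where `∞` stands for stopping. -/
theorem exists_measurable_waitingTime {α lam c d : ℝ} (hlam : 0 < lam) (hc : 0 < c) (n : ℕ)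
    {ε : ℝ≥0∞} (hε : ε ≠ 0) :
    ∃ T : unitInterval → ℝ≥0∞, Measurable T ∧ (∀ p, T p ≠ 0) ∧
      (∀ p, T p = ∞ → dpValue α lam c d (n + 1) p = ENNReal.ofReal (noObservationCost lam c p)) ∧
      ∀ p, T p ≠ ∞ → stepCost α lam c d (dpValue α lam c d n) p (T p).toNNReal ≤
        dpValue α lam c d (n + 1) p + ε := by
  classical
  set g := dpValue α lam c d (n + 1) with hg
  have hgm : Measurable g := measurable_dpValue hlam hc _
  have hus := upperSemicontinuous_stepCost (α := α) (c := c) (d := d) hlam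
    (upperSemicontinuous_dpValue (α := α) (c := c) (d := d) hlam hc n) (dpValue_le_one hlam hc n)
  have : Nonempty {t : ℝ≥0 // 0 < t} := ⟨⟨1, one_pos⟩⟩
  let u : ℕ → {t : ℝ≥0 // 0 < t} := TopologicalSpace.denseSeq _
  have hu : DenseRange u := TopologicalSpace.denseRange_denseSeq _
  let A : Set unitInterval := {p | ENNReal.ofReal (noObservationCost lam c p) ≤ g p}
  have hF : Measurable fun p : unitInterval => ENNReal.ofReal (noObservationCost lam c p) :=
    (upperSemicontinuous_noObservationCost hlam hc).measurable.ennreal_ofReal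
  have hA : MeasurableSet A := measurableSet_le hF hgm
  have hex : ∀ p : unitInterval, ∃ i : ℕ, p ∈ A ∨
      stepCost α lam c d (dpValue α lam c d n) p (u i) ≤ g p + ε := by
    intro p
    by_cases hp : p ∈ A
    · exact ⟨0, Or.inl hp⟩
    · have h1 : ⨅ t : {t : ℝ≥0 // 0 < t},
        stepCost α lam c d (dpValue α lam c d n) p t < g p + ε := by
        have hlt : g p < ENNReal.ofReal (noObservationCost lam c p) := not_le.1 hp
        have he : g p = ⨅ t : {t : ℝ≥0 // 0 < t}, stepCost α lam c d (dpValue α lam c d n) p t := by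
          rcases min_choice (ENNReal.ofReal (noObservationCost lam c p))
            (⨅ t : {t : ℝ≥0 // 0 < t}, stepCost α lam c d (dpValue α lam c d n) p t) with h | h
          · exact absurd h hlt.ne
          · exact h
        rw [← he]
        exact ENNReal.lt_add_right (hlt.trans ENNReal.ofReal_lt_top).ne hε
      obtain ⟨t, ht⟩ := iInf_lt_iff.1 h1
      -- Upper semicontinuity in t makes the set of ε-optimal times open, so it meets the dense
      -- sequence as soon as it is nonempty.
      have ho : IsOpen {s : {t : ℝ≥0 // 0 < t} |
          stepCost α lam c d (dpValue α lam c d n) p s < g p + ε} :=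
        (hus.comp_continuous_map (g := fun s : {t : ℝ≥0 // 0 < t} => (p, (s : ℝ≥0)))
          (by fun_prop)).isOpen_preimage (g p + ε)
      obtain ⟨i, hi⟩ := hu.exists_mem_open ho ⟨t, ht⟩
      exact ⟨i, Or.inr (le_of_lt hi)⟩
  obtain ⟨N, hNm, hN⟩ : ∃ N : unitInterval → ℕ, Measurable N ∧ ∀ p, p ∈ A ∨
      stepCost α lam c d (dpValue α lam c d n) p (u (N p)) ≤ g p + ε := by
    -- Taking the least good index gives a measurable selection, because each condition defines a
    -- measurable set of priors.
    refine ⟨fun p => Nat.find (hex p), ?_, fun p => Nat.find_spec (hex p)⟩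
    refine measurable_find hex fun i => hA.union (measurableSet_le ?_ (hgm.add_const ε))
    exact (hus.comp_continuous_map (g := fun p => (p, (u i : ℝ≥0))) (by fun_prop)).measurable
  refine ⟨fun p => if p ∈ A then ∞ else ((u (N p) : ℝ≥0) : ℝ≥0∞),
    Measurable.ite hA measurable_const
      ((measurable_from_nat (f := fun i => ((u i : ℝ≥0) : ℝ≥0∞))).comp hNm), ?_, ?_, ?_⟩
  · intro p
    by_cases h : p ∈ A
    · simp [h]
    · simpa [h] using (u (N p)).2.ne'
  · intro p hp
    by_cases h : p ∈ A
    · exact le_antisymm (min_le_left _ _) h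
    · simp [h] at hp
  · intro p hp
    by_cases h : p ∈ A
    · simp [h] at hp
    · simp only [h, if_false, ENNReal.toNNReal_coe]
      exact (hN p).resolve_left h

/-! ### Laws under the model, and agreement of the jump operator with its version on the unit
interval -/

theorem lintegral_gaussianReal_scale (t : ℝ≥0) {f : ℝ → ℝ≥0∞} (hf : Measurable f) :
    ∫⁻ w, f w ∂gaussianReal 0 t = ∫⁻ z, f (√(t : ℝ) * z) ∂gaussianReal 0 1 := by
  have h := gaussianReal_map_const_mul (μ := 0) (v := 1) √(t : ℝ)
  have h' : gaussianReal (√(t : ℝ) * 0) (.mk (√(t : ℝ) ^ 2) (sq_nonneg _) * 1) =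
      gaussianReal 0 t := by
    congr 1
    · simp
    · ext; simp
  rw [← h', ← h, lintegral_map hf (by fun_prop)]

namespace DisorderModel

variable {Ω : Type*} [MeasurableSpace Ω] {α lam : ℝ}

theorem ae_Θ_nonneg (M : DisorderModel Ω α lam) {p : ℝ} (hp : p ∈ Icc (0 : ℝ) 1) :
    ∀ᵐ ω ∂M.P p, 0 ≤ M.Θ ω := by
  have := M.isProbabilityMeasure p hp
  have h1 := M.prob_Θ_eq_zero p hp
  have h2 := M.prob_Θ_gt p hp 0 le_rfl
  have hm1 : MeasurableSet {ω | M.Θ ω = 0} := M.measurable_Θ (measurableSet_singleton 0)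
  have hm2 : MeasurableSet {ω | 0 < M.Θ ω} := M.measurable_Θ measurableSet_Ioi
  have hd : Disjoint {ω | M.Θ ω = 0} {ω | 0 < M.Θ ω} := by
    rw [Set.disjoint_left]
    intro ω h h'
    exact (ne_of_gt (show 0 < M.Θ ω from h')) h
  have h3 := measure_union (μ := M.P p) hd hm2
  rw [h1, h2, mul_zero, Real.exp_zero, mul_one, ← ENNReal.ofReal_add hp.1 (sub_nonneg.2 hp.2),
    add_sub_cancel, ENNReal.ofReal_one] at h3
  filter_upwards [(mem_ae_iff_prob_eq_one (hm1.union hm2)).2 h3] with ω hω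
  rcases hω with h | h
  · exact le_of_eq (Eq.symm h)
  · exact le_of_lt h

theorem prob_Θ_le (M : DisorderModel Ω α lam) {p : ℝ} (hp : p ∈ Icc (0 : ℝ) 1)
    {t : ℝ} (ht : 0 ≤ t) :
    M.P p {ω | M.Θ ω ≤ t} = ENNReal.ofReal (noObservationPosterior lam p t) := by
  have := M.isProbabilityMeasure p hp
  have hm : MeasurableSet {ω | t < M.Θ ω} := M.measurable_Θ measurableSet_Ioi
  have h : {ω | M.Θ ω ≤ t} = {ω | t < M.Θ ω}ᶜ := by ext; simp
  rw [h, prob_compl_eq_one_sub hm, M.prob_Θ_gt p hp t ht, noObservationPosterior,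
    ENNReal.ofReal_sub _ (mul_nonneg (sub_nonneg.2 hp.2) (Real.exp_pos _).le), ENNReal.ofReal_one]

theorem map_Θ (M : DisorderModel Ω α lam) (hlam : 0 < lam) {p : ℝ} (hp : p ∈ Icc (0 : ℝ) 1) :
    (M.P p).map M.Θ = ENNReal.ofReal p • Measure.dirac 0 +
      ENNReal.ofReal (1 - p) • expMeasure lam := by
  have := M.isProbabilityMeasure p hp
  have := isProbabilityMeasure_expMeasure hlam
  have : IsProbabilityMeasure ((M.P p).map M.Θ) :=
    Measure.isProbabilityMeasure_map M.measurable_Θ.aemeasurable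
  refine Measure.ext_of_Iic _ _ fun a => ?_
  rw [Measure.map_apply M.measurable_Θ measurableSet_Iic]
  simp only [Measure.coe_add, Measure.coe_smul, Pi.add_apply, Pi.smul_apply, smul_eq_mul]
  have hcdf : expMeasure lam (Iic a) = ENNReal.ofReal (cdf (expMeasure lam) a) := by
    rw [cdf_eq_real, ofReal_measureReal]
  rw [hcdf, cdf_expMeasure_eq hlam, Measure.dirac_apply' _ measurableSet_Iic]
  by_cases ha : 0 ≤ a
  · rw [if_pos ha, indicator_of_mem (mem_Iic.2 ha), Pi.one_apply, mul_one,
      ← ENNReal.ofReal_mul (sub_nonneg.2 hp.2), ← ENNReal.ofReal_add hp.1]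
    · have h := M.prob_Θ_le hp ha
      rw [show M.Θ ⁻¹' Iic a = {ω | M.Θ ω ≤ a} from rfl, h, noObservationPosterior]
      congr 1
      rw [neg_mul]
      ring
    · refine mul_nonneg (sub_nonneg.2 hp.2) (sub_nonneg.2 (Real.exp_le_one_iff.2 ?_))
      nlinarith
  · rw [if_neg ha, indicator_of_notMem (by simpa using ha), ENNReal.ofReal_zero, mul_zero,
      mul_zero, add_zero]
    refine measure_mono_null (t := {ω | ¬ 0 ≤ M.Θ ω}) (fun ω hω => ?_) (M.ae_Θ_nonneg hp)
    have : M.Θ ω ≤ a := hω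
    exact fun h => ha (h.trans this)

theorem lintegral_Θ (M : DisorderModel Ω α lam) (hlam : 0 < lam) {p : ℝ}
    (hp : p ∈ Icc (0 : ℝ) 1) {h : ℝ → ℝ≥0∞} (hh : Measurable h) :
    ∫⁻ ω, h (M.Θ ω) ∂M.P p = priorMix lam p h := by
  rw [← lintegral_map hh M.measurable_Θ, M.map_Θ hlam hp, lintegral_add_measure,
    lintegral_smul_measure, lintegral_smul_measure, lintegral_dirac' _ hh, priorMix]
  rfl

theorem lintegral_Θ_W (M : DisorderModel Ω α lam) (hlam : 0 < lam) {p : ℝ}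
    (hp : p ∈ Icc (0 : ℝ) 1) (t : ℝ≥0) {h : ℝ → ℝ → ℝ≥0∞}
    (hh : Measurable (Function.uncurry h)) :
    ∫⁻ ω, h (M.Θ ω) (M.W t ω) ∂M.P p =
      priorMix lam p fun θ => ∫⁻ z, h θ (√(t : ℝ) * z) ∂gaussianReal 0 1 := by
  have := M.isProbabilityMeasure p hp
  have hind : IndepFun M.Θ (M.W t) (M.P p) :=
    (M.indep p hp).comp measurable_id (measurable_pi_apply t)
  have hmap := (indepFun_iff_map_prod_eq_prod_map_map M.measurable_Θ.aemeasurable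
    (M.measurable_W t).aemeasurable).1 hind
  have e1 : ∫⁻ ω, h (M.Θ ω) (M.W t ω) ∂M.P p =
      ∫⁻ q, Function.uncurry h q ∂(M.P p).map fun ω => (M.Θ ω, M.W t ω) :=
    (lintegral_map hh (M.measurable_Θ.prodMk (M.measurable_W t))).symm
  have : IsProbabilityMeasure ((M.P p).map M.Θ) :=
    Measure.isProbabilityMeasure_map M.measurable_Θ.aemeasurable
  rw [e1, hmap, ((M.isBrownian p hp).hasLaw_eval t).map_eq, lintegral_prod _ hh.aemeasurable,
    lintegral_map hh.lintegral_prod_right' M.measurable_Θ]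
  simp only [Function.uncurry_apply_pair]
  have e2 : ∀ θ, ∫⁻ w, h θ w ∂gaussianReal 0 t = ∫⁻ z, h θ (√(t : ℝ) * z) ∂gaussianReal 0 1 :=
    fun θ => lintegral_gaussianReal_scale t (hh.comp measurable_prodMk_left)
  simp_rw [e2]
  refine M.lintegral_Θ hlam hp (h := fun θ => ∫⁻ z, h θ (√(t : ℝ) * z) ∂gaussianReal 0 1) ?_
  have : Measurable fun q : ℝ × ℝ => h q.1 (√(t : ℝ) * q.2) :=
    hh.comp (measurable_fst.prodMk (measurable_snd.const_mul _))
  exact this.lintegral_prod_right'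

/-- Since Θ ≥ 0 almost surely, (t - Θ)⁺ is the integral of 1_{Θ ≤ u} over [0, t); then Tonelli. -/
theorem lintegral_delay (M : DisorderModel Ω α lam) (hlam : 0 < lam) {c : ℝ} (hc : 0 < c)
    (p : unitInterval) (t : ℝ≥0) :
    ∫⁻ ω, ENNReal.ofReal (c * max ((t : ℝ) - M.Θ ω) 0) ∂M.P p = delayCost lam c p t := by
  have := M.isProbabilityMeasure p p.2
  have hA : MeasurableSet {q : Ω × ℝ | M.Θ q.1 ≤ q.2} :=
    measurableSet_le (M.measurable_Θ.comp measurable_fst) measurable_snd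
  have h1 : ∀ᵐ ω ∂M.P p, ENNReal.ofReal (c * max ((t : ℝ) - M.Θ ω) 0) =
      ENNReal.ofReal c * ∫⁻ u in Ico 0 (t : ℝ),
        {q : Ω × ℝ | M.Θ q.1 ≤ q.2}.indicator 1 (ω, u) := by
    filter_upwards [M.ae_Θ_nonneg p.2] with ω hω
    have e : ∀ u, {q : Ω × ℝ | M.Θ q.1 ≤ q.2}.indicator (1 : Ω × ℝ → ℝ≥0∞) (ω, u) =
        (Ici (M.Θ ω)).indicator 1 u := fun u => by
      simp [indicator_apply]
    simp_rw [e]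
    rw [lintegral_indicator_one measurableSet_Ici, Measure.restrict_apply measurableSet_Ici,
      ENNReal.ofReal_mul hc.le]
    congr 1
    have : Ici (M.Θ ω) ∩ Ico 0 (t : ℝ) = Ico (M.Θ ω) t := by
      ext u
      simp only [mem_inter_iff, mem_Ici, mem_Ico]
      constructor
      · rintro ⟨a, b, c⟩; exact ⟨a, c⟩
      · rintro ⟨a, b⟩; exact ⟨a, hω.trans a, b⟩
    rw [this, Real.volume_Ico]
    rcases le_total 0 ((t : ℝ) - M.Θ ω) with h | h
    · rw [max_eq_left h]
    · rw [max_eq_right h, ENNReal.ofReal_of_nonpos h, ENNReal.ofReal_zero]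
  rw [lintegral_congr_ae h1, lintegral_const_mul _
    (Measurable.lintegral_prod_right' (measurable_one.indicator hA)), lintegral_lintegral_swap
    (f := fun ω u => {q : Ω × ℝ | M.Θ q.1 ≤ q.2}.indicator 1 (ω, u))
    ((measurable_one.indicator hA).aemeasurable), ← lintegral_noObservationPosterior hlam hc]
  congr 1
  refine setLIntegral_congr_fun measurableSet_Ico fun u hu => ?_
  rw [← M.prob_Θ_le p.2 hu.1]
  exact lintegral_indicator_one (s := {ω | M.Θ ω ≤ u}) (M.measurable_Θ measurableSet_Iic)

/-- `f` and `g` need to agree only on the unit interval, where the updated posterior lies.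
Nonnegativity is proved alongside because `ENNReal.ofReal` alone would not determine the real
number. -/
theorem ofReal_jumpCost (M : DisorderModel Ω α lam) (hlam : 0 < lam) {c d : ℝ} (hc : 0 < c)
    (hd : 0 < d) {f : ℝ → ℝ} {g : unitInterval → ℝ≥0∞} (hg : Measurable g) (hg1 : ∀ p, g p ≤ 1)
    (hfg : ∀ p : unitInterval, f p = (g p).toReal) (p : unitInterval) (t : ℝ≥0) :
    0 ≤ M.jumpCost c d f p t ∧
      ENNReal.ofReal (M.jumpCost c d f p t) = stepCost α lam c d g p t := by
  have hP := M.isProbabilityMeasure p p.2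
  have hgu : Measurable fun x => g (posteriorUpdate α lam t p x) :=
    hg.comp (Measurable.posteriorUpdate hlam.le measurable_const measurable_const measurable_id)
  have hgX : Measurable fun ω => g (posteriorUpdate α lam t p (M.X t ω)) :=
    hgu.comp (M.measurable_X t)
  have hD : Measurable fun ω => ENNReal.ofReal (c * max ((t : ℝ) - M.Θ ω) 0) := by
    have := M.measurable_Θ
    fun_prop
  have h1 : ∀ ω, f (updatedPosterior α lam t p (M.X t ω)) + c * max ((t : ℝ) - M.Θ ω) 0 =
      (g (posteriorUpdate α lam t p (M.X t ω)) +
        ENNReal.ofReal (c * max ((t : ℝ) - M.Θ ω) 0)).toReal := fun ω => by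
    rw [ENNReal.toReal_add ((hg1 _).trans_lt ENNReal.one_lt_top).ne ENNReal.ofReal_ne_top,
      ENNReal.toReal_ofReal (mul_nonneg hc.le (le_max_right _ _)), ← hfg,
      coe_posteriorUpdate hlam.le]
  have h2 : ∫⁻ ω, (g (posteriorUpdate α lam t p (M.X t ω)) +
        ENNReal.ofReal (c * max ((t : ℝ) - M.Θ ω) 0)) ∂M.P p =
      delayCost lam c p t + transition α lam t p fun x _ => g (posteriorUpdate α lam t p x) := by
    rw [lintegral_add_left hgX, M.lintegral_delay hlam hc, add_comm]
    congr 1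
    refine M.lintegral_Θ_W hlam p.2 t (h := fun θ w => g (posteriorUpdate α lam t p
      (α * max ((t : ℝ) - θ) 0 + w))) ?_
    refine hgu.comp (g := fun x => g (posteriorUpdate α lam t p x))
      (f := fun q : ℝ × ℝ => α * max ((t : ℝ) - q.1) 0 + q.2) ?_
    fun_prop
  have h3 : transition α lam t p (fun x _ => g (posteriorUpdate α lam t p x)) ≤ 1 := by
    have := isProbabilityMeasure_expMeasure hlam
    refine (priorMix_mono (k := fun _ => 1) fun θ => ?_).trans (priorMix_const hlam p.2 1).le
    exact (lintegral_mono fun z => hg1 _).trans (by simp)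
  have hfin : delayCost lam c p t +
      transition α lam t p (fun x _ => g (posteriorUpdate α lam t p x)) ≠ ∞ :=
    ENNReal.add_ne_top.2 ⟨ENNReal.ofReal_ne_top, (h3.trans_lt ENNReal.one_lt_top).ne⟩
  have h4 : M.jumpCost c d f p t = d + (delayCost lam c p t +
      transition α lam t p fun x _ => g (posteriorUpdate α lam t p x)).toReal := by
    rw [jumpCost]
    simp_rw [h1]
    have hm : Measurable fun ω => g (posteriorUpdate α lam t p (M.X t ω)) +
        ENNReal.ofReal (c * max ((t : ℝ) - M.Θ ω) 0) := hgX.add hD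
    rw [integral_toReal hm.aemeasurable, h2]
    exact Eventually.of_forall fun ω => ENNReal.add_lt_top.2
      ⟨(hg1 _).trans_lt ENNReal.one_lt_top, ENNReal.ofReal_lt_top⟩
  rw [h4]
  refine ⟨by positivity, ?_⟩
  rw [ENNReal.ofReal_add hd.le (by positivity), ENNReal.ofReal_toReal hfin, stepCost, add_assoc]

theorem iterates_eq_dpValue (M : DisorderModel Ω α lam) (hlam : 0 < lam) {c d : ℝ} (hc : 0 < c)
    (hd : 0 < d) (n : ℕ) (p : unitInterval) :
    0 ≤ M.iterates c d n p ∧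
      ENNReal.ofReal (M.iterates c d n p) = dpValue α lam c d n p := by
  induction n generalizing p with
  | zero => exact ⟨(noObservationCost_mem_Icc hlam hc p.2).1, rfl⟩
  | succ n ih =>
    have : Nonempty {t : ℝ≥0 // 0 < t} := ⟨⟨1, one_pos⟩⟩
    have hJ := M.ofReal_jumpCost hlam hc hd (measurable_dpValue (α := α) (d := d) hlam hc n)
      (dpValue_le_one hlam hc n) (f := M.iterates c d n)
      (fun q => by rw [← (ih q).2, ENNReal.toReal_ofReal (ih q).1]) p
    refine ⟨le_min (noObservationCost_mem_Icc hlam hc p.2).1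
      (le_ciInf fun t => (hJ t).1), ?_⟩
    change ENNReal.ofReal (min _ _) = min _ _
    rw [ENNReal.ofReal_min, ENNReal.ofReal_iInf]
    congr 1
    exact iInf_congr fun t => (hJ t).2

end DisorderModel

/-! ### Increments of the Brownian motion over random time intervals -/

theorem setIntegral_eq_of_forall_fiber {Ω ι E : Type*} [MeasurableSpace Ω] [Countable ι]
    [MeasurableSpace ι] [MeasurableSingletonClass ι] [NormedAddCommGroup E] [NormedSpace ℝ E]
    {μ : Measure Ω} {A : Set Ω} (hA : MeasurableSet A) {N : Ω → ι} (hN : Measurable N)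
    {f g : Ω → E} (hf : IntegrableOn f A μ) (hg : IntegrableOn g A μ)
    (h : ∀ i, ∫ ω in A ∩ N ⁻¹' {i}, f ω ∂μ = ∫ ω in A ∩ N ⁻¹' {i}, g ω ∂μ) :
    ∫ ω in A, f ω ∂μ = ∫ ω in A, g ω ∂μ := by
  have hU : ⋃ i, A ∩ N ⁻¹' {i} = A := by
    ext ω; simp
  have hm : ∀ i, MeasurableSet (A ∩ N ⁻¹' {i}) :=
    fun i => hA.inter (hN (measurableSet_singleton i))
  have hd : Pairwise (Function.onFun Disjoint fun i => A ∩ N ⁻¹' {i}) := by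
    intro i j hij
    refine Set.disjoint_left.2 fun ω hi hj => hij ?_
    exact hi.2.symm.trans hj.2
  rw [← hU] at hf hg
  have h1 := integral_iUnion hm hd hf
  have h2 := integral_iUnion hm hd hg
  rw [hU] at h1 h2
  rw [h1, h2]
  exact tsum_congr h

/-- Associativity of product measures: if X is independent of (Y, D) and Y of D, the joint law is a
triple product and can be bracketed the other way. -/
theorem indepFun_prodMk_left_of_indepFun {Ω β γ δ : Type*} [MeasurableSpace Ω]
    [MeasurableSpace β] [MeasurableSpace γ] [MeasurableSpace δ] {μ : Measure Ω}
    [IsProbabilityMeasure μ] {X : Ω → β} {Y : Ω → γ} {D : Ω → δ} (hX : Measurable X)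
    (hY : Measurable Y) (hD : Measurable D) (h1 : IndepFun X (fun ω => (Y ω, D ω)) μ)
    (h2 : IndepFun Y D μ) : IndepFun (fun ω => (X ω, Y ω)) D μ := by
  have := Measure.isProbabilityMeasure_map (μ := μ) hX.aemeasurable
  have := Measure.isProbabilityMeasure_map (μ := μ) hY.aemeasurable
  have := Measure.isProbabilityMeasure_map (μ := μ) hD.aemeasurable
  have h3 : IndepFun X Y μ := h1.comp measurable_id measurable_fst
  rw [indepFun_iff_map_prod_eq_prod_map_map hX.aemeasurable (hY.prodMk hD).aemeasurable,
    (indepFun_iff_map_prod_eq_prod_map_map hY.aemeasurable hD.aemeasurable).1 h2] at h1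
  rw [indepFun_iff_map_prod_eq_prod_map_map (hX.prodMk hY).aemeasurable hD.aemeasurable,
    (indepFun_iff_map_prod_eq_prod_map_map hX.aemeasurable hY.aemeasurable).1 h3]
  refine (MeasurableEquiv.prodAssoc (α := β) (β := γ) (γ := δ)).map_measurableEquiv_injective ?_
  rw [Measure.prodAssoc_prod, ← h1, Measure.map_map MeasurableEquiv.prodAssoc.measurable
    ((hX.prodMk hY).prodMk hD)]
  rfl

/-- If, on every event of a σ-algebra, the conditional law of `D` is the centred normal law with
standard deviation `s`, then `D` can be integrated out. -/
theorem setLIntegral_eq_of_forall_charFun {Ω E : Type*} [MeasurableSpace Ω] [MeasurableSpace E]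
    {μ : Measure Ω} [IsFiniteMeasure μ] {h : Ω → E} (hh : Measurable h) {D s : Ω → ℝ}
    (hD : Measurable D) (hs : Measurable s) {A : Set Ω} (hA : MeasurableSet A)
    (hchar : ∀ B : Set E, MeasurableSet B → ∀ u : ℝ,
      ∫ ω in A ∩ h ⁻¹' B, Complex.exp (u * D ω * Complex.I) ∂μ =
        ∫ ω in A ∩ h ⁻¹' B, Complex.exp (-((s ω) ^ 2 * u ^ 2 / 2 : ℝ)) ∂μ)
    {ψ : E → ℝ → ℝ≥0∞} (hψ : Measurable (Function.uncurry ψ)) :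
    ∫⁻ ω in A, ψ (h ω) (D ω) ∂μ = ∫⁻ ω in A, ∫⁻ z, ψ (h ω) (s ω * z) ∂gaussianReal 0 1 ∂μ := by
  have hm1 : Measurable fun ω => (h ω, D ω) := hh.prodMk hD
  have hm2 : Measurable fun q : Ω × ℝ => (h q.1, s q.1 * q.2) :=
    (hh.comp measurable_fst).prodMk ((hs.comp measurable_fst).mul measurable_snd)
  have key : (μ.restrict A).map (fun ω => (h ω, D ω)) =
      ((μ.restrict A).prod (gaussianReal 0 1)).map fun q => (h q.1, s q.1 * q.2) := by
    -- Rectangles determine the joint law. With B fixed, the two laws of the second coordinate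
    -- restricted to `A ∩ h ⁻¹' B` are finite measures with the same characteristic function.
    refine Measure.ext_prod fun {B C} hB hC => ?_
    have hAB : MeasurableSet (A ∩ h ⁻¹' B) := hA.inter (hh hB)
    have hms : Measurable fun q : Ω × ℝ => s q.1 * q.2 :=
      (hs.comp measurable_fst).mul measurable_snd
    have heq : (μ.restrict (A ∩ h ⁻¹' B)).map D =
        ((μ.restrict (A ∩ h ⁻¹' B)).prod (gaussianReal 0 1)).map fun q => s q.1 * q.2 := by
      refine Measure.ext_of_charFun (funext fun u => ?_)
      rw [charFun_apply_real, charFun_apply_real, integral_map hD.aemeasurable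
        (by fun_prop), integral_map hms.aemeasurable (by fun_prop), hchar B hB u,
        integral_prod]
      · congr 1 with ω
        have h1 := charFun_gaussianReal (μ := 0) (v := 1) (u * s ω)
        rw [charFun_apply_real] at h1
        push_cast at h1 ⊢
        simp only [← mul_assoc]
        rw [h1]
        congr 1
        simp
        ring
      · refine Integrable.of_bound (C := 1) (by fun_prop) (Eventually.of_forall fun q => ?_)
        rw [← Complex.ofReal_mul, Complex.norm_exp_ofReal_mul_I]
    have h1 := DFunLike.congr_fun heq C
    rw [Measure.map_apply hD hC, Measure.map_apply hms hC,
      Measure.restrict_apply (hD hC)] at h1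
    rw [Measure.map_apply hm1 (hB.prod hC), Measure.map_apply hm2 (hB.prod hC),
      Measure.restrict_apply (hm1 (hB.prod hC))]
    have e1 : (fun ω => (h ω, D ω)) ⁻¹' (B ×ˢ C) ∩ A = D ⁻¹' C ∩ (A ∩ h ⁻¹' B) := by
      ext ω
      simp only [mem_inter_iff, mem_preimage, mem_prod]
      tauto
    rw [e1, h1, Measure.prod_apply (hms hC), Measure.prod_apply (hm2 (hB.prod hC)),
      ← lintegral_indicator hAB, ← lintegral_indicator hA]
    congr 1 with ω
    by_cases hω : ω ∈ A
    · by_cases hB' : h ω ∈ B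
      · rw [indicator_of_mem (show ω ∈ A ∩ h ⁻¹' B from ⟨hω, hB'⟩), indicator_of_mem hω]
        congr 1
        ext z
        simp [hB']
      · rw [indicator_of_notMem (show ω ∉ A ∩ h ⁻¹' B from fun h => hB' h.2), indicator_of_mem hω]
        symm
        convert! measure_empty (μ := gaussianReal 0 1)
        ext z
        simp [hB']
    · rw [indicator_of_notMem (show ω ∉ A ∩ h ⁻¹' B from fun h => hω h.1), indicator_of_notMem hω]
  have e1 : ∫⁻ ω in A, ψ (h ω) (D ω) ∂μ =
      ∫⁻ q, Function.uncurry ψ q ∂(μ.restrict A).map fun ω => (h ω, D ω) :=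
    (lintegral_map hψ hm1).symm
  rw [e1, key, lintegral_map hψ hm2]
  exact lintegral_prod _ (hψ.comp hm2).aemeasurable

namespace DisorderModel

variable {Ω : Type*} [MeasurableSpace Ω] {α lam : ℝ}

/-- The σ-algebra generated by the disorder time and the Brownian motion up to time `t`. -/
@[reducible] def pathInfo (M : DisorderModel Ω α lam) (t : ℝ≥0) : MeasurableSpace Ω :=
  MeasurableSpace.comap (fun ω => (M.Θ ω, fun u : Iic t => M.W u ω)) inferInstance

/-- Θ is independent of the whole path, and the path up to t is independent of later increments;
`indepFun_prodMk_left_of_indepFun` joins the two. -/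
theorem indepFun_pathInfo_increment (M : DisorderModel Ω α lam) {p : ℝ} (hp : p ∈ Icc (0 : ℝ) 1)
    {t s : ℝ≥0} (hts : t ≤ s) :
    IndepFun (fun ω => (M.Θ ω, fun u : Iic t => M.W u ω)) (fun ω => M.W s ω - M.W t ω) (M.P p) := by
  have := M.isProbabilityMeasure p hp
  have hY : Measurable fun ω => fun u : Iic t => M.W u ω :=
    measurable_pi_lambda _ fun u => M.measurable_W u
  have hD : Measurable fun ω => M.W s ω - M.W t ω := (M.measurable_W s).sub (M.measurable_W t)
  refine indepFun_prodMk_left_of_indepFun M.measurable_Θ hY hD ?_ ?_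
  · exact (M.indep p hp).comp (φ := id) (ψ := fun w : ℝ≥0 → ℝ =>
      ((fun u : Iic t => w u), w s - w t)) measurable_id (by fun_prop)
  · have hm : Measurable fun w : ℝ≥0 → ℝ => w (s - t) := measurable_pi_apply _
    have h := ((M.isBrownian p hp).indepFun_shift t).comp (φ := fun w : ℝ≥0 → ℝ => w (s - t))
      (ψ := id) hm measurable_id
    have e : (fun w : ℝ≥0 → ℝ => w (s - t)) ∘ (fun ω u => M.W (t + u) ω - M.W t ω) =
        fun ω => M.W s ω - M.W t ω := by
      ext ω
      simp [add_tsub_cancel_of_le hts]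
    rw [e] at h
    exact h.symm

theorem setIntegral_exp_increment (M : DisorderModel Ω α lam) {p : ℝ} (hp : p ∈ Icc (0 : ℝ) 1)
    {t s : ℝ≥0} (hts : t ≤ s) {C : Set Ω} (hC : MeasurableSet[M.pathInfo t] C) (u : ℝ) :
    ∫ ω in C, Complex.exp (u * (M.W s ω - M.W t ω : ℝ) * Complex.I) ∂M.P p =
      ∫ _ in C, Complex.exp (-(((s : ℝ) - t) * u ^ 2 / 2 : ℝ)) ∂M.P p := by
  have := M.isProbabilityMeasure p hp
  obtain ⟨B, hB, rfl⟩ := hC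
  have hY : Measurable fun ω => (M.Θ ω, fun u : Iic t => M.W u ω) :=
    M.measurable_Θ.prodMk (measurable_pi_lambda _ fun u => M.measurable_W u)
  have hD : Measurable fun ω => M.W s ω - M.W t ω := (M.measurable_W s).sub (M.measurable_W t)
  have h := (M.indepFun_pathInfo_increment hp hts).integral_fun_comp_mul_comp (𝕜 := ℂ)
    (f := B.indicator 1) (g := fun x : ℝ => Complex.exp (u * x * Complex.I)) hY.aemeasurable
    hD.aemeasurable (aestronglyMeasurable_const.indicator hB) (by fun_prop)
  have hlaw : ∫ ω, Complex.exp (u * (M.W s ω - M.W t ω : ℝ) * Complex.I) ∂M.P p =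
      Complex.exp (-(((s : ℝ) - t) * u ^ 2 / 2 : ℝ)) := by
    have h1 := ((M.isBrownian p hp).hasLaw_sub s t).map_eq
    have h2 := charFun_gaussianReal (μ := 0) (v := nndist s.1 t.1) u
    rw [← h1, charFun_apply_real, integral_map (by exact hD.aemeasurable) (by fun_prop)] at h2
    simp only [Pi.sub_apply] at h2
    rw [h2]
    have : ((nndist s.1 t.1 : ℝ≥0) : ℝ) = (s : ℝ) - t := by
      rw [coe_nndist, Real.dist_eq]
      exact abs_of_nonneg (sub_nonneg.2 (by exact_mod_cast hts))
    rw [this]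
    push_cast
    simp
  rw [hlaw] at h
  rw [← integral_indicator (hY hB), setIntegral_const]
  have e1 : ∀ ω, (B.indicator (1 : ℝ × (Iic t → ℝ) → ℂ) (M.Θ ω, fun u : Iic t => M.W u ω)) *
      Complex.exp (u * (M.W s ω - M.W t ω : ℝ) * Complex.I) =
      ((fun ω => (M.Θ ω, fun u : Iic t => M.W u ω)) ⁻¹' B).indicator
        (fun ω => Complex.exp (u * (M.W s ω - M.W t ω : ℝ) * Complex.I)) ω := fun ω => by
    by_cases hω : (M.Θ ω, fun u : Iic t => M.W u ω) ∈ B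
    · rw [indicator_of_mem hω, Pi.one_apply, one_mul,
        indicator_of_mem (show ω ∈ (fun ω => (M.Θ ω, fun u : Iic t => M.W u ω)) ⁻¹' B from hω)]
    · rw [indicator_of_notMem hω, zero_mul,
        indicator_of_notMem (show ω ∉ (fun ω => (M.Θ ω, fun u : Iic t => M.W u ω)) ⁻¹' B from hω)]
  have e2 : ∫ ω, (B.indicator (1 : ℝ × (Iic t → ℝ) → ℂ) (M.Θ ω, fun u : Iic t => M.W u ω)) ∂M.P p =
      ((M.P p).real ((fun ω => (M.Θ ω, fun u : Iic t => M.W u ω)) ⁻¹' B) : ℂ) := by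
    have : ∀ ω, (B.indicator (1 : ℝ × (Iic t → ℝ) → ℂ) (M.Θ ω, fun u : Iic t => M.W u ω)) =
      ((fun ω => (M.Θ ω, fun u : Iic t => M.W u ω)) ⁻¹' B).indicator (fun _ => (1 : ℂ)) ω :=
      fun ω => rfl
    simp_rw [this]
    rw [integral_indicator_const _ (hY hB)]
    simp
  simp_rw [e1] at h
  rw [h, e2]
  simp

theorem measurable_uncurry_W (M : DisorderModel Ω α lam) : Measurable (Function.uncurry M.W) :=
  measurable_uncurry_of_continuous_of_measurable M.continuous_W M.measurable_W

theorem measurable_W_comp (M : DisorderModel Ω α lam) {σ : Ω → ℝ≥0} (hσ : Measurable σ) :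
    Measurable fun ω => M.W (σ ω) ω :=
  M.measurable_uncurry_W.comp (hσ.prodMk measurable_id)

/-- The characteristic function of an increment of the Brownian motion over a random interval
`[σ, ρ]` whose endpoints are known at time `σ`. -/
theorem setIntegral_exp_random_increment {Ω : Type*} {H : MeasurableSpace Ω}
    [mΩ : MeasurableSpace Ω] (M : DisorderModel Ω α lam) {p : ℝ}
    (hp : p ∈ Icc (0 : ℝ) 1) (hH : H ≤ mΩ) {A : Set Ω}
    (hA : MeasurableSet[H] A) {σ ρ : Ω → ℝ≥0} (hσ : Measurable[H] σ) (hρ : Measurable[H] ρ)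
    (hσρ : ∀ ω ∈ A, σ ω ≤ ρ ω)
    (hpath : ∀ B, MeasurableSet[H] B → ∀ t, MeasurableSet[M.pathInfo t] (A ∩ B ∩ {ω | σ ω ≤ t}))
    {B : Set Ω} (hB : MeasurableSet[H] B) (u : ℝ) :
    ∫ ω in A ∩ B, Complex.exp (u * (M.W (ρ ω) ω - M.W (σ ω) ω : ℝ) * Complex.I) ∂M.P p =
      ∫ ω in A ∩ B, Complex.exp (-(((ρ ω : ℝ) - σ ω) * u ^ 2 / 2 : ℝ)) ∂M.P p := by
  have hP := M.isProbabilityMeasure p hp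
  -- Both endpoints are rounded up to the grid of mesh 1/(m+1). Rounding up matters: the rounded
  -- starting time is never earlier than σ, so what is known at σ is known there. Path continuity
  -- removes the rounding as m → ∞.
  let N : ℝ≥0 → ℕ → ℕ := fun x m => ⌈x * (m + 1)⌉₊
  let r : ℕ → ℕ → ℝ≥0 := fun m i => i / (m + 1)
  have hNmeas : ∀ m, Measurable fun x => N x m := fun m => by
    have : Measurable (Nat.ceil : ℝ≥0 → ℕ) := Nat.measurable_ceil
    exact this.comp (by fun_prop)
  have hNr : ∀ x m, x ≤ r m (N x m) := fun x m => by
    rw [le_div_iff₀ (by positivity)]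
    exact Nat.le_ceil _
  have hNlim : ∀ x, Tendsto (fun m => r m (N x m)) atTop (𝓝 x) := fun x => by
    rw [← NNReal.tendsto_coe]
    have h := (tendsto_nat_ceil_mul_div_atTop x.coe_nonneg).comp
      ((tendsto_natCast_atTop_atTop (R := ℝ)).comp (tendsto_add_atTop_nat 1))
    refine h.congr fun m => ?_
    simp only [Function.comp_apply, r, N]
    push_cast
    congr 2
  have hr : ∀ m, Monotone (r m) := fun m i j hij => by
    simp only [r]
    gcongr
  have hNmono : ∀ m, Monotone fun x => N x m := fun m x y hxy => Nat.ceil_mono (by gcongr)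
  have hAB : MeasurableSet (A ∩ B) := hH _ (hA.inter hB)
  have hσ' := hσ.mono hH le_rfl
  have hρ' := hρ.mono hH le_rfl
  have hrmeas : ∀ m, Measurable fun x => r m (N x m) := fun m =>
    (measurable_from_nat (f := r m)).comp (hNmeas m)
  have step : ∀ m : ℕ, ∫ ω in A ∩ B, Complex.exp (u * (M.W (r m (N (ρ ω) m)) ω -
        M.W (r m (N (σ ω) m)) ω : ℝ) * Complex.I) ∂M.P p =
      ∫ ω in A ∩ B, Complex.exp (-(((r m (N (ρ ω) m) : ℝ) - r m (N (σ ω) m)) * u ^ 2 / 2 : ℝ))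
        ∂M.P p := by
    intro m
    have mW1 := M.measurable_W_comp ((hrmeas m).comp hρ')
    have mW2 := M.measurable_W_comp ((hrmeas m).comp hσ')
    have mr1 : Measurable fun ω => r m (N (ρ ω) m) := (hrmeas m).comp hρ'
    have mr2 : Measurable fun ω => r m (N (σ ω) m) := (hrmeas m).comp hσ'
    simp only [Function.comp_apply] at mW1 mW2
    refine setIntegral_eq_of_forall_fiber hAB (N := fun ω => (N (σ ω) m, N (ρ ω) m))
      (((hNmeas m).comp hσ').prodMk ((hNmeas m).comp hρ')) ?_ ?_ ?_
    · refine Integrable.integrableOn (Integrable.of_bound (C := 1) (by fun_prop)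
        (Eventually.of_forall fun q => ?_))
      rw [← Complex.ofReal_mul, Complex.norm_exp_ofReal_mul_I]
    · refine IntegrableOn.of_bound (measure_lt_top _ _) (C := 1)
        (Measurable.aestronglyMeasurable (by fun_prop)) ?_
      refine (ae_restrict_mem hAB).mono fun ω hω => ?_
      rw [← Complex.ofReal_neg, Complex.norm_exp_ofReal, Real.exp_le_one_iff, neg_nonpos]
      have : (r m (N (σ ω) m) : ℝ) ≤ r m (N (ρ ω) m) :=
        NNReal.coe_le_coe.2 (hr m (hNmono m (hσρ ω hω.1)))
      have := sub_nonneg.2 this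
      positivity
    · rintro ⟨i, j⟩
      have hSm : MeasurableSet[H] (B ∩ (fun ω => (N (σ ω) m, N (ρ ω) m)) ⁻¹' {(i, j)}) :=
        MeasurableSet.inter hB ((Measurable.prodMk ((hNmeas m).comp hσ) ((hNmeas m).comp hρ))
          (measurableSet_singleton _))
      have hS0 : MeasurableSet (A ∩ B ∩ (fun ω => (N (σ ω) m, N (ρ ω) m)) ⁻¹' {(i, j)}) := by
        rw [inter_assoc]
        exact hH _ (MeasurableSet.inter hA hSm)
      by_cases hij : i ≤ j
      -- If σ rounds up to i/(m+1), then σ ≤ i/(m+1), so `hpath` places the event in the past of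
      -- this deterministic time and the fixed-time identity applies.
      · have hS : MeasurableSet[M.pathInfo (r m i)]
            (A ∩ B ∩ (fun ω => (N (σ ω) m, N (ρ ω) m)) ⁻¹' {(i, j)}) := by
          convert! hpath _ hSm (r m i) using 1
          ext ω
          simp only [mem_inter_iff, mem_preimage, mem_singleton_iff, Prod.mk.injEq]
          constructor
          · rintro ⟨⟨a, b⟩, c, d⟩
            refine ⟨⟨a, b, c, d⟩, ?_⟩
            rw [← c]
            exact hNr _ _
          · rintro ⟨⟨a, b, c, d⟩, -⟩
            exact ⟨⟨a, b⟩, c, d⟩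
        have h := M.setIntegral_exp_increment hp (hr m hij) hS u
        have e : ∀ ω ∈ A ∩ B ∩ (fun ω => (N (σ ω) m, N (ρ ω) m)) ⁻¹' {(i, j)},
            N (σ ω) m = i ∧ N (ρ ω) m = j := fun ω hω => by
          have := hω.2
          simpa using this
        refine (setIntegral_congr_fun hS0 fun ω hω => ?_).trans
          (h.trans (setIntegral_congr_fun hS0 fun ω hω => ?_))
        · simp only [(e ω hω).1, (e ω hω).2]
        · simp only [(e ω hω).1, (e ω hω).2]
      · have hS : A ∩ B ∩ (fun ω => (N (σ ω) m, N (ρ ω) m)) ⁻¹' {(i, j)} = ∅ := by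
          refine eq_empty_of_forall_notMem fun ω hω => hij ?_
          have h1 : (N (σ ω) m, N (ρ ω) m) = (i, j) := hω.2
          rw [← (Prod.mk.inj h1).1, ← (Prod.mk.inj h1).2]
          exact hNmono m (hσρ ω hω.1.1)
        rw [hS]
        simp
  have lim : ∀ ω, Tendsto (fun m => (M.W (r m (N (ρ ω) m)) ω - M.W (r m (N (σ ω) m)) ω : ℝ)) atTop
      (𝓝 (M.W (ρ ω) ω - M.W (σ ω) ω)) := fun ω =>
    (((M.continuous_W ω).tendsto _).comp (hNlim (ρ ω))).sub
      (((M.continuous_W ω).tendsto _).comp (hNlim (σ ω)))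
  have lim2 : ∀ ω, Tendsto (fun m => (r m (N (ρ ω) m) : ℝ) - r m (N (σ ω) m)) atTop
      (𝓝 ((ρ ω : ℝ) - σ ω)) := fun ω =>
    ((NNReal.tendsto_coe.2 (hNlim (ρ ω)))).sub (NNReal.tendsto_coe.2 (hNlim (σ ω)))
  have L1 : Tendsto (fun m => ∫ ω in A ∩ B, Complex.exp (u * (M.W (r m (N (ρ ω) m)) ω -
        M.W (r m (N (σ ω) m)) ω : ℝ) * Complex.I) ∂M.P p) atTop
      (𝓝 (∫ ω in A ∩ B, Complex.exp (u * (M.W (ρ ω) ω - M.W (σ ω) ω : ℝ) * Complex.I) ∂M.P p)) := by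
    refine tendsto_integral_of_dominated_convergence (fun _ => 1) (fun m => ?_) (by simp)
      (fun m => Eventually.of_forall fun ω => ?_) (Eventually.of_forall fun ω => ?_)
    · have mW1 := M.measurable_W_comp ((hrmeas m).comp hρ')
      have mW2 := M.measurable_W_comp ((hrmeas m).comp hσ')
      simp only [Function.comp_apply] at mW1 mW2
      fun_prop
    · rw [← Complex.ofReal_mul, Complex.norm_exp_ofReal_mul_I]
    · have h : Continuous fun x : ℝ => Complex.exp (u * x * Complex.I) := by fun_prop
      exact (h.tendsto _).comp (lim ω)
  have L2 : Tendsto (fun m => ∫ ω in A ∩ B,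
        Complex.exp (-(((r m (N (ρ ω) m) : ℝ) - r m (N (σ ω) m)) * u ^ 2 / 2 : ℝ)) ∂M.P p) atTop
      (𝓝 (∫ ω in A ∩ B, Complex.exp (-(((ρ ω : ℝ) - σ ω) * u ^ 2 / 2 : ℝ)) ∂M.P p)) := by
    refine tendsto_integral_of_dominated_convergence (fun _ => 1) (fun m => ?_) (by simp)
      (fun m => (ae_restrict_mem hAB).mono fun ω hω => ?_) (Eventually.of_forall fun ω => ?_)
    · have mr1 := (hrmeas m).comp hρ'
      have mr2 : Measurable fun ω => r m (N (σ ω) m) := (hrmeas m).comp hσ'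
      exact (Measurable.aestronglyMeasurable (by fun_prop))
    · rw [← Complex.ofReal_neg, Complex.norm_exp_ofReal, Real.exp_le_one_iff, neg_nonpos]
      have : (r m (N (σ ω) m) : ℝ) ≤ r m (N (ρ ω) m) :=
        NNReal.coe_le_coe.2 (hr m (hNmono m (hσρ ω hω.1)))
      have := sub_nonneg.2 this
      positivity
    · have h : Continuous fun x : ℝ => Complex.exp (-(x * u ^ 2 / 2 : ℝ)) := by fun_prop
      exact (h.tendsto _).comp (lim2 ω)
  simp only [step] at L1
  exact tendsto_nhds_unique L1 L2

/-- Integrating out an increment of the Brownian motion over a random interval `[σ, ρ]` whose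
endpoints are known at time `σ`. -/
theorem setLIntegral_random_increment {Ω : Type*} {H : MeasurableSpace Ω}
    [mΩ : MeasurableSpace Ω] (M : DisorderModel Ω α lam) {p : ℝ}
    (hp : p ∈ Icc (0 : ℝ) 1) (hH : H ≤ mΩ) {A : Set Ω}
    (hA : MeasurableSet[H] A) {σ ρ : Ω → ℝ≥0} (hσ : Measurable[H] σ) (hρ : Measurable[H] ρ)
    (hσρ : ∀ ω ∈ A, σ ω ≤ ρ ω)
    (hpath : ∀ B, MeasurableSet[H] B → ∀ t, MeasurableSet[M.pathInfo t] (A ∩ B ∩ {ω | σ ω ≤ t}))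
    {E : Type*} {mE : MeasurableSpace E} {h : Ω → E} (hh : Measurable[H] h)
    {ψ : E → ℝ → ℝ≥0∞} (hψ : Measurable (Function.uncurry ψ)) :
    ∫⁻ ω in A, ψ (h ω) (M.W (ρ ω) ω - M.W (σ ω) ω) ∂M.P p =
      ∫⁻ ω in A, ∫⁻ z, ψ (h ω) (√((ρ ω - σ ω : ℝ≥0) : ℝ) * z) ∂gaussianReal 0 1 ∂M.P p := by
  have hP := M.isProbabilityMeasure p hp
  have hσ' := hσ.mono hH le_rfl
  have hρ' := hρ.mono hH le_rfl
  refine setLIntegral_eq_of_forall_charFun (D := fun ω => M.W (ρ ω) ω - M.W (σ ω) ω)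
    (hh.mono hH le_rfl) ((M.measurable_W_comp hρ').sub (M.measurable_W_comp hσ')) (by fun_prop)
    (hH _ hA) ?_ hψ
  intro B hB u
  rw [M.setIntegral_exp_random_increment hp hH hA hσ hρ hσρ hpath (hh hB) u]
  refine setIntegral_congr_fun (hH _ (MeasurableSet.inter hA (hh hB))) fun ω hω => ?_
  rw [Real.sq_sqrt (NNReal.coe_nonneg _), NNReal.coe_sub (hσρ ω hω.1)]

end DisorderModel

/-! ### Histories of observations -/

/-- The σ-algebra of all sets whose trace on `E` is measurable. -/
@[reducible] def traceSpace {Ω : Type*} (m : MeasurableSpace Ω) {E : Set Ω}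
    (hE : MeasurableSet[m] E) :
    MeasurableSpace Ω where
  MeasurableSet' A := MeasurableSet[m] (A ∩ E)
  measurableSet_empty := by simp
  measurableSet_compl A hA := by
    have : Aᶜ ∩ E = E \ (A ∩ E) := by ext; simp; tauto
    rw [this]
    exact hE.diff hA
  measurableSet_iUnion f hf := by
    rw [iUnion_inter]
    exact MeasurableSet.iUnion hf

theorem comap_le_traceSpace {Ω β : Type*} {m : MeasurableSpace Ω} [mβ : MeasurableSpace β]
    {E : Set Ω} (hE : MeasurableSet[m] E) {f g : Ω → β} (hg : Measurable[m] g)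
    (hfg : ∀ ω ∈ E, f ω = g ω) : MeasurableSpace.comap f mβ ≤ traceSpace m hE := by
  rintro _ ⟨B, hB, rfl⟩
  have : f ⁻¹' B ∩ E = g ⁻¹' B ∩ E := by
    ext ω
    simp only [mem_inter_iff, mem_preimage]
    constructor
    · rintro ⟨h, h'⟩; exact ⟨hfg ω h' ▸ h, h'⟩
    · rintro ⟨h, h'⟩; exact ⟨(hfg ω h').symm ▸ h, h'⟩
  change MeasurableSet[m] (f ⁻¹' B ∩ E)
  rw [this]
  exact (hg hB).inter hE

namespace DisorderModel

variable {Ω : Type*} [MeasurableSpace Ω] {α lam : ℝ}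

theorem measurable_Θ_pathInfo (M : DisorderModel Ω α lam) (t : ℝ≥0) :
    Measurable[M.pathInfo t] M.Θ := by
  have h : Measurable[M.pathInfo t] (fun ω => (M.Θ ω, fun u : Iic t => M.W u ω)) :=
    comap_measurable _
  exact measurable_fst.comp h

theorem measurable_W_pathInfo (M : DisorderModel Ω α lam) {u t : ℝ≥0} (hut : u ≤ t) :
    Measurable[M.pathInfo t] (M.W u) := by
  have h : Measurable[M.pathInfo t] (fun ω => (M.Θ ω, fun u : Iic t => M.W u ω)) :=
    comap_measurable _
  exact (measurable_pi_apply (⟨u, hut⟩ : Iic t)).comp (measurable_snd.comp h)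

theorem measurable_X_pathInfo (M : DisorderModel Ω α lam) {u t : ℝ≥0} (hut : u ≤ t) :
    Measurable[M.pathInfo t] (M.X u) := by
  have h1 := M.measurable_Θ_pathInfo t
  have h2 := M.measurable_W_pathInfo hut
  unfold X
  fun_prop

theorem pathInfo_mono (M : DisorderModel Ω α lam) {s t : ℝ≥0} (hst : s ≤ t) :
    M.pathInfo s ≤ M.pathInfo t := by
  have h : Measurable[M.pathInfo t] (fun ω => (M.Θ ω, fun u : Iic s => M.W u ω)) :=
    (M.measurable_Θ_pathInfo t).prodMk
      (@measurable_pi_lambda _ _ _ (M.pathInfo t) _ _ fun u =>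
        M.measurable_W_pathInfo (u.2.trans hst))
  exact h.comap_le

namespace ObservationStrategy

variable {M : DisorderModel Ω α lam}

/-- The σ-algebra generated by the first `k` observations. -/
@[reducible] noncomputable def history (S : M.ObservationStrategy) (k : ℕ) : MeasurableSpace Ω :=
  ⨆ i ∈ Finset.Icc 1 k, MeasurableSpace.comap (M.observation (S.time i)) inferInstance

/-- The σ-algebra generated by the disorder time and the first `k` observations. -/
@[reducible] noncomputable def fullHistory (S : M.ObservationStrategy) (k : ℕ) :
    MeasurableSpace Ω :=
  MeasurableSpace.comap M.Θ inferInstance ⊔ S.history k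

theorem history_le (S : M.ObservationStrategy) (k : ℕ) : S.history k ≤ ‹MeasurableSpace Ω› :=
  iSup₂_le fun i _ => (M.measurable_observation (S.measurable_time i)).comap_le

theorem fullHistory_le (S : M.ObservationStrategy) (k : ℕ) :
    S.fullHistory k ≤ ‹MeasurableSpace Ω› :=
  sup_le M.measurable_Θ.comap_le (S.history_le k)

theorem history_le_fullHistory (S : M.ObservationStrategy) (k : ℕ) :
    S.history k ≤ S.fullHistory k := le_sup_right

theorem measurable_Θ_fullHistory (S : M.ObservationStrategy) (k : ℕ) :
    Measurable[S.fullHistory k] M.Θ :=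
  (comap_measurable M.Θ).mono le_sup_left le_rfl

theorem history_mono (S : M.ObservationStrategy) : Monotone S.history := fun _ _ hjk =>
  iSup₂_le fun i hi => le_iSup₂_of_le i
    (Finset.mem_Icc.2 ⟨(Finset.mem_Icc.1 hi).1, (Finset.mem_Icc.1 hi).2.trans hjk⟩) le_rfl

theorem measurable_observation_history (S : M.ObservationStrategy) {i k : ℕ} (hi : 1 ≤ i)
    (hik : i ≤ k) : Measurable[S.history k] (M.observation (S.time i)) :=
  (comap_measurable _).mono (le_iSup₂_of_le i (Finset.mem_Icc.2 ⟨hi, hik⟩) le_rfl) le_rfl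

theorem history_succ_le (S : M.ObservationStrategy) (k : ℕ) :
    S.history (k + 1) ≤ S.history k ⊔
      MeasurableSpace.comap (M.observation (S.time (k + 1))) inferInstance := by
  refine iSup₂_le fun i hi => ?_
  obtain ⟨h1, h2⟩ := Finset.mem_Icc.1 hi
  rcases Nat.le_succ_iff.1 h2 with h | rfl
  · exact (S.measurable_observation_history h1 h).comap_le.trans le_sup_left
  · exact le_sup_right

theorem measurable_time_succ_history (S : M.ObservationStrategy) (k : ℕ) :
    Measurable[S.history k] (S.time (k + 1)) := by
  cases k with
  | zero =>
    obtain ⟨t, ht⟩ := S.time_one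
    have h : S.time (0 + 1) = fun _ => t := funext ht
    rw [h]
    exact measurable_const
  | succ k => exact S.measurable_time_succ (k + 1) (by omega)

theorem measurable_time_history (S : M.ObservationStrategy) (k : ℕ) :
    Measurable[S.history k] (S.time k) := by
  cases k with
  | zero =>
    have h : S.time 0 = fun _ => 0 := funext S.time_zero
    rw [h]
    exact measurable_const
  | succ k => exact (S.measurable_time_succ_history k).mono (S.history_mono k.le_succ) le_rfl

theorem time_mono (S : M.ObservationStrategy) (ω : Ω) : Monotone fun k => S.time k ω :=
  monotone_nat_of_le_succ fun k => by
    by_cases h : S.time k ω = ⊤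
    · rw [S.time_top k ω h]; exact le_top
    · exact (S.time_lt k ω h).le

/-- The value of the observation process seen at the `k`-th observation. -/
noncomputable def seen (S : M.ObservationStrategy) (k : ℕ) (ω : Ω) : ℝ :=
  if k = 0 then 0 else (M.observation (S.time k) ω).2

theorem measurable_seen (S : M.ObservationStrategy) (k : ℕ) :
    Measurable[S.history k] (S.seen k) := by
  unfold seen
  by_cases h : k = 0
  · simp only [h, if_true]
    exact measurable_const
  · simp only [h, if_false]
    exact measurable_snd.comp (S.measurable_observation_history (Nat.one_le_iff_ne_zero.2 h) le_rfl)

/-- Only k = 0 is not pointwise: the value 0 is recorded by convention, and X₀ = 0 requires W₀ = 0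
and Θ ≥ 0, both almost sure. -/
theorem ae_seen_eq (S : M.ObservationStrategy) {p : ℝ} (hp : p ∈ Icc (0 : ℝ) 1) (k : ℕ) :
    ∀ᵐ ω ∂M.P p, S.time k ω ≠ ⊤ → S.seen k ω = M.X (S.time k ω).toNNReal ω := by
  by_cases h : k = 0
  · subst h
    filter_upwards [M.ae_Θ_nonneg hp, (M.isBrownian p hp).eval_zero_ae_eq_zero] with ω h1 h2 _
    simp [seen, S.time_zero, X, h2, h1]
  · refine Eventually.of_forall fun ω hω => ?_
    simp [seen, h, observation, hω]

/-- The time between the `k`-th and the `(k+1)`-st observation. -/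
noncomputable def gap (S : M.ObservationStrategy) (k : ℕ) (ω : Ω) : ℝ≥0 :=
  (S.time (k + 1) ω).toNNReal - (S.time k ω).toNNReal

theorem measurable_gap (S : M.ObservationStrategy) (k : ℕ) :
    Measurable[S.history k] (S.gap k) :=
  (S.measurable_time_succ_history k).ennreal_toNNReal.sub
    (S.measurable_time_history k).ennreal_toNNReal

theorem time_ne_top_of_succ (S : M.ObservationStrategy) {k : ℕ} {ω : Ω}
    (h : S.time (k + 1) ω ≠ ⊤) : S.time k ω ≠ ⊤ := fun h' => h (S.time_top k ω h')

theorem toNNReal_time_lt (S : M.ObservationStrategy) {k : ℕ} {ω : Ω}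
    (h : S.time (k + 1) ω ≠ ⊤) : (S.time k ω).toNNReal < (S.time (k + 1) ω).toNNReal :=
  (ENNReal.toNNReal_lt_toNNReal (S.time_ne_top_of_succ h) h).2
    (S.time_lt k ω (S.time_ne_top_of_succ h))

theorem gap_ne_zero (S : M.ObservationStrategy) {k : ℕ} {ω : Ω}
    (h : S.time (k + 1) ω ≠ ⊤) : S.gap k ω ≠ 0 :=
  (tsub_pos_of_lt (S.toNNReal_time_lt h)).ne'

theorem coe_gap (S : M.ObservationStrategy) {k : ℕ} {ω : Ω} (h : S.time (k + 1) ω ≠ ⊤) :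
    (S.gap k ω : ℝ) = ((S.time (k + 1) ω).toNNReal : ℝ) - (S.time k ω).toNNReal :=
  NNReal.coe_sub (S.toNNReal_time_lt h).le

/-- The posterior probability after the `k`-th observation. -/
noncomputable def posterior (S : M.ObservationStrategy) (p : unitInterval) : ℕ → Ω → unitInterval
  | 0, _ => p
  | k + 1, ω => posteriorUpdate α lam (S.gap k ω) (S.posterior p k ω)
      (S.seen (k + 1) ω - S.seen k ω)

theorem measurable_posterior (S : M.ObservationStrategy) (hlam : 0 < lam) (p : unitInterval)
    (k : ℕ) : Measurable[S.history k] (S.posterior p k) := by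
  induction k with
  | zero => exact measurable_const
  | succ k ih =>
    have h1 := (S.measurable_gap k).mono (S.history_mono k.le_succ) le_rfl
    have h2 := ih.mono (S.history_mono k.le_succ) le_rfl
    have h3 := (S.measurable_seen k).mono (S.history_mono k.le_succ) le_rfl
    exact Measurable.posteriorUpdate hlam.le h1 h2 ((S.measurable_seen (k + 1)).sub h3)

/-- Each τ_k is a stopping time for the filtration `pathInfo`, and Θ with the first k observations
is known at τ_k. Both follow from one induction, because τ_{k+1} is a function of the first k
observations and τ_k ≤ τ_{k+1}. -/
theorem measurableSet_fullHistory_inter (S : M.ObservationStrategy) (k : ℕ) {B : Set Ω}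
    (hB : MeasurableSet[S.fullHistory k] B) (t : ℝ≥0) :
    MeasurableSet[M.pathInfo t] (B ∩ {ω | S.time k ω ≤ t}) := by
  induction k generalizing B t with
  | zero =>
    have h0 : S.fullHistory 0 ≤ M.pathInfo t := by
      refine sup_le (M.measurable_Θ_pathInfo t).comap_le ?_
      exact iSup₂_le fun i hi => by simp at hi
    have : {ω | S.time 0 ω ≤ t} = univ := by ext; simp [S.time_zero]
    rw [this, inter_univ]
    exact h0 _ hB
  | succ k ih =>
    have hE : ∀ s, MeasurableSet[M.pathInfo s] {ω | S.time (k + 1) ω ≤ s} := fun s => by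
      have h1 : MeasurableSet[S.fullHistory k] {ω | S.time (k + 1) ω ≤ s} :=
        S.history_le_fullHistory k _ (S.measurable_time_succ_history k measurableSet_Iic)
      have h2 : {ω | S.time (k + 1) ω ≤ s} =
          {ω | S.time (k + 1) ω ≤ s} ∩ {ω | S.time k ω ≤ s} := by
        ext ω
        simp only [mem_inter_iff, mem_ofPred_eq, iff_self_and]
        exact (S.time_mono ω k.le_succ).trans
      rw [h2]
      exact ih h1 s
    have hσ : Measurable[M.pathInfo t] fun ω => (min (S.time (k + 1) ω) t).toNNReal := by
      refine Measurable.ennreal_toNNReal (measurable_of_Iic fun s => ?_)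
      by_cases hs : s < t
      · have hs' : s ≠ ⊤ := hs.ne_top
        lift s to ℝ≥0 using hs'
        have : (fun ω => min (S.time (k + 1) ω) t) ⁻¹' Iic (s : ℝ≥0∞) =
            {ω | S.time (k + 1) ω ≤ s} := by
          ext ω
          simp only [mem_preimage, mem_Iic, min_le_iff, mem_ofPred_eq, or_iff_left_iff_imp]
          exact fun h => absurd h (not_le.2 hs)
        rw [this]
        exact M.pathInfo_mono (by exact_mod_cast hs.le) _ (hE s)
      · have : (fun ω => min (S.time (k + 1) ω) t) ⁻¹' Iic s = univ := by
          ext ω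
          simp only [mem_preimage, mem_Iic, min_le_iff, mem_univ, iff_true]
          exact Or.inr (not_lt.1 hs)
        rw [this]
        exact MeasurableSet.univ
    -- Progressive measurability: the path frozen at t is jointly measurable using information up to
    -- t only, and on {τ_{k+1} ≤ t} it yields the true observed value.
    have hX : Measurable[(inferInstance : MeasurableSpace ℝ≥0).prod (M.pathInfo t)]
        (Function.uncurry fun u ω => M.X (min u t) ω) :=
      measurable_uncurry_of_continuous_of_measurable (m := M.pathInfo t)
        (fun ω => (M.continuous_X ω).comp (by fun_prop))
        fun u => M.measurable_X_pathInfo (min_le_right u t)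
    have hg : Measurable[M.pathInfo t] fun ω => (min (S.time (k + 1) ω) (t : ℝ≥0∞),
        M.X (min (min (S.time (k + 1) ω) t).toNNReal t) ω) := by
      have hσid : Measurable[M.pathInfo t,
          (inferInstance : MeasurableSpace ℝ≥0).prod (M.pathInfo t)]
          fun ω => ((min (S.time (k + 1) ω) t).toNNReal, ω) := hσ.prodMk measurable_id
      have hXσ := hX.comp hσid
      have := hσ.coe_nnreal_ennreal
      have e : (fun ω => ((min (S.time (k + 1) ω) t).toNNReal : ℝ≥0∞)) =
          fun ω => min (S.time (k + 1) ω) t := by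
        ext ω
        exact ENNReal.coe_toNNReal (ne_top_of_le_ne_top ENNReal.coe_ne_top (min_le_right _ _))
      rw [e] at this
      exact this.prodMk hXσ
    have hle : S.fullHistory (k + 1) ≤ traceSpace (M.pathInfo t) (hE t) := by
      have h1 : S.fullHistory k ≤ traceSpace (M.pathInfo t) (hE t) := fun B hB => by
        have h2 : B ∩ {ω | S.time (k + 1) ω ≤ t} =
            (B ∩ {ω | S.time k ω ≤ t}) ∩ {ω | S.time (k + 1) ω ≤ t} := by
          ext ω
          simp only [mem_inter_iff, mem_ofPred_eq]
          have := (S.time_mono ω k.le_succ).trans (c := (t : ℝ≥0∞))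
          tauto
        change MeasurableSet[M.pathInfo t] (B ∩ {ω | S.time (k + 1) ω ≤ t})
        rw [h2]
        exact (ih hB t).inter (hE t)
      refine sup_le (le_sup_left.trans h1) ((S.history_succ_le k).trans
        (sup_le (le_sup_right.trans h1) (comap_le_traceSpace _ hg fun ω hω => ?_)))
      have hω' : S.time (k + 1) ω ≤ t := hω
      have hne : S.time (k + 1) ω ≠ ⊤ := ne_top_of_le_ne_top ENNReal.coe_ne_top hω'
      have h3 : (S.time (k + 1) ω).toNNReal ≤ t := by
        rw [← ENNReal.coe_le_coe, ENNReal.coe_toNNReal hne]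
        exact hω'
      simp only [observation, hne, if_false, min_eq_left hω', min_eq_left h3]
    exact hle _ hB

end ObservationStrategy

end DisorderModel

/-! ### The filtering equation -/

theorem measurable_transition_integrand {E : Type*} {mE : MeasurableSpace E} (α : ℝ)
    {T : E → ℝ≥0} (hT : Measurable T) {χ : E → ℝ → ℝ → ℝ≥0∞}
    (hχ : Measurable fun q : E × ℝ × ℝ => χ q.1 q.2.1 q.2.2) :
    Measurable (Function.uncurry fun e θ => ∫⁻ z, χ e (α * max ((T e : ℝ) - θ) 0 +
      √(T e : ℝ) * z) (max (θ - T e) 0) ∂gaussianReal 0 1) := by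
  have h : Measurable fun r : (E × ℝ) × ℝ => χ r.1.1 (α * max ((T r.1.1 : ℝ) - r.1.2) 0 +
      √(T r.1.1 : ℝ) * r.2) (max (r.1.2 - T r.1.1) 0) :=
    hχ.comp (f := fun r : (E × ℝ) × ℝ => (r.1.1, α * max ((T r.1.1 : ℝ) - r.1.2) 0 +
      √(T r.1.1 : ℝ) * r.2, max (r.1.2 - T r.1.1) 0)) (by fun_prop)
  exact h.lintegral_prod_right'

/-- With a and b consecutive observation times, this and `max_max_sub` express the disordered time
in [a, b] and the residual after b through the gap b - a and the residual after a. One step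
therefore depends on the past time only through the residual. -/
theorem max_sub_sub_max {a b θ : ℝ} (hab : a ≤ b) :
    max (b - θ) 0 - max (a - θ) 0 = max (b - a - max (θ - a) 0) 0 := by
  rcases le_total a θ with h | h
  · rw [max_eq_right (by linarith : a - θ ≤ 0), max_eq_left (by linarith : 0 ≤ θ - a)]
    ring_nf
  · rw [max_eq_left (by linarith : 0 ≤ a - θ), max_eq_left (by linarith : 0 ≤ b - θ),
      max_eq_right (by linarith : θ - a ≤ 0), max_eq_left (by linarith)]
    ring

theorem max_max_sub {a b θ : ℝ} (hab : a ≤ b) :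
    max (max (θ - a) 0 - (b - a)) 0 = max (θ - b) 0 := by
  rcases le_total a θ with h | h
  · rw [max_eq_left (by linarith : 0 ≤ θ - a)]
    ring_nf
  · rw [max_eq_right (by linarith : θ - a ≤ 0), max_eq_right (by linarith),
      max_eq_right (by linarith)]

namespace DisorderModel

namespace ObservationStrategy

variable {Ω : Type*} [mΩ : MeasurableSpace Ω] {α lam : ℝ} {M : DisorderModel Ω α lam}

/-- The time from the `k`-th observation to the disorder, if positive. -/
noncomputable def residual (S : M.ObservationStrategy) (k : ℕ) (ω : Ω) : ℝ :=
  max (M.Θ ω - (S.time k ω).toNNReal) 0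

/-- Given the first `k` observations, the residual time to the disorder has the law
`Π_k δ₀ + (1 - Π_k) Exp(lam)`. -/
def IsFilteredAt (S : M.ObservationStrategy) (p : unitInterval) (k : ℕ) : Prop :=
  ∀ ψ : Ω → ℝ → ℝ≥0∞, Measurable[(S.history k).prod inferInstance] (Function.uncurry ψ) →
    ∫⁻ ω in {ω | S.time k ω ≠ ⊤}, ψ ω (S.residual k ω) ∂M.P p =
      ∫⁻ ω in {ω | S.time k ω ≠ ⊤}, priorMix lam (S.posterior p k ω) (ψ ω) ∂M.P p

theorem measurableSet_time_ne_top (S : M.ObservationStrategy) (k : ℕ) :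
    MeasurableSet[S.history k] {ω | S.time k ω ≠ ⊤} :=
  S.measurable_time_history k (measurableSet_singleton ⊤).compl

theorem measurableSet_time_succ_ne_top (S : M.ObservationStrategy) (k : ℕ) :
    MeasurableSet[S.history k] {ω | S.time (k + 1) ω ≠ ⊤} :=
  S.measurable_time_succ_history k (measurableSet_singleton ⊤).compl

theorem measurable_residual (S : M.ObservationStrategy) (k : ℕ) :
    Measurable[S.fullHistory k] (S.residual k) := by
  have h1 := S.measurable_Θ_fullHistory k
  have h2 : Measurable[S.fullHistory k] fun ω => (S.time k ω).toNNReal :=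
    (S.measurable_time_history k).ennreal_toNNReal.mono (S.history_le_fullHistory k) le_rfl
  exact (h1.sub h2.coe_nnreal_real).max measurable_const

/-- The law of the next increment and the next residual, given the first `k` observations. -/
theorem IsFilteredAt.setLIntegral_succ {S : M.ObservationStrategy} {p : unitInterval}
    {k : ℕ} (hk : S.IsFilteredAt p k) {χ : Ω → ℝ → ℝ → ℝ≥0∞}
    (hχ : Measurable[(S.history k).prod inferInstance] fun q : Ω × ℝ × ℝ => χ q.1 q.2.1 q.2.2) :
    ∫⁻ ω in {ω | S.time (k + 1) ω ≠ ⊤},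
        χ ω (S.seen (k + 1) ω - S.seen k ω) (S.residual (k + 1) ω) ∂M.P p =
      ∫⁻ ω in {ω | S.time (k + 1) ω ≠ ⊤},
        transition α lam (S.gap k ω) (S.posterior p k ω) (χ ω) ∂M.P p := by
  set A : Set Ω := {ω | S.time (k + 1) ω ≠ ⊤} with hAdef
  have hA : MeasurableSet[S.history k] A := S.measurableSet_time_succ_ne_top k
  have hAΩ : MeasurableSet A := S.history_le k _ hA
  have hT := S.measurable_gap k
  have hle := S.history_le_fullHistory k
  have hσ : Measurable[S.history k] fun ω => (S.time k ω).toNNReal :=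
    (S.measurable_time_history k).ennreal_toNNReal
  have hρ : Measurable[S.history k] fun ω => (S.time (k + 1) ω).toNNReal :=
    (S.measurable_time_succ_history k).ennreal_toNNReal
  -- Separates the increment into a drift determined by `fullHistory` and the Brownian increment
  -- that will be integrated out.
  have e1 : ∀ᵐ ω ∂M.P p, ω ∈ A →
      χ ω (S.seen (k + 1) ω - S.seen k ω) (S.residual (k + 1) ω) =
      χ ω (α * max ((S.gap k ω : ℝ) - S.residual k ω) 0 +
        (M.W (S.time (k + 1) ω).toNNReal ω - M.W (S.time k ω).toNNReal ω))
        (max (S.residual k ω - S.gap k ω) 0) := by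
    filter_upwards [S.ae_seen_eq p.2 k, S.ae_seen_eq p.2 (k + 1)] with ω h1 h2 hω
    have hlt : ((S.time k ω).toNNReal : ℝ) ≤ (S.time (k + 1) ω).toNNReal :=
      NNReal.coe_le_coe.2 (S.toNNReal_time_lt hω).le
    rw [h1 (S.time_ne_top_of_succ hω), h2 hω, S.coe_gap hω, residual, residual,
      max_max_sub hlt, ← max_sub_sub_max hlt]
    congr 1
    unfold X
    ring
  rw [setLIntegral_congr_fun_ae hAΩ e1]
  have hpath : ∀ B, MeasurableSet[S.fullHistory k] B → ∀ t,
      MeasurableSet[M.pathInfo t] (A ∩ B ∩ {ω | (S.time k ω).toNNReal ≤ t}) := by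
    intro B hB t
    have h := S.measurableSet_fullHistory_inter k (MeasurableSet.inter (hle _ hA) hB) t
    convert! h using 1
    ext ω
    simp only [mem_inter_iff, mem_ofPred_eq]
    refine and_congr_right fun hω => ?_
    have hne : S.time k ω ≠ ⊤ := S.time_ne_top_of_succ hω.1
    rw [← ENNReal.coe_le_coe, ENNReal.coe_toNNReal hne]
  have hψB : Measurable[(S.fullHistory k).prod inferInstance] (Function.uncurry fun ω w =>
      χ ω (α * max ((S.gap k ω : ℝ) - S.residual k ω) 0 + w)
        (max (S.residual k ω - S.gap k ω) 0)) := by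
    have h1 : Measurable[(S.fullHistory k).prod (inferInstance : MeasurableSpace ℝ),
        S.fullHistory k] fun q : Ω × ℝ => q.1 := measurable_fst
    have h2 : Measurable[(S.fullHistory k).prod (inferInstance : MeasurableSpace ℝ)]
        fun q : Ω × ℝ => q.2 := measurable_snd
    have h3 := ((hT.mono hle le_rfl).comp h1).coe_nnreal_real
    have h4 := (S.measurable_residual k).comp h1
    have h5 : Measurable[(S.fullHistory k).prod (inferInstance : MeasurableSpace ℝ),
        (S.history k).prod inferInstance] fun q : Ω × ℝ => (q.1,
        α * max ((S.gap k q.1 : ℝ) - S.residual k q.1) 0 + q.2,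
        max (S.residual k q.1 - S.gap k q.1) 0) :=
      Measurable.prodMk (h1.mono le_rfl hle) (Measurable.prodMk
        ((((h3.sub h4).max measurable_const).const_mul α).add h2)
        ((h4.sub h3).max measurable_const))
    exact hχ.comp h5
  refine (M.setLIntegral_random_increment (E := Ω) (mE := S.fullHistory k) p.2
    (S.fullHistory_le k) (hle _ hA)
    (hσ.mono hle le_rfl) (hρ.mono hle le_rfl) (fun ω hω => (S.toNNReal_time_lt hω).le) hpath
    (h := fun ω => ω) (@measurable_id' _ (S.fullHistory k)) hψB).trans ?_
  have hg := measurable_transition_integrand (mE := S.history k) α hT hχ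
  -- The filtering hypothesis integrates over {τ_k < ∞}; putting the indicator of the smaller event
  -- {τ_{k+1} < ∞} into the test function restricts it.
  have hAind : Measurable[(S.history k).prod inferInstance] (Function.uncurry fun ω θ =>
      A.indicator (fun ω => ∫⁻ z, χ ω (α * max ((S.gap k ω : ℝ) - θ) 0 +
        √(S.gap k ω : ℝ) * z) (max (θ - S.gap k ω) 0) ∂gaussianReal 0 1) ω) := by
    have hA' : MeasurableSet[(S.history k).prod (inferInstance : MeasurableSpace ℝ)]
        (Prod.fst ⁻¹' A : Set (Ω × ℝ)) := (@measurable_fst Ω ℝ (S.history k) _) hA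
    exact hg.indicator hA'
  have h2 := hk _ hAind
  have hsub : A ⊆ {ω | S.time k ω ≠ ⊤} := fun ω hω => S.time_ne_top_of_succ hω
  have hBΩ : MeasurableSet {ω | S.time k ω ≠ ⊤} := S.history_le k _ (S.measurableSet_time_ne_top k)
  have e2 : ∀ f : Ω → ℝ≥0∞, ∫⁻ ω in {ω | S.time k ω ≠ ⊤}, A.indicator f ω ∂M.P p =
      ∫⁻ ω in A, f ω ∂M.P p := fun f => by
    rw [lintegral_indicator hAΩ, Measure.restrict_restrict hAΩ, inter_eq_left.2 hsub]
  have e4 : ∀ f : Ω → ℝ → ℝ≥0∞, ∀ ω,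
      A.indicator (fun ω => priorMix lam (S.posterior p k ω) (f ω)) ω =
      priorMix lam (S.posterior p k ω) (fun θ => A.indicator (fun ω => f ω θ) ω) := fun f ω => by
    by_cases hω : ω ∈ A
    · simp only [indicator_of_mem hω]
    · simp [indicator_of_notMem hω, priorMix]
  rw [← e2, ← e2]
  unfold transition
  simp_rw [e4]
  rw [← h2]
  refine lintegral_congr fun ω => ?_
  by_cases hω : ω ∈ A
  · simp only [indicator_of_mem hω]
    rfl
  · simp only [indicator_of_notMem hω]

/-- Induction on k. A test function of the first k + 1 observations is a function of the first k and
of the new increment, because τ_{k+1} is already known. The law of the next step, Bayes' formula,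
and the same law read backwards then produce the updated posterior. -/
theorem isFilteredAt (S : M.ObservationStrategy) (hlam : 0 < lam) (p : unitInterval) (k : ℕ) :
    S.IsFilteredAt p k := by
  induction k with
  | zero =>
    intro ψ hψ
    have h0 : (S.history 0).prod (inferInstance : MeasurableSpace ℝ) ≤
        MeasurableSpace.comap Prod.snd inferInstance := by
      have : S.history 0 = ⊥ := by simp
      rw [this]
      refine sup_le ?_ le_rfl
      rw [MeasurableSpace.comap_bot]
      exact bot_le
    obtain ⟨Ψ, hΨ, he⟩ := (hψ.mono h0 le_rfl).exists_eq_measurable_comp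
    have he' : ∀ ω s, ψ ω s = Ψ s := fun ω s => congrFun he (ω, s)
    have hP := M.isProbabilityMeasure p p.2
    have hu : {ω | S.time 0 ω ≠ ⊤} = univ := by
      ext ω
      simp [S.time_zero]
    simp_rw [hu, he', Measure.restrict_univ]
    have h1 : ∀ᵐ ω ∂M.P p, Ψ (S.residual 0 ω) = Ψ (M.Θ ω) := by
      filter_upwards [M.ae_Θ_nonneg p.2] with ω hω
      rw [residual, S.time_zero]
      simp [hω]
    rw [lintegral_congr_ae h1, M.lintegral_Θ hlam p.2 hΨ]
    have e : ∀ ω, priorMix lam (S.posterior p 0 ω) (ψ ω) = priorMix lam p Ψ := fun ω => by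
      rw [show ψ ω = Ψ from funext (he' ω)]
      rfl
    simp_rw [e]
    simp
  | succ k ih =>
    intro ψ hψ
    -- Here Ω, equipped with the σ-algebra `S.history k`, stands for the first k observations, so
    -- Doob–Dynkin factorization through `F` exposes the new observation as a separate argument.
    let F : Ω × ℝ → (Ω × ℝ≥0∞ × ℝ) × ℝ := fun q => ((q.1, M.observation (S.time (k + 1)) q.1), q.2)
    let mF : MeasurableSpace ((Ω × ℝ≥0∞ × ℝ) × ℝ) :=
      ((S.history k).prod inferInstance).prod inferInstance
    have hF : Measurable[MeasurableSpace.comap F mF, mF] F := comap_measurable F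
    have hle : (S.history (k + 1)).prod (inferInstance : MeasurableSpace ℝ) ≤
        MeasurableSpace.comap F mF := by
      have hFs : Measurable[MeasurableSpace.comap F mF] fun q : Ω × ℝ => q.2 :=
        (@measurable_snd (Ω × ℝ≥0∞ × ℝ) ℝ ((S.history k).prod inferInstance) inferInstance).comp hF
      have hFf : Measurable[MeasurableSpace.comap F mF, (S.history k).prod inferInstance]
          fun q : Ω × ℝ => (q.1, M.observation (S.time (k + 1)) q.1) :=
        (@measurable_fst (Ω × ℝ≥0∞ × ℝ) ℝ ((S.history k).prod inferInstance) inferInstance).comp hF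
      have hF1 : Measurable[MeasurableSpace.comap F mF, S.history k] fun q : Ω × ℝ => q.1 :=
        (@measurable_fst Ω (ℝ≥0∞ × ℝ) (S.history k) inferInstance).comp hFf
      have hF2 : Measurable[MeasurableSpace.comap F mF] fun q : Ω × ℝ =>
          M.observation (S.time (k + 1)) q.1 :=
        (@measurable_snd Ω (ℝ≥0∞ × ℝ) (S.history k) inferInstance).comp hFf
      refine sup_le ((MeasurableSpace.comap_mono (S.history_succ_le k)).trans ?_) hFs.comap_le
      rw [MeasurableSpace.comap_sup, MeasurableSpace.comap_comp]
      exact sup_le hF1.comap_le hF2.comap_le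
    obtain ⟨Ψ, hΨ, he⟩ := (hψ.mono hle le_rfl).exists_eq_measurable_comp
    have he' : ∀ ω s, ψ ω s = Ψ ((ω, M.observation (S.time (k + 1)) ω), s) :=
      fun ω s => congrFun he (ω, s)
    -- The new value is written as the previous value plus x, which leaves only the increment free
    -- given the first k observations.
    let χ : Ω → ℝ → ℝ → ℝ≥0∞ := fun ω x s => Ψ ((ω, S.time (k + 1) ω, S.seen k ω + x), s)
    have hχ : Measurable[(S.history k).prod inferInstance]
        fun q : Ω × ℝ × ℝ => χ q.1 q.2.1 q.2.2 := by
      have h1 : Measurable[(S.history k).prod (inferInstance : MeasurableSpace (ℝ × ℝ)),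
        S.history k] fun q : Ω × ℝ × ℝ => q.1 := measurable_fst
      have h2 : Measurable[(S.history k).prod (inferInstance : MeasurableSpace (ℝ × ℝ))]
        fun q : Ω × ℝ × ℝ => q.2 := measurable_snd
      have h3 : Measurable[(S.history k).prod (inferInstance : MeasurableSpace (ℝ × ℝ)), mF]
          fun q : Ω × ℝ × ℝ => ((q.1, S.time (k + 1) q.1, S.seen k q.1 + q.2.1), q.2.2) :=
        Measurable.prodMk (Measurable.prodMk h1 (Measurable.prodMk
          ((S.measurable_time_succ_history k).comp h1)
          (((S.measurable_seen k).comp h1).add (measurable_fst.comp h2)))) (measurable_snd.comp h2)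
      exact hΨ.comp h3
    have hψχ : ∀ ω s, ψ ω s = χ ω (S.seen (k + 1) ω - S.seen k ω) s := fun ω s => by
      rw [he']
      simp only [χ, add_sub_cancel]
      rfl
    have hA : MeasurableSet {ω | S.time (k + 1) ω ≠ ⊤} :=
      S.history_le k _ (S.measurableSet_time_succ_ne_top k)
    have hχω : ∀ ω, Measurable (Function.uncurry (χ ω)) := fun ω =>
      hχ.comp (@measurable_prodMk_left Ω (ℝ × ℝ) (S.history k) _ ω)
    have hχ' : Measurable[(S.history k).prod inferInstance] fun q : Ω × ℝ × ℝ =>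
        (fun ω x (_ : ℝ) => priorMix lam
          (posteriorUpdate α lam (S.gap k ω) (S.posterior p k ω) x) (χ ω x)) q.1 q.2.1 q.2.2 := by
      have h1 : Measurable[(S.history k).prod (inferInstance : MeasurableSpace (ℝ × ℝ)),
        S.history k] fun q : Ω × ℝ × ℝ => q.1 := measurable_fst
      have h2 : Measurable[(S.history k).prod (inferInstance : MeasurableSpace (ℝ × ℝ))]
        fun q : Ω × ℝ × ℝ => q.2 := measurable_snd
      refine measurable_priorMix (mβ := (S.history k).prod inferInstance) hlam
        (measurable_subtype_coe.comp (Measurable.posteriorUpdate hlam.le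
          ((S.measurable_gap k).comp h1) ((S.measurable_posterior hlam p k).comp h1)
          (measurable_fst.comp h2))) (h := fun q => χ q.1 q.2.1) ?_
      have h3 : Measurable[((S.history k).prod (inferInstance : MeasurableSpace (ℝ × ℝ))).prod
          (inferInstance : MeasurableSpace ℝ), (S.history k).prod inferInstance]
          fun r : (Ω × ℝ × ℝ) × ℝ => (r.1.1, r.1.2.1, r.2) :=
        Measurable.prodMk (h1.comp measurable_fst)
          (Measurable.prodMk (measurable_fst.comp (h2.comp measurable_fst)) measurable_snd)
      exact hχ.comp h3
    simp_rw [hψχ]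
    rw [ih.setLIntegral_succ hχ]
    -- Bayes' formula needs a positive time span; observation times strictly increase while finite.
    refine (setLIntegral_congr_fun hA fun ω hω => transition_bayes hlam (S.posterior p k ω)
      (S.gap_ne_zero hω) (hχω ω)).trans ?_
    rw [← ih.setLIntegral_succ hχ']
    refine setLIntegral_congr_fun hA fun ω _ => ?_
    have : ψ ω = χ ω (S.seen (k + 1) ω - S.seen k ω) := funext (hψχ ω)
    rw [this]
    rfl

end ObservationStrategy

end DisorderModel

/-! ### The posterior process between observations -/

theorem priorMix_Iic {lam p r : ℝ} (hlam : 0 < lam) (hp : p ∈ Icc (0 : ℝ) 1) (hr : 0 ≤ r) :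
    priorMix lam p ((Iic r).indicator 1) = ENNReal.ofReal (noObservationPosterior lam p r) := by
  have := isProbabilityMeasure_expMeasure hlam
  have h1 : 0 ≤ 1 - Real.exp (-(lam * r)) :=
    sub_nonneg.2 (Real.exp_le_one_iff.2 (neg_nonpos.2 (by positivity)))
  rw [priorMix, lintegral_indicator_one measurableSet_Iic, indicator_of_mem (mem_Iic.2 hr),
    ← ofReal_measureReal, ← cdf_eq_real, cdf_expMeasure_eq hlam, if_pos hr, Pi.one_apply, mul_one,
    ← ENNReal.ofReal_mul (sub_nonneg.2 hp.2), ← ENNReal.ofReal_add hp.1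
    (mul_nonneg (sub_nonneg.2 hp.2) h1), noObservationPosterior]
  congr 1
  rw [neg_mul]
  ring

namespace DisorderModel

namespace ObservationStrategy

variable {Ω : Type*} [mΩ : MeasurableSpace Ω] {α lam : ℝ} {M : DisorderModel Ω α lam}

/-- The event that exactly `k` observations have been made up to time `t`. -/
def countEq (S : M.ObservationStrategy) (k : ℕ) (t : ℝ≥0) : Set Ω :=
  {ω | S.time k ω ≤ t ∧ (t : ℝ≥0∞) < S.time (k + 1) ω}

theorem measurableSet_countEq_history (S : M.ObservationStrategy) (k : ℕ) (t : ℝ≥0) :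
    MeasurableSet[S.history k] (S.countEq k t) :=
  MeasurableSet.inter (S.measurable_time_history k measurableSet_Iic)
    (S.measurable_time_succ_history k measurableSet_Ioi)

theorem time_succ_pos (S : M.ObservationStrategy) (k : ℕ) (ω : Ω) : 0 < S.time (k + 1) ω := by
  by_cases h : S.time k ω = ⊤
  · rw [S.time_top k ω h]; exact ENNReal.zero_lt_top
  · exact bot_le.trans_lt (S.time_lt k ω h)

theorem measurable_record_filtration (S : M.ObservationStrategy) (t : ℝ≥0) (k : ℕ) :
    Measurable[S.filtration t] (S.record t k) :=
  (comap_measurable _).mono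
    (le_iSup (fun k => MeasurableSpace.comap (S.record t k) inferInstance) k) le_rfl

/-- Observation times of positive index are positive, so a positive first entry of the record
distinguishes an observation already made from the default (0, 0). -/
theorem measurableSet_time_le_filtration (S : M.ObservationStrategy) (k : ℕ) (t : ℝ≥0) :
    MeasurableSet[S.filtration t] {ω | S.time k ω ≤ t} := by
  cases k with
  | zero =>
    have : {ω | S.time 0 ω ≤ t} = univ := by ext; simp [S.time_zero]
    rw [this]
    exact MeasurableSet.univ
  | succ k =>
    have : {ω | S.time (k + 1) ω ≤ t} = S.record t k ⁻¹' {x | 0 < x.1} := by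
      ext ω
      simp only [mem_ofPred_eq, mem_preimage, record]
      split_ifs with h
      · simp [h, observation, S.time_succ_pos]
      · simp [h]
    rw [this]
    exact S.measurable_record_filtration t k (measurable_fst measurableSet_Ioi)

theorem measurableSet_countEq_filtration (S : M.ObservationStrategy) (k : ℕ) (t : ℝ≥0) :
    MeasurableSet[S.filtration t] (S.countEq k t) := by
  have : S.countEq k t = {ω | S.time k ω ≤ t} ∩ {ω | S.time (k + 1) ω ≤ t}ᶜ := by
    ext ω; simp [countEq]
  rw [this]
  exact (S.measurableSet_time_le_filtration k t).inter
    (S.measurableSet_time_le_filtration (k + 1) t).compl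

/-- When exactly k observations have been made by t, the first k records are the observations and
the others are constant. Together with `history_le_traceSpace`, this says that the filtration at t
and the first k observations have the same trace on that event. -/
theorem filtration_le_traceSpace (S : M.ObservationStrategy) (k : ℕ) (t : ℝ≥0) :
    S.filtration t ≤ traceSpace (S.history k) (S.measurableSet_countEq_history k t) := by
  refine iSup_le fun i => ?_
  by_cases hi : i + 1 ≤ k
  · refine comap_le_traceSpace _ (S.measurable_observation_history (by omega) hi) fun ω hω => ?_
    rw [record, if_pos ((S.time_mono ω hi).trans hω.1)]
  · refine comap_le_traceSpace _ (g := fun _ => (0, 0)) measurable_const fun ω hω => ?_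
    rw [record, if_neg (not_le.2 (hω.2.trans_le (S.time_mono ω (by omega))))]

theorem history_le_traceSpace (S : M.ObservationStrategy) (k : ℕ) (t : ℝ≥0) :
    S.history k ≤ traceSpace (S.filtration t) (S.measurableSet_countEq_filtration k t) := by
  refine iSup₂_le fun i hi => ?_
  obtain ⟨h1, h2⟩ := Finset.mem_Icc.1 hi
  obtain ⟨j, rfl⟩ := Nat.exists_eq_add_of_le' h1
  refine comap_le_traceSpace _ (S.measurable_record_filtration t j) fun ω hω => ?_
  rw [record, if_pos ((S.time_mono ω h2).trans hω.1)]

/-- The posterior probability at time `t` if the last observation was the `k`-th. -/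
noncomputable def posteriorAfter (S : M.ObservationStrategy) (p : unitInterval) (k : ℕ) (t : ℝ≥0)
    (ω : Ω) : ℝ :=
  noObservationPosterior lam (S.posterior p k ω) ((t : ℝ) - (S.time k ω).toNNReal)

theorem toNNReal_time_le {S : M.ObservationStrategy} {k : ℕ} {t : ℝ≥0} {ω : Ω}
    (h : S.time k ω ≤ t) : ((S.time k ω).toNNReal : ℝ) ≤ t := by
  have := ENNReal.toNNReal_mono ENNReal.coe_ne_top h
  rw [ENNReal.toNNReal_coe] at this
  exact_mod_cast this

theorem posteriorAfter_mem_Icc (S : M.ObservationStrategy) (hlam : 0 < lam) (p : unitInterval)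
    {k : ℕ} {t : ℝ≥0} {ω : Ω} (h : S.time k ω ≤ t) :
    S.posteriorAfter p k t ω ∈ Icc (0 : ℝ) 1 :=
  noObservationPosterior_mem_Icc hlam (S.posterior p k ω).2 (sub_nonneg.2 (toNNReal_time_le h))

theorem measurable_posteriorAfter (S : M.ObservationStrategy) (hlam : 0 < lam) (p : unitInterval)
    (k : ℕ) (t : ℝ≥0) : Measurable[S.history k] (S.posteriorAfter p k t) := by
  have h1 : Measurable[S.history k] fun ω => (S.posterior p k ω : ℝ) :=
    measurable_subtype_coe.comp (S.measurable_posterior hlam p k)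
  have h2 : Measurable[S.history k] fun ω => ((S.time k ω).toNNReal : ℝ) :=
    (S.measurable_time_history k).ennreal_toNNReal.coe_nnreal_real
  unfold posteriorAfter noObservationPosterior
  fun_prop

/-- For τ_k ≤ t, Θ ≤ t is the same as residual ≤ t - τ_k, so the filtering equation applies to the
indicator of that event. -/
theorem setLIntegral_posteriorAfter (S : M.ObservationStrategy) (hlam : 0 < lam) (p : unitInterval)
    (k : ℕ) (t : ℝ≥0) {B : Set Ω} (hB : MeasurableSet[S.history k] B) :
    ∫⁻ ω in B ∩ S.countEq k t, ENNReal.ofReal (S.posteriorAfter p k t ω) ∂M.P p =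
      M.P p (B ∩ S.countEq k t ∩ {ω | M.Θ ω ≤ t}) := by
  set D := B ∩ S.countEq k t with hD
  have hDm : MeasurableSet[S.history k] D :=
    MeasurableSet.inter hB (S.measurableSet_countEq_history k t)
  have hDΩ : MeasurableSet D := S.history_le k _ hDm
  have hle : ∀ ω ∈ D, S.time k ω ≤ t := fun ω hω => hω.2.1
  have hsub : D ⊆ {ω | S.time k ω ≠ ⊤} := fun ω hω =>
    ne_top_of_le_ne_top ENNReal.coe_ne_top (hle ω hω)
  let Q : Set (Ω × ℝ) := {q | q.1 ∈ D ∧ q.2 ≤ (t : ℝ) - (S.time k q.1).toNNReal}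
  have hQ : MeasurableSet[(S.history k).prod (inferInstance : MeasurableSpace ℝ)] Q := by
    have h1 : Measurable[(S.history k).prod (inferInstance : MeasurableSpace ℝ), S.history k]
        fun q : Ω × ℝ => q.1 := measurable_fst
    have h2 : Measurable[(S.history k).prod (inferInstance : MeasurableSpace ℝ)]
        fun q : Ω × ℝ => q.2 := measurable_snd
    have h3 := ((S.measurable_time_history k).comp h1).ennreal_toNNReal.coe_nnreal_real
    exact MeasurableSet.inter (h1 hDm) (measurableSet_le h2 (h3.const_sub (t : ℝ)))
  have h := S.isFilteredAt hlam p k (fun ω s => Q.indicator 1 (ω, s))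
    ((@measurable_const ℝ≥0∞ (Ω × ℝ) _ ((S.history k).prod inferInstance) 1).indicator hQ)
  have e1 : ∀ ω, (Q.indicator 1 (ω, S.residual k ω) : ℝ≥0∞) =
      (D ∩ {ω | M.Θ ω ≤ t}).indicator 1 ω := fun ω => by
    have : (ω, S.residual k ω) ∈ Q ↔ ω ∈ D ∩ {ω | M.Θ ω ≤ t} := by
      simp only [Q, mem_ofPred_eq, mem_inter_iff, residual]
      refine and_congr_right fun hω => ?_
      have := toNNReal_time_le (hle ω hω)
      rw [max_le_iff, sub_le_sub_iff_right]
      exact and_iff_left (sub_nonneg.2 this)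
    by_cases h : ω ∈ D ∩ {ω | M.Θ ω ≤ t}
    · rw [indicator_of_mem h, indicator_of_mem (this.2 h)]
      rfl
    · rw [indicator_of_notMem h, indicator_of_notMem (mt this.1 h)]
  have e2 : ∀ ω, priorMix lam (S.posterior p k ω) (fun s => Q.indicator 1 (ω, s)) =
      D.indicator (fun ω => ENNReal.ofReal (S.posteriorAfter p k t ω)) ω := fun ω => by
    by_cases hω : ω ∈ D
    · rw [indicator_of_mem hω, posteriorAfter, ← priorMix_Iic hlam (S.posterior p k ω).2
        (sub_nonneg.2 (toNNReal_time_le (hle ω hω)))]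
      congr 1
      ext s
      by_cases h : s ≤ (t : ℝ) - (S.time k ω).toNNReal
      · rw [indicator_of_mem (mem_Iic.2 h), indicator_of_mem (show (ω, s) ∈ Q from ⟨hω, h⟩)]
        rfl
      · rw [indicator_of_notMem (mt mem_Iic.1 h), indicator_of_notMem fun h' => h h'.2]
    · rw [indicator_of_notMem hω]
      simp [Q, hω, priorMix]
  simp_rw [e1, e2] at h
  have hΘ : MeasurableSet {ω | M.Θ ω ≤ t} := M.measurable_Θ measurableSet_Iic
  rw [lintegral_indicator hDΩ, lintegral_indicator_one (hDΩ.inter hΘ),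
    Measure.restrict_restrict hDΩ, inter_eq_left.2 hsub, Measure.restrict_apply (hDΩ.inter hΘ),
    inter_eq_left.2 (inter_subset_left.trans hsub)] at h
  exact h.symm

/-- Conditional expectation is local: on `countEq` the filtration may be replaced by `history k`,
for which the defining integral identity is `setLIntegral_posteriorAfter`. -/
theorem condExp_eq_posteriorAfter (S : M.ObservationStrategy) (hlam : 0 < lam) (p : unitInterval)
    (k : ℕ) (t : ℝ≥0) :
    ∀ᵐ ω ∂M.P p, ω ∈ S.countEq k t →
      ((M.P p)[indicator {ω | M.Θ ω ≤ t} (fun _ => (1 : ℝ)) | S.filtration t]) ω =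
        S.posteriorAfter p k t ω := by
  have hP := M.isProbabilityMeasure p p.2
  set E := S.countEq k t with hE
  set f : Ω → ℝ := indicator {ω | M.Θ ω ≤ t} (fun _ => (1 : ℝ)) with hf
  have hEm : MeasurableSet[S.history k] E := S.measurableSet_countEq_history k t
  have hEΩ : MeasurableSet E := S.history_le k _ hEm
  have hΘ : MeasurableSet {ω | M.Θ ω ≤ t} := M.measurable_Θ measurableSet_Iic
  have hfi : Integrable f (M.P p) := (integrable_const 1).indicator hΘ
  have h1 : (M.P p)[f | S.filtration t] =ᵐ[(M.P p).restrict E] (M.P p)[f | S.history k] := by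
    refine condExp_ae_eq_restrict_of_measurableSpace_eq_on (S.filtration.le t) (S.history_le k)
      (S.measurableSet_countEq_filtration k t) fun A => ⟨fun hA => ?_, fun hA => ?_⟩
    · have := S.filtration_le_traceSpace k t _ hA
      have h' : MeasurableSet[S.history k] (E ∩ A ∩ E) := this
      rwa [inter_right_comm, inter_self] at h'
    · have := S.history_le_traceSpace k t _ hA
      have h' : MeasurableSet[S.filtration t] (E ∩ A ∩ E) := this
      rwa [inter_right_comm, inter_self] at h'
  have h2 := condExp_indicator (m := S.history k) hfi hEm
  have hbm : Measurable[S.history k] (E.indicator (S.posteriorAfter p k t)) :=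
    (S.measurable_posteriorAfter hlam p k t).indicator hEm
  have hb : ∀ ω, E.indicator (S.posteriorAfter p k t) ω ∈ Icc (0 : ℝ) 1 := fun ω => by
    by_cases hω : ω ∈ E
    · rw [indicator_of_mem hω]; exact S.posteriorAfter_mem_Icc hlam p hω.1
    · rw [indicator_of_notMem hω]; simp
  have h3 : E.indicator (S.posteriorAfter p k t) =ᵐ[M.P p]
      (M.P p)[E.indicator f | S.history k] := by
    refine ae_eq_condExp_of_forall_setIntegral_eq (S.history_le k) (hfi.indicator hEΩ) ?_ ?_
      hbm.stronglyMeasurable.aestronglyMeasurable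
    · intro B _ _
      refine (Integrable.of_bound (C := 1)
        (hbm.mono (S.history_le k) le_rfl).aestronglyMeasurable
        (Eventually.of_forall fun ω => ?_)).integrableOn
      rw [Real.norm_of_nonneg (hb ω).1]
      exact (hb ω).2
    · intro B hB _
      have hBΩ : MeasurableSet B := S.history_le k _ hB
      have h4 := S.setLIntegral_posteriorAfter hlam p k t hB
      rw [← hE] at h4
      have e1 : ∫ ω in B, E.indicator f ω ∂M.P p = (M.P p).real (B ∩ E ∩ {ω | M.Θ ω ≤ t}) := by
        rw [setIntegral_indicator hEΩ, hf, setIntegral_indicator hΘ]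
        simp
      have e2 : ∫ ω in B, E.indicator (S.posteriorAfter p k t) ω ∂M.P p =
          (∫⁻ ω in B ∩ E, ENNReal.ofReal (S.posteriorAfter p k t ω) ∂M.P p).toReal := by
        rw [setIntegral_indicator hEΩ, integral_eq_lintegral_of_nonneg_ae]
        · refine (ae_restrict_mem (hBΩ.inter hEΩ)).mono fun ω hω => ?_
          exact (S.posteriorAfter_mem_Icc hlam p hω.2.1).1
        · exact ((S.measurable_posteriorAfter hlam p k t).mono (S.history_le k)
            le_rfl).aestronglyMeasurable
      rw [e1, e2, h4]
      rfl
  filter_upwards [(ae_restrict_iff' hEΩ).1 h1, h2, h3] with ω g1 g2 g3 hω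
  rw [g1 hω]
  rw [g2, indicator_of_mem hω, indicator_of_mem hω] at g3
  exact g3.symm

/-- Every version of the a posteriori probability process is given by the recursive posterior. -/
theorem IsPosterior.ae_eq {S : M.ObservationStrategy} (hlam : 0 < lam) {p : unitInterval}
    {A : ℝ≥0 → Ω → ℝ} (hA : S.IsPosterior p A) :
    ∀ᵐ ω ∂M.P p, ∀ k t, ω ∈ S.countEq k t → A t ω = S.posteriorAfter p k t ω := by
  -- The formula holds off one null set at countably many dense times. If it failed at t,
  -- right-continuity would make it fail throughout some [t, v) before the next observation, an
  -- interval that contains a dense time.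
  obtain ⟨u, hu⟩ := TopologicalSpace.exists_dense_seq ℝ≥0
  have h1 : ∀ᵐ ω ∂M.P p, ∀ k i, ω ∈ S.countEq k (u i) →
      A (u i) ω = S.posteriorAfter p k (u i) ω := by
    rw [ae_all_iff]
    intro k
    rw [ae_all_iff]
    intro i
    filter_upwards [S.condExp_eq_posteriorAfter hlam p k (u i), hA.2 (u i)] with ω g1 g2 hω
    rw [g2, g1 hω]
  filter_upwards [h1] with ω hω k t ht
  by_contra hne
  have hc : ContinuousWithinAt (fun s => A s ω - S.posteriorAfter p k s ω) (Ici t) t := by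
    refine (hA.1 ω t).sub (Continuous.continuousWithinAt ?_)
    unfold posteriorAfter noObservationPosterior
    fun_prop
  have hev : ∀ᶠ s in 𝓝[Ici t] t, A s ω - S.posteriorAfter p k s ω ≠ 0 :=
    hc.eventually_ne (sub_ne_zero.2 hne)
  have hev1 : ∀ᶠ s : ℝ≥0 in 𝓝 t, (s : ℝ≥0∞) < S.time (k + 1) ω :=
    (ENNReal.continuous_coe.tendsto t).eventually (gt_mem_nhds ht.2)
  have hev2 := hev1.filter_mono (nhdsWithin_le_nhds (s := Ici t))
  obtain ⟨v, hv, hsub⟩ := (mem_nhdsGE_iff_exists_Ico_subset).1 (hev.and hev2)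
  obtain ⟨i, hi⟩ := hu.exists_mem_open isOpen_Ioo (nonempty_Ioo.2 hv)
  have hs := hsub ⟨hi.1.le, hi.2⟩
  refine hs.1 (sub_eq_zero.2 (hω k i ⟨ht.1.trans ?_, hs.2⟩))
  exact_mod_cast hi.1.le

end ObservationStrategy

end DisorderModel

/-! ### Decomposition of the cost at observation times -/

theorem measurable_delayCost {β : Type*} {mβ : MeasurableSpace β} {lam : ℝ} (hlam : 0 < lam)
    (c : ℝ) {p : β → unitInterval} {t : β → ℝ≥0} (hp : Measurable p) (ht : Measurable t) :
    Measurable fun b => delayCost lam c (p b) (t b) := by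
  unfold delayCost
  simp only [integral_noObservationPosterior hlam]
  fun_prop

namespace DisorderModel

namespace ObservationStrategy

variable {Ω : Type*} [mΩ : MeasurableSpace Ω] {α lam c d : ℝ} {M : DisorderModel Ω α lam}

/-- The expected cost of one more observation. -/
theorem setLIntegral_stepCost (S : M.ObservationStrategy) (hlam : 0 < lam)
    (p : unitInterval) (k : ℕ) {g : unitInterval → ℝ≥0∞} (hg : Measurable g) {B : Set Ω}
    (hB : MeasurableSet[S.history k] B) (hBt : ∀ ω ∈ B, S.time (k + 1) ω ≠ ⊤) :
    ∫⁻ ω in B, stepCost α lam c d g (S.posterior p k ω) (S.gap k ω) ∂M.P p =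
      ∫⁻ ω in B, (ENNReal.ofReal d + delayCost lam c (S.posterior p k ω) (S.gap k ω)) ∂M.P p +
      ∫⁻ ω in B, g (S.posterior p (k + 1) ω) ∂M.P p := by
  have hBΩ : MeasurableSet B := S.history_le k _ hB
  have hsub : B ⊆ {ω | S.time (k + 1) ω ≠ ⊤} := hBt
  -- The one-step law is stated on {τ_{k+1} < ∞}; the indicator cuts it down to `B`.
  let χ : Ω → ℝ → ℝ → ℝ≥0∞ := fun ω x _ => (Prod.fst ⁻¹' B : Set (Ω × ℝ)).indicator
    (fun q => g (posteriorUpdate α lam (S.gap k q.1) (S.posterior p k q.1) q.2)) (ω, x)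
  have hχ : Measurable[(S.history k).prod inferInstance]
      fun q : Ω × ℝ × ℝ => χ q.1 q.2.1 q.2.2 := by
    have h1 : Measurable[(S.history k).prod (inferInstance : MeasurableSpace ℝ),
      S.history k] fun q : Ω × ℝ => q.1 := measurable_fst
    have h2 : Measurable[(S.history k).prod (inferInstance : MeasurableSpace ℝ)]
      fun q : Ω × ℝ => q.2 := measurable_snd
    have h3 := Measurable.indicator (hg.comp (Measurable.posteriorUpdate (α := α) hlam.le
      ((S.measurable_gap k).comp h1) ((S.measurable_posterior hlam p k).comp h1) h2)) (h1 hB)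
    have h4 : Measurable[(S.history k).prod (inferInstance : MeasurableSpace (ℝ × ℝ)),
      (S.history k).prod (inferInstance : MeasurableSpace ℝ)]
        fun q : Ω × ℝ × ℝ => (q.1, q.2.1) :=
      Measurable.prodMk (@measurable_fst Ω (ℝ × ℝ) (S.history k) inferInstance)
        (measurable_fst.comp (@measurable_snd Ω (ℝ × ℝ) (S.history k) inferInstance))
    exact h3.comp h4
  have h := (S.isFilteredAt hlam p k).setLIntegral_succ hχ
  have e1 : ∀ ω, χ ω (S.seen (k + 1) ω - S.seen k ω) (S.residual (k + 1) ω) =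
      B.indicator (fun ω => g (S.posterior p (k + 1) ω)) ω := fun ω => by
    by_cases hω : ω ∈ B
    · rw [indicator_of_mem hω]
      exact indicator_of_mem (show (ω, _) ∈ Prod.fst ⁻¹' B from hω) _
    · rw [indicator_of_notMem hω]
      exact indicator_of_notMem (show (ω, _) ∉ Prod.fst ⁻¹' B from hω) _
  have e2 : ∀ ω, transition α lam (S.gap k ω) (S.posterior p k ω) (χ ω) =
      B.indicator (fun ω => transition α lam (S.gap k ω) (S.posterior p k ω) fun x _ =>
        g (posteriorUpdate α lam (S.gap k ω) (S.posterior p k ω) x)) ω := fun ω => by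
    by_cases hω : ω ∈ B
    · rw [indicator_of_mem hω]
      congr 1
      ext x s
      exact indicator_of_mem (show (ω, x) ∈ Prod.fst ⁻¹' B from hω) _
    · rw [indicator_of_notMem hω]
      have : χ ω = fun _ _ => 0 := by
        ext x s
        exact indicator_of_notMem (show (ω, x) ∉ Prod.fst ⁻¹' B from hω) _
      simp [this, transition, priorMix]
  simp_rw [e1, e2] at h
  rw [lintegral_indicator hBΩ, lintegral_indicator hBΩ, Measure.restrict_restrict hBΩ,
    inter_eq_left.2 hsub] at h
  rw [h]
  exact lintegral_add_left (measurable_const.add (measurable_delayCost hlam c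
    ((S.measurable_posterior hlam p k).mono (S.history_le k) le_rfl)
    ((S.measurable_gap k).mono (S.history_le k) le_rfl))) _

/-- The cost that is incurred from the `k`-th observation on. -/
noncomputable def remainingCost (S : M.ObservationStrategy) (c d : ℝ) (A : ℝ≥0 → Ω → ℝ)
    (τ : Ω → ℝ≥0∞) (k : ℕ) (ω : Ω) : ℝ≥0∞ :=
  ENNReal.ofReal (noObservationCost lam c (A (τ ω).toNNReal ω)) +
    ENNReal.ofReal c * (∫⁻ s in {s : ℝ | 0 ≤ s ∧ S.time k ω ≤ ENNReal.ofReal s ∧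
      ENNReal.ofReal s ≤ τ ω}, ENNReal.ofReal (A s.toNNReal ω)) +
    ENNReal.ofReal d * ∑' i : ℕ, (if S.time (k + 1 + i) ω ≤ τ ω then 1 else 0)

theorem cost_eq_lintegral_remainingCost (S : M.ObservationStrategy) (p : ℝ) (A : ℝ≥0 → Ω → ℝ)
    (τ : Ω → ℝ≥0∞) : S.cost c d p A τ = ∫⁻ ω, S.remainingCost c d A τ 0 ω ∂M.P p := by
  simp [cost, remainingCost, S.time_zero, add_comm]

/-- The process `A` is given by the recursive posterior along the path `ω`. -/
def FollowsPosterior (S : M.ObservationStrategy) (p : unitInterval) (A : ℝ≥0 → Ω → ℝ) (ω : Ω) :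
    Prop :=
  ∀ k t, ω ∈ S.countEq k t → A t ω = S.posteriorAfter p k t ω

variable {S : M.ObservationStrategy} {p : unitInterval} {A : ℝ≥0 → Ω → ℝ} {τ : Ω → ℝ≥0∞} {k : ℕ}
  {ω : Ω}

/-- On stopping at τ_k the delay integral is over at most one point and later observations do not
count, so only the terminal cost is left. -/
theorem remainingCost_of_eq (hA : S.FollowsPosterior p A ω) (hk : S.time k ω ≠ ⊤)
    (hτ : τ ω = S.time k ω) : S.remainingCost c d A τ k ω =
      ENNReal.ofReal (noObservationCost lam c (S.posterior p k ω)) := by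
  have h1 : A (τ ω).toNNReal ω = S.posterior p k ω := by
    rw [hA k]
    · simp [posteriorAfter, noObservationPosterior, hτ]
    · rw [hτ]
      simp only [countEq, mem_ofPred_eq, ENNReal.coe_toNNReal hk, le_refl, true_and]
      exact S.time_lt k ω hk
  have h2 : {s : ℝ | 0 ≤ s ∧ S.time k ω ≤ ENNReal.ofReal s ∧ ENNReal.ofReal s ≤ τ ω} ⊆
      {((S.time k ω).toNNReal : ℝ)} := by
    rintro s ⟨h0, h1, h2⟩
    rw [mem_singleton_iff, le_antisymm h1 (h2.trans hτ.le), ENNReal.ofReal, ENNReal.toNNReal_coe,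
      Real.coe_toNNReal s h0]
  have h3 : ∀ i, ¬ S.time (k + 1 + i) ω ≤ τ ω := fun i => by
    rw [hτ, not_le]
    exact (S.time_lt k ω hk).trans_le (S.time_mono ω (by omega))
  rw [remainingCost, h1, Measure.restrict_eq_zero.2 (measure_mono_null h2 (by simp))]
  simp [h3]

/-- With τ = ∞ every index contributes to the sum, even one whose observation time is itself ∞, so d
> 0 makes the cost infinite. -/
theorem remainingCost_of_eq_top (hd : 0 < d) (hτ : τ ω = ⊤) :
    S.remainingCost c d A τ k ω = ⊤ := by
  simp [remainingCost, hτ, hd, ENNReal.mul_top]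

/-- On [τ_k, τ_{k+1}) the posterior is the deterministic evolution started from Π_k; shifting time
by τ_k turns its integral into `delayCost` over the gap. One observation fee is split off the sum.
-/
theorem remainingCost_succ (hlam : 0 < lam) (hc : 0 < c) (hA : S.FollowsPosterior p A ω)
    (hk : S.time (k + 1) ω ≠ ⊤) (hτ : S.time (k + 1) ω ≤ τ ω) :
    S.remainingCost c d A τ k ω =
      ENNReal.ofReal d + delayCost lam c (S.posterior p k ω) (S.gap k ω) +
        S.remainingCost c d A τ (k + 1) ω := by
  have hk' := S.time_ne_top_of_succ hk
  set a := (S.time k ω).toNNReal with ha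
  set b := (S.time (k + 1) ω).toNNReal with hb
  have hat : S.time k ω = a := (ENNReal.coe_toNNReal hk').symm
  have hbt : S.time (k + 1) ω = b := (ENNReal.coe_toNNReal hk).symm
  have hab : (a : ℝ) ≤ b := by exact_mod_cast (S.toNNReal_time_lt hk).le
  have hbτ : (b : ℝ≥0∞) ≤ τ ω := hbt ▸ hτ
  have hset : {s : ℝ | 0 ≤ s ∧ S.time k ω ≤ ENNReal.ofReal s ∧ ENNReal.ofReal s ≤ τ ω} =
      Ico (a : ℝ) b ∪
        {s : ℝ | 0 ≤ s ∧ S.time (k + 1) ω ≤ ENNReal.ofReal s ∧ ENNReal.ofReal s ≤ τ ω} := by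
    have key : ∀ (x : ℝ≥0) {s : ℝ}, 0 ≤ s → ((x : ℝ≥0∞) ≤ ENNReal.ofReal s ↔ (x : ℝ) ≤ s) :=
      fun x s hs => by
        rw [← ENNReal.ofReal_coe_nnreal, ENNReal.ofReal_le_ofReal_iff hs]
    ext s
    simp only [mem_ofPred_eq, mem_union, mem_Ico, hat, hbt]
    constructor
    · rintro ⟨h0, h1, h2⟩
      by_cases h : (b : ℝ) ≤ s
      · exact Or.inr ⟨h0, (key b h0).2 h, h2⟩
      · exact Or.inl ⟨(key a h0).1 h1, not_le.1 h⟩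
    · rintro (⟨h1, h2⟩ | ⟨h0, h1, h2⟩)
      · have h0 : 0 ≤ s := a.coe_nonneg.trans h1
        refine ⟨h0, (key a h0).2 h1, le_trans ?_ hbτ⟩
        rw [← ENNReal.ofReal_coe_nnreal]
        exact ENNReal.ofReal_le_ofReal h2.le
      · exact ⟨h0, (key a h0).2 (hab.trans ((key b h0).1 h1)), h2⟩
  have hdisj : Disjoint (Ico (a : ℝ) b)
      {s : ℝ | 0 ≤ s ∧ S.time (k + 1) ω ≤ ENNReal.ofReal s ∧ ENNReal.ofReal s ≤ τ ω} := by
    refine disjoint_left.2 fun s hs hs' => ?_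
    have := hs'.2.1
    rw [hbt, ← ENNReal.ofReal_coe_nnreal, ENNReal.ofReal_le_ofReal_iff hs'.1] at this
    exact (not_le.2 hs.2) this
  have hmeas : MeasurableSet
      {s : ℝ | 0 ≤ s ∧ S.time (k + 1) ω ≤ ENNReal.ofReal s ∧ ENNReal.ofReal s ≤ τ ω} :=
    measurableSet_Ici.inter ((measurableSet_le measurable_const ENNReal.measurable_ofReal).inter
      (measurableSet_le ENNReal.measurable_ofReal measurable_const))
  have hint : ENNReal.ofReal c * ∫⁻ s in Ico (a : ℝ) b, ENNReal.ofReal (A s.toNNReal ω) =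
      delayCost lam c (S.posterior p k ω) (S.gap k ω) := by
    rw [← lintegral_noObservationPosterior hlam hc, S.coe_gap hk, ← ha, ← hb]
    congr 1
    rw [← lintegral_indicator measurableSet_Ico, ← lintegral_indicator measurableSet_Ico,
      ← lintegral_sub_right_eq_self ((Ico (0 : ℝ) (b - a)).indicator _) (a : ℝ)]
    congr 1
    ext s
    by_cases hs : s ∈ Ico (a : ℝ) b
    · have hs0 : 0 ≤ s := a.coe_nonneg.trans hs.1
      rw [indicator_of_mem hs, indicator_of_mem
        (show s - a ∈ Ico (0 : ℝ) (b - a) from ⟨sub_nonneg.2 hs.1, sub_lt_sub_right hs.2 _⟩),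
        hA k s.toNNReal]
      · rw [posteriorAfter, Real.coe_toNNReal s hs0]
      · simp only [countEq, mem_ofPred_eq, hat, hbt]
        rw [ENNReal.coe_le_coe, ENNReal.coe_lt_coe, Real.le_toNNReal_iff_coe_le hs0,
          Real.toNNReal_lt_iff_lt_coe hs0]
        exact hs
    · rw [indicator_of_notMem hs, indicator_of_notMem]
      rintro ⟨h1, h2⟩
      exact hs ⟨sub_nonneg.1 h1, by linarith⟩
  have hsum : (∑' i : ℕ, (if S.time (k + 1 + i) ω ≤ τ ω then 1 else 0) : ℝ≥0∞) =
      1 + ∑' i : ℕ, (if S.time (k + 1 + 1 + i) ω ≤ τ ω then 1 else 0) := by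
    rw [tsum_eq_zero_add' ENNReal.summable, add_zero, if_pos hτ]
    congr 2
    ext i
    rw [add_right_comm (k + 1) 1 i, add_assoc (k + 1) i 1]
  rw [remainingCost, hset, lintegral_union hmeas hdisj, hsum, mul_add, mul_add, hint, mul_one,
    remainingCost]
  ring

end ObservationStrategy

end DisorderModel

/-! ### Comparison of the cost of a strategy with the iterates -/

namespace DisorderModel

namespace ObservationStrategy

variable {Ω : Type*} [mΩ : MeasurableSpace Ω] {α lam c d : ℝ} {M : DisorderModel Ω α lam}
  {S : M.ObservationStrategy} {p : unitInterval} {A : ℝ≥0 → Ω → ℝ} {τ : Ω → ℝ≥0∞}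

/-- If τ < τ_{k+1}, some time from a countable dense set lies between max(τ, τ_k) and τ_{k+1}. At
such a time {τ ≤ u} is observable, and there the observable information is that of the first k
observations. -/
theorem measurableSet_stop (hτ : IsStoppingTime S.filtration τ) (k : ℕ) :
    MeasurableSet[S.history k] {ω | S.time k ω ≠ ⊤ ∧ τ ω < S.time (k + 1) ω} := by
  let u := TopologicalSpace.denseSeq ℝ≥0
  have : {ω | S.time k ω ≠ ⊤ ∧ τ ω < S.time (k + 1) ω} =
      ⋃ i, {ω | τ ω ≤ u i} ∩ S.countEq k (u i) := by
    ext ω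
    simp only [mem_ofPred_eq, mem_iUnion, mem_inter_iff, countEq]
    constructor
    · rintro ⟨h1, h2⟩
      obtain ⟨r, hr1, hr2⟩ := ENNReal.lt_iff_exists_nnreal_btwn.1 (max_lt h2 (S.time_lt k ω h1))
      obtain ⟨r', hr3, hr4⟩ := ENNReal.lt_iff_exists_nnreal_btwn.1 hr2
      obtain ⟨i, hi⟩ := (TopologicalSpace.denseRange_denseSeq ℝ≥0).exists_mem_open isOpen_Ioo
        (nonempty_Ioo.2 (ENNReal.coe_lt_coe.1 hr3))
      have h3 := hr1.trans (ENNReal.coe_lt_coe.2 hi.1)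
      exact ⟨i, ((le_max_left _ _).trans_lt h3).le, ((le_max_right _ _).trans_lt h3).le,
        (ENNReal.coe_lt_coe.2 hi.2).trans hr4⟩
    · rintro ⟨i, h1, h2, h3⟩
      exact ⟨ne_top_of_le_ne_top ENNReal.coe_ne_top h2, h1.trans_lt h3⟩
  rw [this]
  refine MeasurableSet.iUnion fun i => ?_
  have h := S.filtration_le_traceSpace k (u i) _ (hτ (u i))
  exact h

theorem eq_time_of_lt_succ {k j : ℕ} {ω : Ω} (hj : τ ω = S.time j ω) (h1 : S.time k ω ≤ τ ω)
    (h2 : τ ω < S.time (k + 1) ω) : τ ω = S.time k ω := by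
  refine le_antisymm ?_ h1
  rw [hj] at h2 ⊢
  by_contra h
  rcases le_or_gt j k with h3 | h3
  · exact h (S.time_mono ω h3)
  · exact absurd h2 (not_lt.2 (S.time_mono ω h3))

/-- The events on which the `k`-th observation has been made and the stopping time has not passed
before. -/
def IsActive (S : M.ObservationStrategy) (τ : Ω → ℝ≥0∞) (k : ℕ) (B : Set Ω) : Prop :=
  MeasurableSet[S.history k] B ∧ ∀ ω ∈ B, S.time k ω ≠ ⊤ ∧ S.time k ω ≤ τ ω

variable {k : ℕ} {B : Set Ω}

theorem IsActive.measurableSet (hB : S.IsActive τ k B) : MeasurableSet B :=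
  S.history_le k _ hB.1

theorem IsActive.measurableSet_stopped (hB : S.IsActive τ k B)
    (hτ : IsStoppingTime S.filtration τ) :
    MeasurableSet[S.history k] (B ∩ {ω | τ ω < S.time (k + 1) ω}) := by
  have : B ∩ {ω | τ ω < S.time (k + 1) ω} =
      B ∩ {ω | S.time k ω ≠ ⊤ ∧ τ ω < S.time (k + 1) ω} := by
    ext ω
    exact ⟨fun h => ⟨h.1, (hB.2 ω h.1).1, h.2⟩, fun h => ⟨h.1, h.2.2⟩⟩
  rw [this]
  exact MeasurableSet.inter hB.1 (measurableSet_stop hτ k)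

theorem IsActive.measurableSet_continued (hB : S.IsActive τ k B)
    (hτ : IsStoppingTime S.filtration τ) :
    MeasurableSet[S.history k] (B ∩ {ω | S.time (k + 1) ω ≤ τ ω}) := by
  have : B ∩ {ω | S.time (k + 1) ω ≤ τ ω} = B \ (B ∩ {ω | τ ω < S.time (k + 1) ω}) := by
    ext ω
    simp
  rw [this]
  exact MeasurableSet.diff hB.1 (hB.measurableSet_stopped hτ)

theorem IsActive.measurableSet_continued_ne_top (hB : S.IsActive τ k B)
    (hτ : IsStoppingTime S.filtration τ) :
    MeasurableSet[S.history k]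
      (B ∩ {ω | S.time (k + 1) ω ≤ τ ω} ∩ {ω | S.time (k + 1) ω ≠ ⊤}) :=
  MeasurableSet.inter (hB.measurableSet_continued hτ) (S.measurableSet_time_succ_ne_top k)

theorem IsActive.succ (hB : S.IsActive τ k B)
    (hτ : IsStoppingTime S.filtration τ) :
    S.IsActive τ (k + 1)
      (B ∩ {ω | S.time (k + 1) ω ≤ τ ω} ∩ {ω | S.time (k + 1) ω ≠ ⊤}) :=
  ⟨S.history_mono k.le_succ _ (hB.measurableSet_continued_ne_top hτ), fun _ hω => ⟨hω.2, hω.1.2⟩⟩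

/-- At τ_k one stops, continues to a genuine observation, or has τ = τ_{k+1} = ∞. -/
theorem IsActive.setLIntegral_split (hB : S.IsActive τ k B) (hτ : IsStoppingTime S.filtration τ)
    (μ : Measure Ω) (f : Ω → ℝ≥0∞) :
    ∫⁻ ω in B, f ω ∂μ = ∫⁻ ω in B ∩ {ω | τ ω < S.time (k + 1) ω}, f ω ∂μ +
      (∫⁻ ω in B ∩ {ω | S.time (k + 1) ω ≤ τ ω} ∩ {ω | S.time (k + 1) ω ≠ ⊤}, f ω ∂μ +
      ∫⁻ ω in B ∩ {ω | S.time (k + 1) ω ≤ τ ω} ∩ {ω | S.time (k + 1) ω = ⊤}, f ω ∂μ) := by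
  have h1 : MeasurableSet (B ∩ {ω | S.time (k + 1) ω ≤ τ ω}) :=
    S.history_le k _ (hB.measurableSet_continued hτ)
  have h2 : MeasurableSet {ω | S.time (k + 1) ω = ⊤} :=
    S.measurable_time (k + 1) (measurableSet_singleton ⊤)
  have e1 : B = B ∩ {ω | τ ω < S.time (k + 1) ω} ∪ B ∩ {ω | S.time (k + 1) ω ≤ τ ω} := by
    rw [← inter_union_distrib_left, eq_comm, inter_eq_left]
    exact fun ω _ => lt_or_ge (τ ω) _
  have e2 : B ∩ {ω | S.time (k + 1) ω ≤ τ ω} =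
      B ∩ {ω | S.time (k + 1) ω ≤ τ ω} ∩ {ω | S.time (k + 1) ω ≠ ⊤} ∪
      B ∩ {ω | S.time (k + 1) ω ≤ τ ω} ∩ {ω | S.time (k + 1) ω = ⊤} := by
    rw [← inter_union_distrib_left, eq_comm, inter_eq_left]
    exact fun ω _ => (em _).symm
  conv_lhs => rw [e1]
  rw [lintegral_union h1]
  · conv_lhs => rw [e2]
    rw [lintegral_union (h1.inter h2)]
    exact disjoint_left.2 fun ω hω hω' => hω.2 hω'.2
  · exact disjoint_left.2 fun ω hω hω' => not_lt.2 (show _ ≤ τ ω from hω'.2) hω.2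

/-- Along almost every path the a posteriori probability is given by the recursive posterior, and
the stopping time is one of the observation times. -/
def IsRegular (S : M.ObservationStrategy) (p : unitInterval) (A : ℝ≥0 → Ω → ℝ)
    (τ : Ω → ℝ≥0∞) : Prop :=
  ∀ᵐ ω ∂M.P p, S.FollowsPosterior p A ω ∧ ∃ j, τ ω = S.time j ω

theorem IsPosterior.isRegular (hlam : 0 < lam) (hA : S.IsPosterior p A)
    (hτ : S.IsObservationStoppingTime p τ) : S.IsRegular p A τ :=
  (hA.ae_eq hlam).and hτ.2

theorem IsActive.setLIntegral_stop (hB : S.IsActive τ k B) (hτ : IsStoppingTime S.filtration τ)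
    (hr : S.IsRegular p A τ) :
    ∫⁻ ω in B ∩ {ω | τ ω < S.time (k + 1) ω}, S.remainingCost c d A τ k ω ∂M.P p =
      ∫⁻ ω in B ∩ {ω | τ ω < S.time (k + 1) ω},
        ENNReal.ofReal (noObservationCost lam c (S.posterior p k ω)) ∂M.P p := by
  refine setLIntegral_congr_fun_ae (S.history_le k _ (hB.measurableSet_stopped hτ)) (hr.mono ?_)
  rintro ω ⟨h1, j, hj⟩ hω
  obtain ⟨h2, h3⟩ := hB.2 ω hω.1
  exact remainingCost_of_eq h1 h2 (eq_time_of_lt_succ hj h3 hω.2)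

theorem IsActive.setLIntegral_continue (hB : S.IsActive τ k B)
    (hτ : IsStoppingTime S.filtration τ) (hr : S.IsRegular p A τ) (hlam : 0 < lam) (hc : 0 < c) :
    ∫⁻ ω in B ∩ {ω | S.time (k + 1) ω ≤ τ ω} ∩ {ω | S.time (k + 1) ω ≠ ⊤},
        S.remainingCost c d A τ k ω ∂M.P p =
      ∫⁻ ω in B ∩ {ω | S.time (k + 1) ω ≤ τ ω} ∩ {ω | S.time (k + 1) ω ≠ ⊤},
        (ENNReal.ofReal d + delayCost lam c (S.posterior p k ω) (S.gap k ω)) ∂M.P p +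
      ∫⁻ ω in B ∩ {ω | S.time (k + 1) ω ≤ τ ω} ∩ {ω | S.time (k + 1) ω ≠ ⊤},
        S.remainingCost c d A τ (k + 1) ω ∂M.P p := by
  have hm : Measurable fun ω =>
      ENNReal.ofReal d + delayCost lam c (S.posterior p k ω) (S.gap k ω) :=
    measurable_const.add (measurable_delayCost hlam c
      ((S.measurable_posterior hlam p k).mono (S.history_le k) le_rfl)
      ((S.measurable_gap k).mono (S.history_le k) le_rfl))
  rw [← lintegral_add_left hm]
  refine setLIntegral_congr_fun_ae (S.history_le k _ (hB.measurableSet_continued_ne_top hτ))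
    (hr.mono ?_)
  rintro ω ⟨h1, -⟩ hω
  exact remainingCost_succ hlam hc h1 hω.2 hω.1.2

theorem dpValue_le_noObservationCost (n : ℕ) (q : unitInterval) :
    dpValue α lam c d n q ≤ ENNReal.ofReal (noObservationCost lam c q) := by
  cases n with
  | zero => exact le_rfl
  | succ n => exact min_le_left _ _

theorem dpValue_succ_le_stepCost (n : ℕ) (q : unitInterval) {t : ℝ≥0} (ht : t ≠ 0) :
    dpValue α lam c d (n + 1) q ≤ stepCost α lam c d (dpValue α lam c d n) q t :=
  (min_le_right _ _).trans (iInf_le (fun t : {t : ℝ≥0 // 0 < t} =>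
    stepCost α lam c d (dpValue α lam c d n) q t) ⟨t, pos_iff_ne_zero.2 ht⟩)

/-- Induction on the number m of observations left. Stopping costs the no-observation cost,
continuing costs at least one step followed by the bound for m - 1, and τ = ∞ costs infinity; the
iterate is below each of these. -/
theorem IsActive.setLIntegral_dpValue_le (hlam : 0 < lam) (hc : 0 < c) (hd : 0 < d)
    (hτ : IsStoppingTime S.filtration τ) (hr : S.IsRegular p A τ) {m : ℕ}
    (hB : S.IsActive τ k B) (hle : ∀ᵐ ω ∂M.P p, τ ω ≤ S.time (k + m) ω) :
    ∫⁻ ω in B, dpValue α lam c d m (S.posterior p k ω) ∂M.P p ≤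
      ∫⁻ ω in B, S.remainingCost c d A τ k ω ∂M.P p := by
  induction m generalizing k B with
  | zero =>
    refine setLIntegral_mono_ae' hB.measurableSet ((hr.and hle).mono ?_)
    rintro ω ⟨⟨h1, -⟩, h2⟩ hω
    obtain ⟨h3, h4⟩ := hB.2 ω hω
    rw [remainingCost_of_eq h1 h3 (le_antisymm h2 h4)]
    exact le_rfl
  | succ m ih =>
    rw [hB.setLIntegral_split hτ, hB.setLIntegral_split hτ (M.P p)
      (S.remainingCost c d A τ k), hB.setLIntegral_stop hτ hr]
    refine add_le_add (lintegral_mono fun ω => dpValue_le_noObservationCost _ _)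
      (add_le_add ?_ ?_)
    · rw [hB.setLIntegral_continue hτ hr hlam hc]
      refine le_trans ?_ (add_le_add_right (ih (hB.succ hτ) (by rwa [add_right_comm])) _)
      rw [← S.setLIntegral_stepCost hlam p k (measurable_dpValue hlam hc m)
        (hB.measurableSet_continued_ne_top hτ) fun ω hω => hω.2]
      refine setLIntegral_mono' (S.history_le k _ (hB.measurableSet_continued_ne_top hτ))
        fun ω hω => ?_
      exact dpValue_succ_le_stepCost _ _ (S.gap_ne_zero hω.2)
    · refine setLIntegral_mono' ((S.history_le k _ (hB.measurableSet_continued hτ)).inter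
        (S.measurable_time (k + 1) (measurableSet_singleton ⊤))) fun ω hω => ?_
      rw [remainingCost_of_eq_top hd (top_le_iff.1 (hω.2 ▸ hω.1.2))]
      exact le_top

/-- Near optimality of the actions that are taken after at most `n` observations. -/
def IsNearlyOptimal (S : M.ObservationStrategy) (c d : ℝ) (n : ℕ) (p : unitInterval)
    (τ : Ω → ℝ≥0∞) (ε : ℝ≥0∞) : Prop :=
  ∀ k m, k + m = n → ∀ ω, S.time k ω ≠ ⊤ → S.time k ω ≤ τ ω →
    τ ω < S.time (k + 1) ω ∧ ENNReal.ofReal (noObservationCost lam c (S.posterior p k ω)) ≤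
      dpValue α lam c d m (S.posterior p k ω) ∨
    S.time (k + 1) ω ≤ τ ω ∧ S.time (k + 1) ω ≠ ⊤ ∧ ∃ i, m = i + 1 ∧
      stepCost α lam c d (dpValue α lam c d i) (S.posterior p k ω) (S.gap k ω) ≤
        dpValue α lam c d m (S.posterior p k ω) + ε

/-- The same induction with the inequalities reversed by near optimality. Every further observation
adds at most ε. -/
theorem IsActive.le_setLIntegral_dpValue (hlam : 0 < lam) (hc : 0 < c)
    (hτ : IsStoppingTime S.filtration τ) (hr : S.IsRegular p A τ) {n m : ℕ} {ε : ℝ≥0∞}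
    (hopt : S.IsNearlyOptimal c d n p τ ε) (hB : S.IsActive τ k B) (hkm : k + m = n) :
    ∫⁻ ω in B, S.remainingCost c d A τ k ω ∂M.P p ≤
      ∫⁻ ω in B, dpValue α lam c d m (S.posterior p k ω) ∂M.P p + m * ε := by
  have hP := M.isProbabilityMeasure p p.2
  induction m generalizing k B with
  | zero =>
    refine le_add_right (setLIntegral_mono_ae' hB.measurableSet (hr.mono ?_))
    rintro ω ⟨h1, j, hj⟩ hω
    obtain ⟨h3, h4⟩ := hB.2 ω hω
    rcases hopt k 0 hkm ω h3 h4 with ⟨h5, -⟩ | ⟨-, -, i, hi, -⟩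
    · rw [remainingCost_of_eq h1 h3 (eq_time_of_lt_succ hj h4 h5)]
      exact le_rfl
    · exact absurd hi (by omega)
  | succ m ih =>
    have key := hopt k (m + 1) hkm
    rw [hB.setLIntegral_split hτ, hB.setLIntegral_split hτ (M.P p)
      (fun ω => dpValue α lam c d (m + 1) (S.posterior p k ω)), hB.setLIntegral_stop hτ hr,
      hB.setLIntegral_continue hτ hr hlam hc]
    have h1 : ∫⁻ ω in B ∩ {ω | τ ω < S.time (k + 1) ω},
        ENNReal.ofReal (noObservationCost lam c (S.posterior p k ω)) ∂M.P p ≤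
        ∫⁻ ω in B ∩ {ω | τ ω < S.time (k + 1) ω},
          dpValue α lam c d (m + 1) (S.posterior p k ω) ∂M.P p := by
      refine setLIntegral_mono' (S.history_le k _ (hB.measurableSet_stopped hτ)) fun ω hω => ?_
      obtain ⟨h3, h4⟩ := hB.2 ω hω.1
      rcases key ω h3 h4 with ⟨-, h5⟩ | ⟨h5, -⟩
      · exact h5
      · exact absurd hω.2 (not_lt.2 h5)
    have h2 := ih (hB.succ hτ) (by omega)
    -- A nearly optimal strategy continues only to a finite observation time, so the branch of
    -- infinite cost is empty.
    have h3 : B ∩ {ω | S.time (k + 1) ω ≤ τ ω} ∩ {ω | S.time (k + 1) ω = ⊤} = ∅ := by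
      refine eq_empty_of_forall_notMem fun ω hω => ?_
      obtain ⟨h3, h4⟩ := hB.2 ω hω.1.1
      rcases key ω h3 h4 with ⟨h5, -⟩ | ⟨-, h5, -⟩
      · exact not_lt.2 hω.1.2 h5
      · exact h5 hω.2
    rw [h3, Measure.restrict_empty, lintegral_zero_measure, lintegral_zero_measure, add_zero,
      add_zero]
    set C := B ∩ {ω | S.time (k + 1) ω ≤ τ ω} ∩ {ω | S.time (k + 1) ω ≠ ⊤} with hC
    have hCΩ : MeasurableSet C := S.history_le k _ (hB.measurableSet_continued_ne_top hτ)
    have h4 : ∫⁻ ω in C, stepCost α lam c d (dpValue α lam c d m) (S.posterior p k ω)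
        (S.gap k ω) ∂M.P p ≤
        ∫⁻ ω in C, dpValue α lam c d (m + 1) (S.posterior p k ω) ∂M.P p + ε := by
      calc _ ≤ ∫⁻ ω in C, (dpValue α lam c d (m + 1) (S.posterior p k ω) + ε) ∂M.P p := by
            refine setLIntegral_mono' hCΩ fun ω hω => ?_
            obtain ⟨h5, h6⟩ := hB.2 ω hω.1.1
            rcases key ω h5 h6 with ⟨h7, -⟩ | ⟨-, -, i, hi, h7⟩
            · exact absurd hω.1.2 (not_le.2 h7)
            · obtain rfl : m = i := by omega
              exact h7
        _ = ∫⁻ ω in C, dpValue α lam c d (m + 1) (S.posterior p k ω) ∂M.P p + ε * M.P p C := by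
            rw [lintegral_add_right _ measurable_const, setLIntegral_const]
        _ ≤ _ := by
            gcongr
            -- The loss in this step is ε times the probability of continuing, hence at most ε.
            exact (mul_le_mul_right prob_le_one ε).trans (mul_one ε).le
    rw [S.setLIntegral_stepCost hlam p k (measurable_dpValue hlam hc m)
        (hB.measurableSet_continued_ne_top hτ) fun ω hω => hω.2] at h4
    refine (add_le_add h1 (add_le_add le_rfl h2)).trans ?_
    rw [add_assoc, ← add_assoc (∫⁻ ω in C, _ ∂M.P p)]
    refine (add_le_add le_rfl (add_le_add h4 le_rfl)).trans (le_of_eq ?_)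
    push_cast
    ring

theorem isActive_univ (τ : Ω → ℝ≥0∞) : S.IsActive τ 0 univ :=
  ⟨MeasurableSet.univ, fun ω _ => by simp [S.time_zero]⟩

theorem dpValue_le_cost (hlam : 0 < lam) (hc : 0 < c) (hd : 0 < d) {n : ℕ}
    (hτ : S.IsObservationStoppingTime p τ) (hle : ∀ᵐ ω ∂M.P p, τ ω ≤ S.time n ω)
    (hA : S.IsPosterior p A) : dpValue α lam c d n p ≤ S.cost c d p A τ := by
  have hP := M.isProbabilityMeasure p p.2
  have h := (isActive_univ τ).setLIntegral_dpValue_le (c := c) (d := d) (m := n) hlam hc hd hτ.1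
    (hA.isRegular hlam hτ) (by simpa using hle)
  simpa [cost_eq_lintegral_remainingCost, posterior] using h

theorem cost_le_dpValue (hlam : 0 < lam) (hc : 0 < c) {n : ℕ} {ε : ℝ≥0∞}
    (hτ : S.IsObservationStoppingTime p τ) (hopt : S.IsNearlyOptimal c d n p τ ε)
    (hA : S.IsPosterior p A) : S.cost c d p A τ ≤ dpValue α lam c d n p + n * ε := by
  have hP := M.isProbabilityMeasure p p.2
  have h := (isActive_univ τ).le_setLIntegral_dpValue hlam hc hτ.1 (hA.isRegular hlam hτ) hopt
    (zero_add n)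
  simpa [cost_eq_lintegral_remainingCost, posterior] using h

end ObservationStrategy

end DisorderModel

namespace DisorderModel

variable {Ω : Type*} [mΩ : MeasurableSpace Ω] {α lam c d : ℝ} {M : DisorderModel Ω α lam}

namespace ObservationStrategy

/-! ### Strategies with a bounded number of observations -/

/-- The last of the first `n` observation times that is finite. -/
noncomputable def lastTime (S : M.ObservationStrategy) : ℕ → Ω → ℝ≥0∞
  | 0, _ => 0
  | n + 1, ω => if S.time (n + 1) ω = ⊤ then S.lastTime n ω else S.time (n + 1) ω

/-- The recursive posterior at time `t` if only the first `n` observations are used. -/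
noncomputable def posteriorUpTo (S : M.ObservationStrategy) (p : unitInterval) :
    ℕ → ℝ≥0 → Ω → ℝ
  | 0, t, ω => S.posteriorAfter p 0 t ω
  | n + 1, t, ω =>
    if S.time (n + 1) ω ≤ t then S.posteriorAfter p (n + 1) t ω else S.posteriorUpTo p n t ω

variable {S : M.ObservationStrategy} {p : unitInterval} {n : ℕ}

theorem exists_lastTime_eq (n : ℕ) (ω : Ω) : ∃ j ≤ n, S.lastTime n ω = S.time j ω ∧
    S.time j ω ≠ ⊤ ∧ (j = n ∨ S.time (j + 1) ω = ⊤) := by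
  induction n with
  | zero => exact ⟨0, le_rfl, by simp [lastTime, S.time_zero], by simp [S.time_zero], Or.inl rfl⟩
  | succ n ih =>
    rw [lastTime]
    split_ifs with h
    · obtain ⟨j, hj, h1, h2, h3⟩ := ih
      refine ⟨j, by omega, h1, h2, Or.inr ?_⟩
      rcases h3 with rfl | h3
      · exact h
      · exact h3
    · exact ⟨n + 1, le_rfl, rfl, h, Or.inl rfl⟩

theorem time_le_lastTime {j : ℕ} (hj : j ≤ n) {ω : Ω} (h : S.time j ω ≠ ⊤) :
    S.time j ω ≤ S.lastTime n ω := by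
  obtain ⟨i, hi, h1, h2, h3⟩ := S.exists_lastTime_eq n ω
  rw [h1]
  rcases le_or_gt j i with h4 | h4
  · exact S.time_mono ω h4
  · rcases h3 with rfl | h3
    · omega
    · exact absurd (top_le_iff.1 (h3 ▸ S.time_mono ω h4)) h

theorem lastTime_eq_of_succ_eq_top {j : ℕ} (hj : j ≤ n) {ω : Ω} (h : S.time j ω ≠ ⊤)
    (h' : S.time (j + 1) ω = ⊤) : S.lastTime n ω = S.time j ω := by
  refine le_antisymm ?_ (time_le_lastTime hj h)
  obtain ⟨i, hi, h1, h2, h3⟩ := S.exists_lastTime_eq n ω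
  rw [h1]
  refine S.time_mono ω ?_
  by_contra h4
  exact h2 (top_le_iff.1 (h' ▸ S.time_mono ω (by omega : j + 1 ≤ i)))

/-- The next time τ_{k+1} is known at τ_k, so it is observable whether the current observation is
the last one; no look into the future is involved. -/
theorem isObservationStoppingTime_lastTime (hS : ∀ ω, S.time (n + 1) ω = ⊤) (p : ℝ) :
    S.IsObservationStoppingTime p (S.lastTime n) := by
  refine ⟨fun t => ?_, Eventually.of_forall fun ω =>
    let ⟨j, _, h, _⟩ := S.exists_lastTime_eq n ω; ⟨j, h⟩⟩
  have : {ω | S.lastTime n ω ≤ t} =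
      ⋃ k ∈ Finset.range (n + 1), {ω | S.time (k + 1) ω = ⊤} ∩ S.countEq k t := by
    ext ω
    simp only [mem_ofPred_eq, mem_iUnion, Finset.mem_range, exists_prop, mem_inter_iff, countEq]
    constructor
    · intro h
      obtain ⟨j, hj, h1, h2, h3⟩ := S.exists_lastTime_eq n ω
      have h4 : S.time (j + 1) ω = ⊤ := by
        rcases h3 with rfl | h3
        · exact hS ω
        · exact h3
      exact ⟨j, by omega, h4, h1 ▸ h, h4 ▸ ENNReal.coe_lt_top⟩
    · rintro ⟨k, hk, h1, h2, h3⟩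
      rw [lastTime_eq_of_succ_eq_top (by omega) (ne_top_of_le_ne_top ENNReal.coe_ne_top h2) h1]
      exact h2
  change MeasurableSet[S.filtration t] {ω | S.lastTime n ω ≤ t}
  rw [this]
  refine Finset.measurableSet_biUnion _ fun k _ => ?_
  exact S.history_le_traceSpace k t _
    (S.measurable_time_succ_history k (measurableSet_singleton ⊤))

theorem lastTime_le_time (n : ℕ) (ω : Ω) : S.lastTime n ω ≤ S.time n ω := by
  obtain ⟨j, hj, h, -⟩ := S.exists_lastTime_eq n ω
  exact h ▸ S.time_mono ω hj

theorem posteriorUpTo_eq {k : ℕ} (hk : k ≤ n) {t : ℝ≥0} {ω : Ω} (h : ω ∈ S.countEq k t) :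
    S.posteriorUpTo p n t ω = S.posteriorAfter p k t ω := by
  induction n with
  | zero => rw [Nat.le_zero.1 hk, posteriorUpTo]
  | succ n ih =>
    rw [posteriorUpTo]
    rcases Nat.le_succ_iff.1 hk with h1 | rfl
    · rw [if_neg (not_le.2 (h.2.trans_le (S.time_mono ω (by omega)))), ih h1]
    · rw [if_pos h.1]

theorem exists_countEq (hS : ∀ ω, S.time (n + 1) ω = ⊤) (t : ℝ≥0) (ω : Ω) :
    ∃ k ≤ n, ω ∈ S.countEq k t := by
  have h : ∃ k, (t : ℝ≥0∞) < S.time (k + 1) ω := ⟨n, hS ω ▸ ENNReal.coe_lt_top⟩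
  classical
  refine ⟨Nat.find h, Nat.find_min' h (hS ω ▸ ENNReal.coe_lt_top), ?_, Nat.find_spec h⟩
  cases hk : Nat.find h with
  | zero => simp [S.time_zero]
  | succ k => exact not_lt.1 (Nat.find_min h (hk ▸ k.lt_succ_self))

theorem continuousWithinAt_posteriorUpTo (S : M.ObservationStrategy) (p : unitInterval) (n : ℕ)
    (ω : Ω) (t : ℝ≥0) : ContinuousWithinAt (fun s => S.posteriorUpTo p n s ω) (Ici t) t := by
  have h0 : ∀ k, ContinuousWithinAt (fun s => S.posteriorAfter p k s ω) (Ici t) t := fun k => by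
    refine Continuous.continuousWithinAt ?_
    unfold posteriorAfter noObservationPosterior
    fun_prop
  induction n with
  | zero => exact h0 0
  | succ n ih =>
    by_cases h : S.time (n + 1) ω ≤ t
    · refine (h0 (n + 1)).congr (fun s hs => ?_) ?_
      · rw [posteriorUpTo, if_pos (h.trans (ENNReal.coe_le_coe.2 hs))]
      · rw [posteriorUpTo, if_pos h]
    · have h1 : ∀ᶠ s : ℝ≥0 in 𝓝 t, (s : ℝ≥0∞) < S.time (n + 1) ω :=
        (ENNReal.continuous_coe.tendsto t).eventually (gt_mem_nhds (not_le.1 h))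
      refine ih.congr_of_eventuallyEq
        ((h1.filter_mono (nhdsWithin_le_nhds (s := Ici t))).mono fun s hs => ?_) ?_
      · exact if_neg (not_le.2 hs)
      · exact if_neg h

/-- The value is an infimum over versions of the posterior as well, so the upper bound needs one
version that is right-continuous along every path. -/
theorem isPosterior_posteriorUpTo (hlam : 0 < lam) (hS : ∀ ω, S.time (n + 1) ω = ⊤)
    (p : unitInterval) : S.IsPosterior p (S.posteriorUpTo p n) := by
  refine ⟨S.continuousWithinAt_posteriorUpTo p n, fun t => ?_⟩
  filter_upwards [ae_all_iff.2 fun k => S.condExp_eq_posteriorAfter hlam p k t] with ω hω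
  obtain ⟨k, hk, h⟩ := exists_countEq hS t ω
  rw [hω k h, posteriorUpTo_eq hk h]

end ObservationStrategy

/-! ### Strategies that wait for a time depending on the posterior -/

/-- One step of the recursion for the time, the observed value, and the posterior. -/
noncomputable def observationStep (α lam : ℝ) (s : ℝ≥0∞ × ℝ × unitInterval) (o : ℝ≥0∞ × ℝ) :
    ℝ≥0∞ × ℝ × unitInterval :=
  (o.1, o.2, posteriorUpdate α lam (o.1.toNNReal - s.1.toNNReal) s.2.2 (o.2 - s.2.1))

/-- The time, the observed value, and the posterior at the `k`-th observation, if after the `k`-th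
observation one waits for the time `T k q`, where `q` is the current posterior. -/
noncomputable def waitingState (M : DisorderModel Ω α lam) (p : unitInterval)
    (T : ℕ → unitInterval → ℝ≥0∞) : ℕ → Ω → ℝ≥0∞ × ℝ × unitInterval
  | 0, _ => (0, 0, p)
  | k + 1, ω => observationStep α lam (M.waitingState p T k ω)
      (M.observation (fun ω => (M.waitingState p T k ω).1 + T k (M.waitingState p T k ω).2.2) ω)

theorem waitingState_succ_fst (M : DisorderModel Ω α lam) (p : unitInterval)
    (T : ℕ → unitInterval → ℝ≥0∞) (k : ℕ) (ω : Ω) : (M.waitingState p T (k + 1) ω).1 =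
      (M.waitingState p T k ω).1 + T k (M.waitingState p T k ω).2.2 := rfl

/-- The state is a measurable function of the preceding state and the new observation, so the
recursion stays within the σ-algebra of its own observations and the strategy is admissible. -/
theorem measurable_waitingState (M : DisorderModel Ω α lam) (hlam : 0 < lam) (p : unitInterval)
    {T : ℕ → unitInterval → ℝ≥0∞} (k : ℕ) :
    Measurable[⨆ i ∈ Finset.Icc 1 k, MeasurableSpace.comap
      (M.observation fun ω => (M.waitingState p T i ω).1) inferInstance]
      (M.waitingState p T k) := by
  induction k with
  | zero => exact measurable_const
  | succ k ih =>
    have h1 := ih.mono (iSup₂_mono' fun i hi => ⟨i, Finset.mem_Icc.2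
      ⟨(Finset.mem_Icc.1 hi).1, (Finset.mem_Icc.1 hi).2.trans k.le_succ⟩, le_rfl⟩ :
      _ ≤ ⨆ i ∈ Finset.Icc 1 (k + 1), MeasurableSpace.comap
        (M.observation fun ω => (M.waitingState p T i ω).1) inferInstance) le_rfl
    have h2 : Measurable[⨆ i ∈ Finset.Icc 1 (k + 1), MeasurableSpace.comap
        (M.observation fun ω => (M.waitingState p T i ω).1) inferInstance]
        (M.observation fun ω => (M.waitingState p T (k + 1) ω).1) :=
      (comap_measurable _).mono (le_iSup₂_of_le (k + 1)
        (Finset.mem_Icc.2 ⟨by omega, le_rfl⟩) le_rfl) le_rfl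
    have h3 : Measurable fun q : (ℝ≥0∞ × ℝ × unitInterval) × ℝ≥0∞ × ℝ =>
        observationStep α lam q.1 q.2 := by
      refine (measurable_fst.comp measurable_snd).prodMk
        ((measurable_snd.comp measurable_snd).prodMk ?_)
      exact Measurable.posteriorUpdate hlam.le (by fun_prop) (by fun_prop) (by fun_prop)
    exact h3.comp (h1.prodMk h2)

/-- The strategy of waiting for the time `T k q` after the `k`-th observation, where `q` is the
current posterior. -/
noncomputable def waitingStrategy (M : DisorderModel Ω α lam) (hlam : 0 < lam) (p : unitInterval)
    (T : ℕ → unitInterval → ℝ≥0∞) (hT : ∀ k, Measurable (T k)) (hT0 : ∀ k q, T k q ≠ 0) :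
    M.ObservationStrategy where
  time k ω := (M.waitingState p T k ω).1
  time_zero _ := rfl
  time_lt k ω h := ENNReal.lt_add_right h (hT0 k _)
  time_top k ω h := by rw [waitingState_succ_fst, h, top_add]
  time_one := ⟨0 + T 0 p, fun _ => rfl⟩
  measurable_time_succ j _ := by
    have h := M.measurable_waitingState hlam p (T := T) j
    exact (measurable_fst.comp h).add ((hT j).comp (measurable_snd.comp (measurable_snd.comp h)))

section

variable (M) (hlam : 0 < lam) (p : unitInterval) {T : ℕ → unitInterval → ℝ≥0∞}
  (hT : ∀ k, Measurable (T k)) (hT0 : ∀ k q, T k q ≠ 0)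

/-- The posterior carried along to define the strategy is the recursive posterior of the strategy so
defined. -/
theorem waitingState_eq (k : ℕ) (ω : Ω) : M.waitingState p T k ω =
    ((M.waitingStrategy hlam p T hT hT0).time k ω, (M.waitingStrategy hlam p T hT hT0).seen k ω,
      (M.waitingStrategy hlam p T hT hT0).posterior p k ω) := by
  induction k with
  | zero => rfl
  | succ k ih =>
    have h1 : (M.waitingState p T (k + 1) ω).2.1 =
        (M.waitingStrategy hlam p T hT hT0).seen (k + 1) ω := by
      rw [ObservationStrategy.seen, if_neg k.succ_ne_zero]
      rfl
    refine Prod.ext rfl (Prod.ext h1 ?_)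
    change posteriorUpdate α lam _ _ ((M.waitingState p T (k + 1) ω).2.1 - _) = _
    rw [h1, ih]
    rfl

theorem waitingStrategy_time_succ (k : ℕ) (ω : Ω) :
    (M.waitingStrategy hlam p T hT hT0).time (k + 1) ω =
      (M.waitingStrategy hlam p T hT hT0).time k ω +
        T k ((M.waitingStrategy hlam p T hT hT0).posterior p k ω) := by
  have h := M.waitingState_eq hlam p hT hT0 k ω
  change (M.waitingState p T k ω).1 + T k (M.waitingState p T k ω).2.2 = _
  rw [h]

end

/-! ### Nearly optimal strategies and the conclusion -/

theorem value_le_dpValue_add (M : DisorderModel Ω α lam) (hlam : 0 < lam) (hc : 0 < c)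
    (n : ℕ) (p : unitInterval) {ε : ℝ≥0∞} (hε : ε ≠ 0) :
    M.value c d n p ≤ dpValue α lam c d n p + n * ε := by
  choose s hs hs0 hs1 hs2 using
    fun m => exists_measurable_waitingTime (α := α) (d := d) hlam hc m hε
  -- After k < n observations there remain n - k, and `s m` is nearly optimal for m + 1 of them, so
  -- m = n - 1 - k. From index n on the waiting time is ∞, which caps the number of observations.
  let T : ℕ → unitInterval → ℝ≥0∞ := fun k q => if k < n then s (n - 1 - k) q else ⊤
  have hT : ∀ k, Measurable (T k) := fun k => by
    by_cases h : k < n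
    · simpa only [T, h, if_true] using hs _
    · simpa only [T, h, if_false] using measurable_const
  have hT0 : ∀ k q, T k q ≠ 0 := fun k q => by
    by_cases h : k < n
    · simpa only [T, h, if_true] using hs0 _ q
    · simp only [T, h, if_false, ne_eq, ENNReal.top_ne_zero, not_false_eq_true]
  let S := M.waitingStrategy hlam p T hT hT0
  have htime : ∀ k ω, S.time (k + 1) ω = S.time k ω + T k (S.posterior p k ω) :=
    M.waitingStrategy_time_succ hlam p hT hT0
  have hS : ∀ ω, S.time (n + 1) ω = ⊤ := fun ω => by simp [htime, T]
  have hopt : S.IsNearlyOptimal c d n p (S.lastTime n) ε := by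
    intro k m hkm ω h1 h2
    have hkn : k ≤ n := by omega
    cases m with
    | zero =>
      obtain rfl : k = n := hkm
      left
      rw [ObservationStrategy.lastTime_eq_of_succ_eq_top hkn h1 (hS ω), hS ω]
      exact ⟨lt_top_iff_ne_top.2 h1, le_rfl⟩
    | succ m =>
      have hTk : T k (S.posterior p k ω) = s m (S.posterior p k ω) := by
        simp only [T, if_pos (by omega : k < n), show n - 1 - k = m by omega]
      have h3 := htime k ω
      rw [hTk] at h3
      by_cases h4 : s m (S.posterior p k ω) = ⊤
      · rw [h4, add_top] at h3
        left
        rw [ObservationStrategy.lastTime_eq_of_succ_eq_top hkn h1 h3, h3]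
        exact ⟨lt_top_iff_ne_top.2 h1, (hs1 m _ h4).ge⟩
      · have h5 : S.time (k + 1) ω ≠ ⊤ := by
          rw [h3]
          exact ENNReal.add_ne_top.2 ⟨h1, h4⟩
        have h6 : S.gap k ω = (s m (S.posterior p k ω)).toNNReal := by
          rw [ObservationStrategy.gap, h3, ENNReal.toNNReal_add h1 h4, add_tsub_cancel_left]
        refine Or.inr ⟨ObservationStrategy.time_le_lastTime (by omega) h5, h5, m, rfl, ?_⟩
        rw [h6]
        exact hs2 m _ h4
  have hτ := ObservationStrategy.isObservationStoppingTime_lastTime hS p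
  refine le_trans ?_ (ObservationStrategy.cost_le_dpValue hlam hc hτ hopt
    (ObservationStrategy.isPosterior_posteriorUpTo hlam hS p))
  exact iInf₂_le_of_le S (S.lastTime n) (iInf₂_le_of_le hτ
    (Eventually.of_forall (ObservationStrategy.lastTime_le_time n)) (iInf₂_le _
    (ObservationStrategy.isPosterior_posteriorUpTo hlam hS p)))

theorem value_eq_dpValue (M : DisorderModel Ω α lam) (hlam : 0 < lam) (hc : 0 < c) (hd : 0 < d)
    (n : ℕ) (p : unitInterval) : M.value c d n p = dpValue α lam c d n p := by
  refine le_antisymm (ENNReal.le_of_forall_pos_le_add fun ε hε _ => ?_) ?_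
  -- Dividing by n + 1 rather than n avoids division by zero when no observation is allowed.
  · have h0 : (ε : ℝ≥0∞) / (n + 1) ≠ 0 :=
      ENNReal.div_ne_zero.2 ⟨by exact_mod_cast hε.ne', by finiteness⟩
    refine (M.value_le_dpValue_add hlam hc n p h0).trans (add_le_add le_rfl ?_)
    calc (n : ℝ≥0∞) * (ε / (n + 1)) ≤ (n + 1) * (ε / (n + 1)) := by gcongr; exact le_self_add
      _ = ε := ENNReal.mul_div_cancel (by simp) (by finiteness)
  · refine le_iInf fun S => le_iInf fun τ => le_iInf fun hτ => le_iInf fun hle => le_iInf fun A =>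
      le_iInf fun hA => ObservationStrategy.dpValue_le_cost hlam hc hd hτ hle hA

end DisorderModel

theorem mainTheorem3 {Ω : Type*} [MeasurableSpace Ω] {α lam c d : ℝ}
    (hlam : 0 < lam) (hc : 0 < c) (hd : 0 < d)
    (M : DisorderModel Ω α lam) (n : ℕ) (p : ℝ) (hp : p ∈ Set.Icc (0 : ℝ) 1) :
    ((M.value c d n p : ℝ≥0∞) : EReal) = ((M.iterates c d n p : ℝ) : EReal) := by
  obtain ⟨h1, h2⟩ := M.iterates_eq_dpValue hlam hc hd n ⟨p, hp⟩
  have h3 := M.value_eq_dpValue hlam hc hd n ⟨p, hp⟩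
  simp only at h1 h2 h3
  -- `ENNReal.ofReal` truncates at 0, so nonnegativity of the iterate is what yields the equality.
  rw [h3, ← h2, EReal.coe_ennreal_ofReal, max_eq_left h1]
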